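/- Let $d\ge 1$, $T>0$, $I=[0,T]^d$, and let $E=\mathcal C(I)$ be the space of real continuous functions on $I$ with the sup-norm $\|\cdot\|$. Let $X$ be a centered Gaussian random vector in $E$, let $\xi_1,\xi_2,\dots$ be i.i.d. $\mathcal N(0,1)$ random variables, and let $r\in(0,\infty)$. Definitions. A sequence $(f_j)_{j\ge1}$ in $E$ is admissible for $X$ if $\sum_{j\ge1}\xi_jf_j$ converges a.s. in $E$ and has the same distribution as $X$; in this case $X$ is identified with $\sum_{j\ge1}\xi_jf_j$. For a Banach-space valued random vector $Z$, an $N$-quantization of $Z$ is a random vector $\widehat Z$ with at most $N$ values; it is $L^r$-optimal if $(\mathbb E\|Z-\widehat Z\|^r)^{1/r}$ is minimal among all $N$-quantizations of $Z$. An $L^r$-product $N$-quantization of $X$ with respect to an admissible sequence $(f_j)$ is a random vector $\widehat X=\sum_{j=1}^m\widehat\xi_jf_j$, where $m,N_1,\dots,N_m\ge1$ are integers with $\prod_{j=1}^mN_j\le N$ and $\widehat\xi_j$ is an $L^r$-optimal $N_j$-quantization of $\xi_j$. The minimal $N$-th product quantization error $e^{(\mathrm{prod})}_{N,r}(X)$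 is the infimum of $(\mathbb E\|X-\widehat X\|^r)^{1/r}$ over all sequences $(f_j)$ admissible for $X$ and all $L^r$-product $N$-quantizations $\widehat X$ with respect to $(f_j)$. Theorem. Let $\vartheta>1/2$, $\gamma\ge0$, $a\in(0,1]$, $b\in\mathbb R$ and $C_1,C_2<\infty$, and assume that $X$ has an admissible sequence $(f_j)_{j\ge1}$ in $E$ such that for every $j\ge1$ (A1) $\|f_j\|\le C_1\,j^{-\vartheta}(\log(1+j))^{\gamma}$, and (A2) $[f_j]_a:=\sup_{s\ne t}\dfrac{|f_j(s)-f_j(t)|}{|s-t|^a}\le C_2\,j^{b}$, where $|s-t|$ is the Euclidean distance. Then there is a finite constant $C$, depending only on $T,d,\vartheta,\gamma,a,b,C_1,C_2,r$, such that for every integer $N\ge3$ $$e^{(\mathrm{prod})}_{N,r}(X)\le \frac{C(\log\log N)^{\vartheta+\gamma}}{(\log N)^{\vartheta-1/2}},$$ and, if $b+\vartheta\le0$, $$e^{(\mathrm{prod})}_{N,r}(X)\le \frac{C(\log\log N)^{\vartheta+\gamma-1/2}}{(\log N)^{\vartheta-1/2}}.$$ Furthermore, these rates are achieved by the following product quantizations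 with respect to the given sequence $(f_j)$. Let $j_0=[e^{\gamma/\vartheta}]$, let $\nu_j=j^{-\vartheta}(\log(1+j))^\gamma$ for $j\ge j_0$ and $\nu_j=\nu_{j_0}$ for $j<j_0$, and for $1\le j\le m$ put $$z_j=z_j(N,m)=N^{1/m}\nu_j\Big(\prod_{k=1}^m\nu_k\Big)^{-1/m}.$$ There exist integers $m(N)\ge1$ such that $z_{m(N)}(N,m(N))\ge1$ and $m(N)\le \frac{2\log N}{\log\log N}$ for all $N\ge3$, and $m(N)\sim\frac{2\log N}{\log\log N}$ as $N\to\infty$. For every such choice of $(m(N))_{N\ge 3}$ and every $N\ge3$, there exists an $L^r$-product $N$-quantization $\widehat X$ of $X$ with respect to $(f_j)$ with $m=m(N)$ and $N_j=[z_j(N,m(N))]$, $1\le j\le m(N)$, and every such $\widehat X$ satisfies the above bounds with $(\mathbb E\|X-\widehat X\|^r)^{1/r}$ in place of $e^{(\mathrm{prod})}_{N,r}(X)$, with a constant $C$ that depends only on $T,d,\vartheta,\gamma,a,b,C_1,C_2,r$ and the chosen sequence $(m(N))_{N\ge3}$. -/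

import Mathlib

open MeasureTheory ProbabilityTheory Filter Topology
open scoped NNReal ENNReal

noncomputable section

namespace ProdQuant

/-- The cube `[0,T]^d`, with the Euclidean (l2) distance. -/
def cube (T : ℝ) (d : ℕ) : Set (EuclideanSpace ℝ (Fin d)) :=
  {t | ∀ i, t i ∈ Set.Icc (0 : ℝ) T}

theorem isCompact_cube (T : ℝ) (d : ℕ) : IsCompact (cube T d) := by
  have h : cube T d = (EuclideanSpace.equiv (Fin d) ℝ).toHomeomorph ⁻¹'
      (Set.univ.pi fun _ => Set.Icc (0 : ℝ) T) := by
    ext t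
    simp only [cube, Set.mem_ofPred_eq, Set.mem_preimage, Set.mem_univ_pi]
    rfl
  rw [h, Homeomorph.isCompact_preimage]
  exact isCompact_univ_pi fun _ => isCompact_Icc

instance instCompactSpaceCube (T : ℝ) (d : ℕ) : CompactSpace (cube T d) :=
  isCompact_iff_compactSpace.mp (isCompact_cube T d)

/-- The path space of real continuous functions on `[0,T]^d`, with the sup-norm. -/
abbrev PathSpace (T : ℝ) (d : ℕ) : Type := C(cube T d, ℝ)

instance instMeasurableSpacePathSpace (T : ℝ) (d : ℕ) : MeasurableSpace (PathSpace T d) :=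
  borel _

instance instBorelSpacePathSpace (T : ℝ) (d : ℕ) : BorelSpace (PathSpace T d) := ⟨rfl⟩

/-! ### Quantization -/

section Quantization

variable {Ω E : Type*} [MeasurableSpace Ω]

/-- The `L^r`-error `(𝔼 ‖X - Y‖^r)^(1/r)`, as an extended nonnegative real. -/
def lrError [NormedAddCommGroup E] (r : ℝ) (P : Measure Ω) (X Y : Ω → E) : ℝ≥0∞ :=
  (∫⁻ ω, ‖X ω - Y ω‖ₑ ^ r ∂P) ^ (1 / r)

/-- An `N`-quantization: a random vector with at most `N` values. -/
def IsQuantization [MeasurableSpace E] (N : ℕ) (Xhat : Ω → E) : Prop :=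
  Measurable Xhat ∧ (Set.range Xhat).encard ≤ N

/-- The minimal level-`N` quantization error `e_{N,r}(X, E)`. -/
def minError [NormedAddCommGroup E] [MeasurableSpace E]
    (r : ℝ) (P : Measure Ω) (N : ℕ) (X : Ω → E) : ℝ≥0∞ :=
  sInf {e | ∃ Xhat : Ω → E, IsQuantization N Xhat ∧ e = lrError r P X Xhat}

/-- `Xhat` is an `L^r`-optimal `N`-quantization of `X`. -/
def IsOptimalQuantization [NormedAddCommGroup E] [MeasurableSpace E]
    (r : ℝ) (P : Measure Ω) (N : ℕ) (X Xhat : Ω → E) : Prop :=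
  IsQuantization N Xhat ∧ lrError r P X Xhat = minError r P N X

end Quantization

/-! ### Gaussian series and product quantization

Sequences indexed by `j ≥ 1` are represented by functions on `ℕ`, the value at `j` standing for
the term with index `j + 1`. -/

section Product

variable {Ω Ω' E : Type*} [MeasurableSpace Ω] [MeasurableSpace Ω']

/-- `ξ` is a sequence of i.i.d. standard normal random variables. -/
structure IsStdNormalSeq (P : Measure Ω) (ξ : ℕ → Ω → ℝ) : Prop where
  measurable : ∀ j, Measurable (ξ j)
  law : ∀ j, P.map (ξ j) = gaussianReal 0 1
  indep : iIndepFun ξ P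

variable [NormedAddCommGroup E] [NormedSpace ℝ E]

/-- The series `∑ ξ_j f_j` converges in `E` almost surely, and its sum is `Y` almost surely. -/
def IsSeriesSum (P : Measure Ω) (ξ : ℕ → Ω → ℝ) (f : ℕ → E) (Y : Ω → E) : Prop :=
  ∀ᵐ ω ∂P, Tendsto (fun n => ∑ j ∈ Finset.range n, ξ j ω • f j) atTop (𝓝 (Y ω))

/-- `Y` is the realization of `X` along `f`: `Y = ∑ ξ_j f_j` a.s. (with a.s. convergence in `E`),
and `Y` has the law of `X`. -/
def IsRealization [MeasurableSpace E] (P : Measure Ω) (ξ : ℕ → Ω → ℝ) (P' : Measure Ω')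
    (X : Ω' → E) (f : ℕ → E) (Y : Ω → E) : Prop :=
  IsSeriesSum P ξ f Y ∧ IdentDistrib Y X P P'

/-- `f` is admissible for `X`: `∑ ξ_j f_j` converges a.s. in `E` and has the law of `X`
(so that `X` is a centered Gaussian random vector). -/
def IsAdmissible [MeasurableSpace E] (P : Measure Ω) (ξ : ℕ → Ω → ℝ) (P' : Measure Ω')
    (X : Ω' → E) (f : ℕ → E) : Prop :=
  ∃ Y : Ω → E, IsRealization P ξ P' X f Y

/-- `Xhat = ∑_{j ≤ m} ξhat_j f_j` is an `L^r`-product `N`-quantization with respect to `f`,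
of length `m` and with marginal levels `n`: each `ξhat_j` is an `L^r`-optimal
`n_j`-quantization of `ξ_j`, and `∏_{j ≤ m} n_j ≤ N`. -/
def IsProductQuantization (r : ℝ) (P : Measure Ω) (ξ : ℕ → Ω → ℝ) (f : ℕ → E)
    (N m : ℕ) (n : ℕ → ℕ) (Xhat : Ω → E) : Prop :=
  1 ≤ m ∧ (∀ j < m, 1 ≤ n j) ∧ ∏ j ∈ Finset.range m, n j ≤ N ∧
    ∃ ξhat : ℕ → Ω → ℝ, (∀ j < m, IsOptimalQuantization r P (n j) (ξ j) (ξhat j)) ∧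
      ∀ ω, Xhat ω = ∑ j ∈ Finset.range m, ξhat j ω • f j

/-- The minimal `N`-th product quantization error `e^(prod)_{N,r}(X, E)`. The infimum is over all
admissible `f` and all `L^r`-product `N`-quantizations with respect to `f`, the error being that
of the quantization of the realization `∑ ξ_j f_j` of `X`. -/
def prodError [MeasurableSpace E] (r : ℝ) (P : Measure Ω) (ξ : ℕ → Ω → ℝ) (P' : Measure Ω')
    (X : Ω' → E) (N : ℕ) : ℝ≥0∞ :=
  sInf {e | ∃ (f : ℕ → E) (Y : Ω → E) (m : ℕ) (n : ℕ → ℕ) (Xhat : Ω → E),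
    IsRealization P ξ P' X f Y ∧ IsProductQuantization r P ξ f N m n Xhat ∧
      e = lrError r P Y Xhat}

end Product

/-! ### Conditions on the functions, tuning parameters, rates -/

/-- `‖f_j‖ ≤ C₁ j^(-θ) log(1+j)^γ` for all `j ≥ 1`. -/
def SizeCondition {T : ℝ} {d : ℕ} (θ γ C₁ : ℝ) (f : ℕ → PathSpace T d) : Prop :=
  ∀ j : ℕ, ‖f j‖ ≤ C₁ * ((j : ℝ) + 1) ^ (-θ) * Real.log (1 + ((j : ℝ) + 1)) ^ γ

/-- `f_j` is `a`-Hölder continuous and `[f_j]_a ≤ C₂ j^b` for all `j ≥ 1`. -/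
def HolderCondition {T : ℝ} {d : ℕ} (a : ℝ≥0) (b C₂ : ℝ) (f : ℕ → PathSpace T d) : Prop :=
  ∀ j : ℕ, eHolderNorm a (f j) ≤ ENNReal.ofReal (C₂ * ((j : ℝ) + 1) ^ b)

/-- The index `j₀ = [e^(γ/θ)]`. -/
def j₀ (θ γ : ℝ) : ℕ := ⌊Real.exp (γ / θ)⌋₊

/-- The sequence `ν_j`, `j ≥ 1` (here with the true index `j`):
`j^(-θ) log(1+j)^γ` for `j ≥ j₀`, and constant equal to its value at `j₀` before. -/
def nu (θ γ : ℝ) (j : ℕ) : ℝ :=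
  ((max j (j₀ θ γ) : ℕ) : ℝ) ^ (-θ) * Real.log (1 + ((max j (j₀ θ γ) : ℕ) : ℝ)) ^ γ

/-- `z_j = N^(1/m) ν_j (∏_{k=1}^m ν_k)^(-1/m)`, `1 ≤ j ≤ m` (true index `j`). -/
def zAlloc (θ γ : ℝ) (N m j : ℕ) : ℝ :=
  (N : ℝ) ^ (1 / (m : ℝ)) * nu θ γ j * (∏ k ∈ Finset.Icc 1 m, nu θ γ k) ^ (-(1 / (m : ℝ)))

/-- The allocation `N_j = [z_j]`; the value at `j` is the level of the term with index `j + 1`. -/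
def levels (θ γ : ℝ) (N m : ℕ) (j : ℕ) : ℕ := ⌊zAlloc θ γ N m (j + 1)⌋₊

/-- The lengths `m(N)`: `m(N) ∈ I(N) = {m ≥ 1 : z_m ≥ 1}` and `m(N) ≤ 2 log N / log log N` for
`N ≥ 3`, and `m(N) ~ 2 log N / log log N`. -/
structure IsLengthChoice (θ γ : ℝ) (m : ℕ → ℕ) : Prop where
  pos : ∀ N, 3 ≤ N → 1 ≤ m N
  mem : ∀ N, 3 ≤ N → 1 ≤ zAlloc θ γ N (m N) (m N)
  le : ∀ N : ℕ, 3 ≤ N → (m N : ℝ) ≤ 2 * Real.log N / Real.log (Real.log N)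
  equiv : Tendsto (fun N : ℕ => (m N : ℝ) / (2 * Real.log N / Real.log (Real.log N)))
    atTop (𝓝 1)

/-- The rate `C (log log N)^κ / (log N)^(θ - 1/2)`. -/
def rate (C κ θ : ℝ) (N : ℕ) : ℝ≥0∞ :=
  ENNReal.ofReal (C * Real.log (Real.log N) ^ κ / Real.log N ^ (θ - 1 / 2))

end ProdQuant

end

/-!
The error of a product quantization splits into the quantized coordinates
`∑_{j ≤ m} (ξ_j - ξhat_j) f_j` and the remainder `∑_{j > m} ξ_j f_j` of the series. Put
`s = max 1 r`.

*Quantized coordinates.* The levels are chosen such that `‖f_j‖ / N_j` is at most a constant times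
the same number `N ^ (-1 / m) * (∏ ν_k) ^ (1 / m)` for all `j ≤ m`. If the `L^s`-error of an
optimal `N_j`-quantization of a normal variable is of order `1 / N_j`, then the triangle inequality
in `L^s` bounds this part by `m` times that number. The loss of the factor `m` does no harm: the
length `m ~ 2 log N / log log N` gives `N ^ (-1 / m) ≤ (log N) ^ (-1 / 2)`, and `m ! ≥ (m / e) ^ m`
gives `(∏ ν_k) ^ (1 / m) = O(ν_m)` (`exists_nuMean_le`, `exists_error_le_rate`).

For `r < 1` this needs the `L^1`-error of an `L^r`-optimal quantization. The bound
`exists_eLpNorm_quantization_le` holds for every `s < r + 1` and rests on an exchange argument.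
Among many points of an optimal codebook three are close to each other on an exponential scale, and
the middle one can be removed at a cost of order `N ^ (-(r + 1))` (`exists_erase_cost`). Placing it
at `y` instead gains at least a multiple of `δ ^ (r + 1) * exp (-y ^ 2 / 2)`, where `δ` is the
distance from `y` to the codebook, truncated at `1`. By optimality
`δ = O(exp (y ^ 2 / (2 (r + 1))) / N)` (`exists_infDist_le`), and the `s`-th power of this is
integrable for the normal law exactly if `s < r + 1`.

*Remainder.* Chaining along dyadic grids of `[0,T]^d` bounds the moments of the sup-norm of a
Gaussian sum by its pointwise standard deviation and the size of its Hölder constants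
(`IsStdNormalSeq.eLpNorm_chaining`). If `b + θ ≤ 0` both have order `m ^ (1 / 2 - θ) (log m) ^ γ`.
Otherwise interpolation between the sup-norms and the Hölder constants makes the latter square
summable, with a polynomially larger sum; starting the chaining at a grid of polynomial size in `m`
removes this excess at the price of a factor `√(log m)` (`exists_eLpNorm_tail_le_rate`).
-/

universe u

namespace ProdQuant

/-! ### Moments of Gaussian sums -/

section LpTools

variable {Ω F : Type*} [MeasurableSpace Ω] [NormedAddCommGroup F] {P : Measure Ω}

theorem eLpNorm_ofReal_rpow {q : ℝ} (hq : 0 < q) (f : Ω → F) :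
    eLpNorm f (ENNReal.ofReal q) P ^ q = ∫⁻ ω, ‖f ω‖ₑ ^ q ∂P := by
  have h0 : ENNReal.ofReal q ≠ 0 := by simpa using hq
  rw [eLpNorm_eq_lintegral_rpow_enorm_toReal h0 ENNReal.ofReal_ne_top,
    ENNReal.toReal_ofReal hq.le, ← ENNReal.rpow_mul, one_div, inv_mul_cancel₀ hq.ne',
    ENNReal.rpow_one]

theorem eLpNorm_ofReal_le {q : ℝ} (hq : 0 < q) {f : Ω → F} {B : ℝ≥0∞}
    (h : ∫⁻ ω, ‖f ω‖ₑ ^ q ∂P ≤ B ^ q) : eLpNorm f (ENNReal.ofReal q) P ≤ B := by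
  rw [← eLpNorm_ofReal_rpow hq] at h
  exact (ENNReal.rpow_le_rpow_iff hq).1 h

theorem lrError_eq_eLpNorm {r : ℝ} (hr : 0 < r) (X Y : Ω → F) :
    lrError r P X Y = eLpNorm (fun ω => X ω - Y ω) (ENNReal.ofReal r) P := by
  rw [eLpNorm_eq_lintegral_rpow_enorm_toReal (by simpa using hr) ENNReal.ofReal_ne_top,
    ENNReal.toReal_ofReal hr.le]
  rfl

end LpTools

section GaussianSums

variable {Ω : Type*} [MeasurableSpace Ω] {P : Measure Ω} {ξ : ℕ → Ω → ℝ}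

theorem IsStdNormalSeq.hasSubgaussianMGF_const_mul (hξ : IsStdNormalSeq P ξ) (c : ℝ) (j : ℕ) :
    HasSubgaussianMGF (fun ω => c * ξ j ω) (Real.toNNReal (c ^ 2)) P where
  integrable_exp_mul t := by
    have h := integrable_exp_mul_gaussianReal (μ := 0) (v := 1) (t * c)
    rw [← hξ.law j, integrable_map_measure (by fun_prop) (hξ.measurable j).aemeasurable] at h
    refine h.congr (Eventually.of_forall fun ω => ?_)
    simp [mul_assoc]
  mgf_le t := by
    have h := mgf_gaussianReal (hξ.law j) (t * c)
    have h2 : mgf (fun ω => c * ξ j ω) P t = mgf (ξ j) P (t * c) := by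
      simp [mgf, mul_assoc]
    rw [h2, h, Real.coe_toNNReal _ (sq_nonneg c)]
    apply le_of_eq
    congr 1
    simp
    ring

/-- A finite linear combination of independent standard normal variables is sub-Gaussian, with
the variance as its parameter. -/
theorem IsStdNormalSeq.hasSubgaussianMGF_sum (hξ : IsStdNormalSeq P ξ) (c : ℕ → ℝ)
    (s : Finset ℕ) :
    HasSubgaussianMGF (fun ω => ∑ j ∈ s, c j * ξ j ω)
      (∑ j ∈ s, Real.toNNReal (c j ^ 2)) P := by
  have hind : iIndepFun (fun j ω => c j * ξ j ω) P :=
    hξ.indep.comp (fun j x => c j * x) fun j => by fun_prop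
  exact HasSubgaussianMGF.sum_of_iIndepFun hind
    fun j _ => hξ.hasSubgaussianMGF_const_mul (c j) j

/-- Even moments of a Gaussian sum, with the growth `√p` in the order `2p`. It comes from the
exponential moments by `x ^ n / n! ≤ exp x` at the scale `√(2p) / σ`. -/
theorem IsStdNormalSeq.eLpNorm_sum_le (hξ : IsStdNormalSeq P ξ) (c : ℕ → ℝ) (s : Finset ℕ)
    {σ : ℝ} (hσ : 0 < σ) (hc : ∑ j ∈ s, c j ^ 2 ≤ σ ^ 2) {p : ℕ} (hp : 1 ≤ p) :
    eLpNorm (fun ω => ∑ j ∈ s, c j * ξ j ω) (ENNReal.ofReal (2 * p)) P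
      ≤ ENNReal.ofReal (3 * √(2 * p) * σ) := by
  have hp' : (1 : ℝ) ≤ p := by exact_mod_cast hp
  have hG := hξ.hasSubgaussianMGF_sum c s
  set Z : Ω → ℝ := fun ω => ∑ j ∈ s, c j * ξ j ω with hZ
  have hmgf : ∀ t : ℝ, mgf Z P t ≤ Real.exp (σ ^ 2 * t ^ 2 / 2) := fun t => by
    refine (hG.mgf_le t).trans (Real.exp_le_exp.2 ?_)
    have : ((∑ j ∈ s, Real.toNNReal (c j ^ 2) : ℝ≥0) : ℝ) = ∑ j ∈ s, c j ^ 2 := by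
      push_cast
      exact Finset.sum_congr rfl fun j _ => max_eq_left (sq_nonneg _)
    rw [this]
    gcongr
  have hs2 : √(2 * (p : ℝ)) ^ 2 = 2 * p := Real.sq_sqrt (by positivity)
  have hspos : 0 < √(2 * (p : ℝ)) := Real.sqrt_pos.2 (by positivity)
  set t : ℝ := √(2 * (p : ℝ)) / σ with ht
  have htpos : 0 < t := by positivity
  have htσ : σ ^ 2 * t ^ 2 / 2 = p := by
    rw [ht, div_pow, hs2]; field_simp
  set A : ℝ := (√(2 * (p : ℝ)) * σ) ^ (2 * p) with hA
  have hApos : 0 < A := by positivity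
  have hAt : ((2 * p : ℕ) : ℝ) ^ (2 * p) = A * t ^ (2 * p) := by
    rw [hA, ← mul_pow]
    congr 1
    rw [ht]
    push_cast
    field_simp
    rw [hs2]
  have hpt : ∀ ω, ‖Z ω‖ₑ ^ (2 * (p : ℝ)) ≤
      ENNReal.ofReal (A * (Real.exp (t * Z ω) + Real.exp (-t * Z ω))) := fun ω => by
    have h1 : ‖Z ω‖ₑ ^ (2 * (p : ℝ)) = ENNReal.ofReal (|Z ω| ^ (2 * p)) := by
      rw [← ofReal_norm, ENNReal.ofReal_rpow_of_nonneg (norm_nonneg _) (by positivity)]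
      congr 1
      rw [Real.norm_eq_abs, ← Real.rpow_natCast]
      push_cast
      rfl
    rw [h1]
    apply ENNReal.ofReal_le_ofReal
    have h2 := Real.pow_div_factorial_le_exp (t * |Z ω|) (by positivity) (2 * p)
    have h3 : Real.exp (t * |Z ω|) ≤ Real.exp (t * Z ω) + Real.exp (-t * Z ω) := by
      rcases abs_cases (Z ω) with ⟨h, _⟩ | ⟨h, _⟩
      · rw [h]; linarith [Real.exp_pos (-t * Z ω)]
      · rw [h, mul_neg, ← neg_mul]; linarith [Real.exp_pos (t * Z ω)]
    have h4 : ((2 * p).factorial : ℝ) ≤ A * t ^ (2 * p) := by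
      rw [← hAt]; exact_mod_cast Nat.factorial_le_pow _
    have h5 : (t * |Z ω|) ^ (2 * p) ≤ A * t ^ (2 * p) *
        (Real.exp (t * Z ω) + Real.exp (-t * Z ω)) := by
      rw [div_le_iff₀ (by positivity)] at h2
      refine h2.trans ?_
      rw [mul_comm]
      gcongr
    rw [mul_pow] at h5
    have h6 : 0 < t ^ (2 * p) := by positivity
    refine le_of_mul_le_mul_left ?_ h6
    linarith
  apply eLpNorm_ofReal_le (by positivity)
  have hi1 := hG.integrable_exp_mul t
  have hi2 := hG.integrable_exp_mul (-t)
  calc ∫⁻ ω, ‖Z ω‖ₑ ^ (2 * (p : ℝ)) ∂P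
      ≤ ∫⁻ ω, ENNReal.ofReal (A * (Real.exp (t * Z ω) + Real.exp (-t * Z ω))) ∂P :=
        lintegral_mono hpt
    _ = ENNReal.ofReal (A * (mgf Z P t + mgf Z P (-t))) := by
        have hi : Integrable
            (fun ω => A * (Real.exp (t * Z ω) + Real.exp (-t * Z ω))) P :=
          (hi1.add hi2).const_mul A
        rw [← ofReal_integral_eq_lintegral_ofReal hi
          (Eventually.of_forall fun ω => by positivity)]
        congr 1
        rw [integral_const_mul, integral_add hi1 hi2]
        rfl
    _ ≤ ENNReal.ofReal (A * (2 * Real.exp p)) := by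
        apply ENNReal.ofReal_le_ofReal
        have h1 := hmgf t
        have h2 := hmgf (-t)
        rw [htσ] at h1
        rw [neg_sq, htσ] at h2
        gcongr
        linarith
    _ ≤ ENNReal.ofReal ((3 * √(2 * p) * σ) ^ (2 * p)) := by
        apply ENNReal.ofReal_le_ofReal
        have : 2 * Real.exp p ≤ 3 ^ (2 * p) := by
          have he : Real.exp p = Real.exp 1 ^ p := by rw [← Real.exp_nat_mul, mul_one]
          have h2 : (2 : ℝ) ≤ 2 ^ p := by
            calc (2 : ℝ) = 2 ^ 1 := by norm_num
              _ ≤ 2 ^ p := pow_le_pow_right₀ (by norm_num) hp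
          have h3 : 2 * Real.exp 1 ≤ 3 ^ 2 := by linarith [Real.exp_one_lt_d9]
          rw [he, pow_mul]
          calc 2 * Real.exp 1 ^ p ≤ 2 ^ p * Real.exp 1 ^ p := by gcongr
            _ = (2 * Real.exp 1) ^ p := by rw [mul_pow]
            _ ≤ _ := by gcongr
        rw [mul_assoc 3, mul_pow, ← hA, mul_comm]
        gcongr
    _ = _ := by
        rw [ENNReal.ofReal_rpow_of_nonneg (by positivity) (by positivity), ← Real.rpow_natCast]
        push_cast
        rfl

end GaussianSums

/-! ### Chaining in the space of continuous functions -/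

section Chaining

/-- The `L^q`-norm of a maximum of finitely many variables costs the `q`-th root of their
number. -/
theorem eLpNorm_pi_le {Ω ι : Type*} [MeasurableSpace Ω] {P : Measure Ω} [Fintype ι]
    {h : Ω → ι → ℝ} (hm : ∀ i, Measurable fun ω => h ω i) {q : ℝ} (hq : 0 < q) {B : ℝ≥0∞}
    (hB : ∀ i, eLpNorm (fun ω => h ω i) (ENNReal.ofReal q) P ≤ B) :
    eLpNorm h (ENNReal.ofReal q) P ≤ (Fintype.card ι : ℝ≥0∞) ^ (1 / q) * B := by
  apply eLpNorm_ofReal_le hq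
  have hpt : ∀ ω, ‖h ω‖ₑ ^ q ≤ ∑ i, ‖h ω i‖ₑ ^ q := fun ω => by
    rcases isEmpty_or_nonempty ι with hι | hι
    · have : h ω = 0 := Subsingleton.elim _ _
      simp [this, hq]
    · obtain ⟨i, -, hi⟩ := Finset.exists_max_image Finset.univ (fun i => ‖h ω i‖)
        Finset.univ_nonempty
      have h1 : ‖h ω‖ ≤ ‖h ω i‖ :=
        (pi_norm_le_iff_of_nonneg (norm_nonneg _)).2 fun j => hi j (Finset.mem_univ j)
      have h2 : ‖h ω‖ₑ ≤ ‖h ω i‖ₑ := by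
        rw [← ofReal_norm, ← ofReal_norm]
        exact ENNReal.ofReal_le_ofReal h1
      exact (ENNReal.rpow_le_rpow h2 hq.le).trans
        (Finset.single_le_sum (f := fun i => ‖h ω i‖ₑ ^ q) (fun _ _ => zero_le)
          (Finset.mem_univ i))
  calc ∫⁻ ω, ‖h ω‖ₑ ^ q ∂P ≤ ∫⁻ ω, ∑ i, ‖h ω i‖ₑ ^ q ∂P := lintegral_mono hpt
    _ = ∑ i, ∫⁻ ω, ‖h ω i‖ₑ ^ q ∂P :=
        lintegral_finsetSum _ fun i _ => ((hm i).enorm.pow_const q)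
    _ ≤ ∑ _i : ι, B ^ q := by
        refine Finset.sum_le_sum fun i _ => ?_
        rw [← eLpNorm_ofReal_rpow hq]
        exact ENNReal.rpow_le_rpow (hB i) hq.le
    _ = _ := by
        rw [Finset.sum_const, nsmul_eq_mul, ENNReal.mul_rpow_of_nonneg _ _ hq.le,
          ← ENNReal.rpow_mul, one_div, inv_mul_cancel₀ hq.ne', ENNReal.rpow_one]
        rfl

variable {T : ℝ} {d : ℕ}

/-- The point of the dyadic grid of mesh `T / 2 ^ k` in `[0,T]^d` with index vector `v`. -/
noncomputable def gridPt (hT : 0 ≤ T) (k : ℕ) (v : Fin d → Fin (2 ^ k + 1)) : cube T d :=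
  ⟨WithLp.toLp 2 fun i => T * (v i : ℕ) / 2 ^ k, fun i => by
    have h : ((v i : ℕ) : ℝ) ≤ 2 ^ k := by exact_mod_cast Nat.lt_succ_iff.1 (v i).2
    refine ⟨by positivity, ?_⟩
    change T * ((v i : ℕ) : ℝ) / 2 ^ k ≤ T
    rw [div_le_iff₀ (by positivity)]
    gcongr⟩

/-- The parent of a grid point, one dyadic level up, obtained by halving the indices. -/
def gridParent (k : ℕ) (v : Fin d → Fin (2 ^ (k + 1) + 1)) : Fin d → Fin (2 ^ k + 1) :=
  fun i => ⟨(v i : ℕ) / 2, by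
    have h1 := (v i).2
    have h2 : 2 ^ (k + 1) = 2 ^ k * 2 := pow_succ _ _
    omega⟩

theorem dist_cube_le (x y : cube T d) {δ : ℝ} (hδ : 0 ≤ δ)
    (h : ∀ i, |x.1 i - y.1 i| ≤ δ) : dist x y ≤ d * δ := by
  rw [Subtype.dist_eq, EuclideanSpace.dist_eq]
  apply Real.sqrt_le_iff.2 ⟨by positivity, ?_⟩
  calc ∑ i, dist (x.1 i) (y.1 i) ^ 2 ≤ ∑ _i : Fin d, δ ^ 2 := by
        refine Finset.sum_le_sum fun i _ => ?_
        rw [Real.dist_eq]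
        have := h i
        gcongr
    _ = d * δ ^ 2 := by simp
    _ ≤ (d * δ) ^ 2 := by
        rw [mul_pow]
        gcongr
        rcases Nat.eq_zero_or_pos d with h0 | h0
        · simp [h0]
        · have : (1 : ℝ) ≤ d := by exact_mod_cast h0
          nlinarith

theorem dist_gridPt_parent (hT : 0 ≤ T) (k : ℕ) (v : Fin d → Fin (2 ^ (k + 1) + 1)) :
    dist (gridPt hT (k + 1) v) (gridPt hT k (gridParent k v)) ≤ d * (T / 2 ^ k) := by
  apply dist_cube_le _ _ (by positivity)
  intro i
  change |T * ((v i : ℕ) : ℝ) / 2 ^ (k + 1) - T * (((v i : ℕ) / 2 : ℕ) : ℝ) / 2 ^ k| ≤ _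
  have h1 : 2 * ((v i : ℕ) / 2) ≤ (v i : ℕ) := by omega
  have h2 : (v i : ℕ) ≤ 2 * ((v i : ℕ) / 2) + 1 := by omega
  have h1' : 2 * (((v i : ℕ) / 2 : ℕ) : ℝ) ≤ ((v i : ℕ) : ℝ) := by exact_mod_cast h1
  have h2' : ((v i : ℕ) : ℝ) ≤ 2 * (((v i : ℕ) / 2 : ℕ) : ℝ) + 1 := by exact_mod_cast h2
  have : T * ((v i : ℕ) : ℝ) / 2 ^ (k + 1) - T * (((v i : ℕ) / 2 : ℕ) : ℝ) / 2 ^ k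
      = T / 2 ^ k * ((((v i : ℕ) : ℝ) - 2 * (((v i : ℕ) / 2 : ℕ) : ℝ)) / 2) := by
    have hk : (2 : ℝ) ^ (k + 1) = 2 ^ k * 2 := pow_succ _ _
    rw [hk]; field_simp
  rw [this, abs_mul, abs_of_nonneg (by positivity : 0 ≤ T / 2 ^ k)]
  apply mul_le_of_le_one_right (by positivity)
  rw [abs_le]
  constructor <;> linarith

theorem exists_gridPt_near (hT : 0 < T) (k : ℕ) (x : cube T d) :
    ∃ v, dist (gridPt hT.le k v) x ≤ d * (T / 2 ^ k) := by
  have hx := x.2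
  have hfl : ∀ i, ⌊x.1 i * 2 ^ k / T⌋₊ < 2 ^ k + 1 := fun i => by
    rw [Nat.lt_succ_iff]
    apply Nat.floor_le_of_le
    push_cast
    rw [div_le_iff₀ hT, mul_comm]
    have := (hx i).2
    gcongr
  refine ⟨fun i => ⟨_, hfl i⟩, dist_cube_le _ _ (by positivity) fun i => ?_⟩
  change |T * (⌊x.1 i * 2 ^ k / T⌋₊ : ℝ) / 2 ^ k - x.1 i| ≤ _
  have h0 : 0 ≤ x.1 i * 2 ^ k / T := by have := (hx i).1; positivity
  have h1 := Nat.floor_le h0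
  have h2 := Nat.lt_floor_add_one (x.1 i * 2 ^ k / T)
  have : T * (⌊x.1 i * 2 ^ k / T⌋₊ : ℝ) / 2 ^ k - x.1 i
      = T / 2 ^ k * ((⌊x.1 i * 2 ^ k / T⌋₊ : ℝ) - x.1 i * 2 ^ k / T) := by
    field_simp
  rw [this, abs_mul, abs_of_nonneg (by positivity : 0 ≤ T / 2 ^ k)]
  apply mul_le_of_le_one_right (by positivity)
  rw [abs_le]
  constructor <;> linarith

/-- The restrictions of a continuous function to the dyadic grids recover its sup-norm. -/
theorem tendsto_norm_grid (hT : 0 < T) (G : PathSpace T d) :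
    Tendsto (fun k => ‖fun v => G (gridPt hT.le k v)‖) atTop (𝓝 ‖G‖) := by
  have hne : Nonempty (cube T d) := ⟨gridPt hT.le 0 fun _ => 0⟩
  obtain ⟨x, hx⟩ : ∃ x, ‖G‖ = ‖G x‖ := by
    obtain ⟨x, -, hx⟩ := isCompact_univ.exists_isMaxOn Set.univ_nonempty
      (G.continuous.norm.continuousOn (s := Set.univ))
    exact ⟨x, le_antisymm ((ContinuousMap.norm_le G (norm_nonneg _)).2
      fun y => hx (Set.mem_univ y)) (G.norm_coe_le_norm x)⟩
  choose v hv using fun k => exists_gridPt_near hT k x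
  have hlim : Tendsto (fun k => gridPt hT.le k (v k)) atTop (𝓝 x) := by
    rw [tendsto_iff_dist_tendsto_zero]
    refine squeeze_zero (fun _ => dist_nonneg) hv ?_
    have : Tendsto (fun k : ℕ => (d * T) * ((1 / 2 : ℝ)) ^ k) atTop (𝓝 ((d * T) * 0)) :=
      (tendsto_pow_atTop_nhds_zero_of_lt_one (by norm_num) (by norm_num)).const_mul _
    rw [mul_zero] at this
    refine this.congr fun k => ?_
    rw [div_pow, one_pow]; ring
  have h1 : Tendsto (fun k => ‖G (gridPt hT.le k (v k))‖) atTop (𝓝 ‖G‖) := by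
    rw [hx]
    exact ((G.continuous.norm.tendsto x).comp hlim)
  refine tendsto_of_tendsto_of_tendsto_of_le_of_le h1 tendsto_const_nhds ?_ ?_
  · intro k
    exact norm_le_pi_norm (fun v => G (gridPt hT.le k v)) (v k)
  · intro k
    exact (pi_norm_le_iff_of_nonneg (norm_nonneg _)).2 fun w => G.norm_coe_le_norm _

variable {Ω : Type*} [MeasurableSpace Ω] {P : Measure Ω} {ξ : ℕ → Ω → ℝ}

theorem card_grid_rpow_le (k n : ℕ) {e : ℝ} (he : 0 ≤ e) (hn : k + 1 ≤ n) :
    ((Fintype.card (Fin d → Fin (2 ^ k + 1)) : ℕ) : ℝ≥0∞) ^ e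
      ≤ ENNReal.ofReal ((2 : ℝ) ^ (n * (d * e))) := by
  have h1 : Fintype.card (Fin d → Fin (2 ^ k + 1)) = (2 ^ k + 1) ^ d := by simp
  have h2 : (2 ^ k + 1) ^ d ≤ (2 ^ n) ^ d := by
    apply Nat.pow_le_pow_left
    calc 2 ^ k + 1 ≤ 2 ^ k + 2 ^ k := by gcongr; exact Nat.one_le_two_pow
      _ = 2 ^ (k + 1) := by ring
      _ ≤ _ := Nat.pow_le_pow_right (by norm_num) hn
  rw [h1]
  calc (((2 ^ k + 1) ^ d : ℕ) : ℝ≥0∞) ^ e ≤ (((2 ^ n) ^ d : ℕ) : ℝ≥0∞) ^ e := by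
        gcongr
    _ = ENNReal.ofReal (((2 ^ n) ^ d : ℕ) : ℝ) ^ e := by rw [ENNReal.ofReal_natCast]
    _ = _ := by
        rw [ENNReal.ofReal_rpow_of_nonneg (by positivity) he]
        congr 1
        push_cast
        rw [← pow_mul, ← Real.rpow_natCast, ← Real.rpow_mul (by norm_num)]
        push_cast
        ring_nf

/-- Chaining for a finite Gaussian sum `∑ ξ_j g_j` in the space of continuous functions: a union
bound over the grid of level `k₀`, and a geometric series for the links between finer grids.
The order `2p` of the moment absorbs the cardinalities of the grids. -/
theorem IsStdNormalSeq.eLpNorm_chaining (hξ : IsStdNormalSeq P ξ) (hT : 0 < T) (hd : 1 ≤ d)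
    (g : ℕ → PathSpace T d) (s : Finset ℕ) {S H a : ℝ} (hS0 : 0 < S) (hH0 : 0 < H) (ha : 0 < a)
    (hS : ∑ j ∈ s, ‖g j‖ ^ 2 ≤ S ^ 2) (h : ℕ → ℝ)
    (hh : ∀ j ∈ s, ∀ x y, |g j x - g j y| ≤ h j * dist x y ^ a)
    (hh0 : ∀ j ∈ s, 0 ≤ h j)
    (hH : ∑ j ∈ s, h j ^ 2 ≤ H ^ 2) (k₀ : ℕ) {p : ℕ} (hp : 1 ≤ p) (hpd : d ≤ 2 * p)
    (hpa : (d : ℝ) / (2 * p) ≤ a / 2) :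
    eLpNorm (fun ω => ∑ j ∈ s, ξ j ω • g j) (ENNReal.ofReal (2 * p)) P ≤
      ENNReal.ofReal (3 * √(2 * p) * (2 * 2 ^ (k₀ * ((d : ℝ) / (2 * p))) * S +
        4 * (d * T) ^ a * H * (((2 : ℝ) ^ (-(a / 2))) ^ k₀ / (1 - 2 ^ (-(a / 2)))))) := by
  have hp' : (1 : ℝ) ≤ p := by exact_mod_cast hp
  have hd' : (1 : ℝ) ≤ d := by exact_mod_cast hd
  have hq : (0 : ℝ) < 2 * p := by positivity
  have hq1 : (1 : ℝ) ≤ 2 * p := by linarith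
  have hqE : 1 ≤ ENNReal.ofReal (2 * p) := by
    rw [← ENNReal.ofReal_one]; exact ENNReal.ofReal_le_ofReal hq1
  have hdq1 : (d : ℝ) / (2 * p) ≤ 1 := by
    rw [div_le_one hq]; exact_mod_cast hpd
  have hdq0 : 0 ≤ (d : ℝ) / (2 * p) := by positivity
  set β : ℝ := (2 : ℝ) ^ (-(a / 2)) with hβ
  have hβ0 : 0 < β := by positivity
  have hβ1 : β < 1 := Real.rpow_lt_one_of_one_lt_of_neg (by norm_num) (by linarith)
  set G : Ω → PathSpace T d := fun ω => ∑ j ∈ s, ξ j ω • g j with hG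
  have hGx : ∀ ω x, G ω x = ∑ j ∈ s, g j x * ξ j ω := fun ω x => by
    simp only [hG, ContinuousMap.coe_sum, Finset.sum_apply, ContinuousMap.coe_smul,
      Pi.smul_apply, smul_eq_mul]
    exact Finset.sum_congr rfl fun _ _ => mul_comm _ _
  have hGm : ∀ x, Measurable fun ω => G ω x := fun x => by
    simp only [hGx]
    exact Finset.measurable_sum _ fun j _ => (hξ.measurable j).const_mul _
  have hGp : ∀ x, eLpNorm (fun ω => G ω x) (ENNReal.ofReal (2 * p)) P
      ≤ ENNReal.ofReal (3 * √(2 * p) * S) := fun x => by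
    simp only [hGx]
    refine hξ.eLpNorm_sum_le _ s hS0 (le_trans (Finset.sum_le_sum fun j _ => ?_) hS) hp
    rw [← sq_abs]
    have := (g j).norm_coe_le_norm x
    rw [Real.norm_eq_abs] at this
    gcongr
  let V : (k : ℕ) → Ω → (Fin d → Fin (2 ^ k + 1)) → ℝ := fun k ω v => G ω (gridPt hT.le k v)
  let D : (k : ℕ) → Ω → (Fin d → Fin (2 ^ (k + 1) + 1)) → ℝ :=
    fun k ω v => G ω (gridPt hT.le (k + 1) v) - G ω (gridPt hT.le k (gridParent k v))
  have hVm : ∀ k, Measurable (V k) := fun k => measurable_pi_lambda _ fun v => hGm _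
  have hDm : ∀ k, Measurable (D k) := fun k =>
    measurable_pi_lambda _ fun v => (hGm _).sub (hGm _)
  have hV0 : eLpNorm (V k₀) (ENNReal.ofReal (2 * p)) P ≤
      ENNReal.ofReal (3 * √(2 * p) * (2 * 2 ^ (k₀ * ((d : ℝ) / (2 * p))) * S)) := by
    refine (eLpNorm_pi_le (fun v => hGm _) hq fun v => hGp _).trans ?_
    refine (mul_le_mul_left (card_grid_rpow_le k₀ (k₀ + 1) (by positivity) le_rfl) _).trans ?_
    rw [← ENNReal.ofReal_mul (by positivity)]
    apply ENNReal.ofReal_le_ofReal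
    have : (2 : ℝ) ^ (((k₀ + 1 : ℕ) : ℝ) * (d * (1 / (2 * p))))
        ≤ 2 * 2 ^ (k₀ * ((d : ℝ) / (2 * p))) := by
      rw [mul_one_div]
      push_cast
      rw [add_mul, Real.rpow_add (by norm_num), one_mul, mul_comm]
      gcongr
      calc (2 : ℝ) ^ ((d : ℝ) / (2 * p)) ≤ 2 ^ (1 : ℝ) := by gcongr; norm_num
        _ = 2 := by norm_num
    calc _ ≤ 2 * 2 ^ (k₀ * ((d : ℝ) / (2 * p))) * (3 * √(2 * p) * S) := by gcongr
      _ = _ := by ring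
  have hDk : ∀ k, eLpNorm (D k) (ENNReal.ofReal (2 * p)) P ≤
      ENNReal.ofReal (3 * √(2 * p) * (4 * (d * T) ^ a * H) * β ^ k) := fun k => by
    have hone : ∀ v, eLpNorm (fun ω => D k ω v) (ENNReal.ofReal (2 * p)) P ≤
        ENNReal.ofReal (3 * √(2 * p) * (H * (d * (T / 2 ^ k)) ^ a)) := fun v => by
      have : (fun ω => D k ω v) = fun ω => ∑ j ∈ s, (g j (gridPt hT.le (k + 1) v) -
          g j (gridPt hT.le k (gridParent k v))) * ξ j ω := by
        funext ω
        simp only [D, hGx, sub_mul, Finset.sum_sub_distrib]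
      rw [this]
      refine hξ.eLpNorm_sum_le _ s (by positivity) ?_ hp
      rw [mul_pow]
      refine le_trans ?_ (mul_le_mul_of_nonneg_right hH (by positivity))
      rw [Finset.sum_mul]
      refine Finset.sum_le_sum fun j hj => ?_
      rw [← sq_abs, ← mul_pow]
      have h1 := hh j hj (gridPt hT.le (k + 1) v) (gridPt hT.le k (gridParent k v))
      have h2 := dist_gridPt_parent hT.le k v
      have h3 := hh0 j hj
      refine pow_le_pow_left₀ (abs_nonneg _) (h1.trans ?_) 2
      gcongr
    refine (eLpNorm_pi_le (fun v => (hGm _).sub (hGm _)) hq hone).trans ?_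
    refine (mul_le_mul_left (card_grid_rpow_le (k + 1) (k + 2) (by positivity) le_rfl)
      _).trans ?_
    rw [← ENNReal.ofReal_mul (by positivity)]
    apply ENNReal.ofReal_le_ofReal
    have h1 : (2 : ℝ) ^ (((k + 2 : ℕ) : ℝ) * (d * (1 / (2 * p))))
        ≤ 4 * (2 ^ (a / 2)) ^ k := by
      rw [mul_one_div]
      push_cast
      rw [add_mul, Real.rpow_add (by norm_num), mul_comm]
      have e1 : (2 : ℝ) ^ (2 * ((d : ℝ) / (2 * p))) ≤ 4 := by
        calc (2 : ℝ) ^ (2 * ((d : ℝ) / (2 * p))) ≤ 2 ^ (2 : ℝ) := by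
              apply Real.rpow_le_rpow_of_exponent_le (by norm_num); linarith
          _ = 4 := by norm_num
      have e2 : (2 : ℝ) ^ ((k : ℝ) * ((d : ℝ) / (2 * p))) ≤ (2 ^ (a / 2)) ^ k := by
        rw [← Real.rpow_natCast, ← Real.rpow_mul (by norm_num), mul_comm (a / 2)]
        apply Real.rpow_le_rpow_of_exponent_le (by norm_num)
        gcongr
      gcongr
    have h2 : (d * (T / 2 ^ k)) ^ a = (d * T) ^ a * (β ^ k * β ^ k) := by
      rw [← mul_div_assoc, Real.div_rpow (by positivity) (by positivity), div_eq_mul_inv]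
      congr 1
      rw [← pow_add, hβ, ← Real.rpow_natCast, ← Real.rpow_natCast, ← Real.rpow_mul (by norm_num),
        ← Real.rpow_mul (by norm_num), ← Real.rpow_neg (by norm_num)]
      congr 1
      push_cast
      ring
    have h3 : (2 ^ (a / 2)) ^ k * β ^ k = (1 : ℝ) := by
      rw [← mul_pow, hβ, ← Real.rpow_add (by norm_num)]; simp
    rw [h2]
    calc _ ≤ 4 * (2 ^ (a / 2)) ^ k * (3 * √(2 * p) * (H * ((d * T) ^ a * (β ^ k * β ^ k)))) := by
          gcongr
      _ = 3 * √(2 * p) * (4 * (d * T) ^ a * H) * β ^ k * ((2 ^ (a / 2)) ^ k * β ^ k) := by ring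
      _ = _ := by rw [h3, mul_one]
  have hstep : ∀ k, eLpNorm (V (k + 1)) (ENNReal.ofReal (2 * p)) P ≤
      eLpNorm (V k) (ENNReal.ofReal (2 * p)) P +
        eLpNorm (D k) (ENNReal.ofReal (2 * p)) P := fun k => by
    have h1 : V (k + 1) = (fun ω v => V k ω (gridParent k v)) + D k := by
      funext ω v; simp [V, D]
    rw [h1]
    refine (eLpNorm_add_le ?_ (hDm k).aestronglyMeasurable hqE).trans ?_
    · exact (measurable_pi_lambda _ fun v =>
        hGm (gridPt hT.le k (gridParent k v))).aestronglyMeasurable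
    · gcongr
      apply eLpNorm_mono
      intro ω
      exact (pi_norm_le_iff_of_nonneg (norm_nonneg _)).2 fun v =>
        norm_le_pi_norm (V k ω) (gridParent k v)
  set Q : ℝ := 3 * √(2 * p) * (4 * (d * T) ^ a * H) with hQ
  have hQ0 : 0 ≤ Q := by positivity
  have hsum : ∀ n, eLpNorm (V (k₀ + n)) (ENNReal.ofReal (2 * p)) P ≤
      ENNReal.ofReal (3 * √(2 * p) * (2 * 2 ^ (k₀ * ((d : ℝ) / (2 * p))) * S) +
        ∑ i ∈ Finset.range n, Q * β ^ (k₀ + i)) := fun n => by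
    induction n with
    | zero => simpa using hV0
    | succ n ih =>
      refine (hstep (k₀ + n)).trans ((add_le_add ih (hDk (k₀ + n))).trans ?_)
      rw [← ENNReal.ofReal_add (by positivity) (by positivity), Finset.sum_range_succ, add_assoc]
  have hbound : ∀ n, eLpNorm (fun ω => ‖V (k₀ + n) ω‖) (ENNReal.ofReal (2 * p)) P ≤
      ENNReal.ofReal (3 * √(2 * p) * (2 * 2 ^ (k₀ * ((d : ℝ) / (2 * p))) * S +
        4 * (d * T) ^ a * H * (β ^ k₀ / (1 - β)))) := fun n => by
    rw [eLpNorm_norm]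
    refine (hsum n).trans (ENNReal.ofReal_le_ofReal ?_)
    have : ∑ i ∈ Finset.range n, Q * β ^ (k₀ + i) ≤ Q * (β ^ k₀ / (1 - β)) := by
      rw [← Finset.mul_sum]
      gcongr
      simp only [pow_add]
      rw [← Finset.mul_sum, div_eq_mul_inv]
      gcongr
      rw [← tsum_geometric_of_lt_one hβ0.le hβ1]
      exact (summable_geometric_of_lt_one hβ0.le hβ1).sum_le_tsum _ fun _ _ => by positivity
    rw [mul_add, ← mul_assoc (3 * √(2 * p)) (4 * (d * T) ^ a * H), ← hQ]
    gcongr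
  rw [← eLpNorm_norm]
  refine (Lp.eLpNorm_lim_le_liminf_eLpNorm (f := fun n ω => ‖V (n + k₀) ω‖)
    (fun n => (hVm _).norm.aestronglyMeasurable) _ (Eventually.of_forall fun ω =>
      (tendsto_norm_grid hT (G ω)).comp (tendsto_add_atTop_nat k₀))).trans ?_
  refine (liminf_le_liminf (Eventually.of_forall fun n => ?_)).trans
    (liminf_const (f := atTop (α := ℕ)) _).le
  rw [Nat.add_comm n k₀]
  exact hbound n

end Chaining

/-! ### The remainder of the series -/

section Tail

/-- The profile `x ^ (-θ) * log (1 + x) ^ γ` of the sizes of the functions of the series. -/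
noncomputable def decay (θ γ x : ℝ) : ℝ := x ^ (-θ) * Real.log (1 + x) ^ γ

theorem log_one_add_pos {x : ℝ} (hx : 0 < x) : 0 < Real.log (1 + x) :=
  Real.log_pos (by linarith)

theorem decay_pos {θ γ x : ℝ} (hx : 0 < x) : 0 < decay θ γ x :=
  mul_pos (Real.rpow_pos_of_pos hx _) (Real.rpow_pos_of_pos (log_one_add_pos hx) _)

theorem sum_rpow_neg_le {p : ℝ} (hp : 1 < p) {m : ℕ} (hm : 1 ≤ m) (n : ℕ) :
    ∑ j ∈ Finset.Ico m n, ((j : ℝ) + 1) ^ (-p) ≤ (m : ℝ) ^ (1 - p) / (p - 1) := by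
  have hm' : (0 : ℝ) < m := by exact_mod_cast hm
  rcases le_or_gt n m with h | h
  · rw [Finset.Ico_eq_empty_of_le h, Finset.sum_empty]
    have : 0 < p - 1 := by linarith
    positivity
  have hn' : (0 : ℝ) < n := by exact_mod_cast (lt_of_le_of_lt (Nat.zero_le m) h)
  have hanti : AntitoneOn (fun x : ℝ => x ^ (-p)) (Set.Icc (m : ℝ) n) := fun x hx y _ hxy =>
    Real.rpow_le_rpow_of_nonpos (lt_of_lt_of_le hm' hx.1) hxy (by linarith)
  have h1 := hanti.sum_le_integral_Ico h.le
  rw [integral_rpow (Or.inr ⟨by linarith, by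
    rw [Set.uIcc_of_le (by exact_mod_cast h.le)]
    intro h0
    exact absurd h0.1 (not_le.2 hm')⟩)] at h1
  have h2 : ∑ j ∈ Finset.Ico m n, ((j : ℝ) + 1) ^ (-p)
      = ∑ j ∈ Finset.Ico m n, (((j + 1 : ℕ) : ℝ)) ^ (-p) := by push_cast; rfl
  rw [h2]
  refine h1.trans ?_
  have h3 : ((n : ℝ) ^ (-p + 1) - (m : ℝ) ^ (-p + 1)) / (-p + 1)
      = ((m : ℝ) ^ (1 - p) - (n : ℝ) ^ (1 - p)) / (p - 1) := by
    rw [neg_add_eq_sub, ← neg_div_neg_eq, neg_sub, neg_sub]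
  rw [h3]
  have : 0 < p - 1 := by linarith
  gcongr
  have : 0 ≤ (n : ℝ) ^ (1 - p) := by positivity
  linarith

/-- Logarithms vary slowly: `(log (1 + x) / log (1 + m)) ^ γ` is bounded by an arbitrarily small
power of `x / m`. -/
theorem exists_log_rpow_le {γ ε : ℝ} (hγ : 0 ≤ γ) (hε : 0 < ε) :
    ∃ B : ℝ, 0 < B ∧ ∀ m x : ℝ, 1 ≤ m → m ≤ x →
      Real.log (1 + x) ^ γ ≤ B * Real.log (1 + m) ^ γ * (x / m) ^ ε := by
  set δ : ℝ := ε / (γ + 1) with hδ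
  have hδ0 : 0 < δ := by positivity
  have hlog2 : 0 < Real.log 2 := Real.log_pos (by norm_num)
  set b : ℝ := 1 + 1 / (δ * Real.log 2) with hb
  have hb0 : 0 < b := by positivity
  refine ⟨b ^ γ, by positivity, fun m x hm hmx => ?_⟩
  have hm0 : 0 < m := by linarith
  have hx0 : 0 < x := by linarith
  have hy : 1 ≤ x / m := by rwa [one_le_div hm0]
  have hy0 : 0 < x / m := by linarith
  have h1 : Real.log (1 + x) ≤ Real.log (1 + m) + Real.log (x / m) := by
    rw [← Real.log_mul (by linarith) hy0.ne']
    apply Real.log_le_log (by linarith)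
    have : m * (x / m) = x := by field_simp
    nlinarith
  have hlm : Real.log 2 ≤ Real.log (1 + m) := Real.log_le_log (by norm_num) (by linarith)
  have hlm0 : 0 < Real.log (1 + m) := by linarith
  have h2 : Real.log (x / m) ≤ (x / m) ^ δ / δ := Real.log_le_rpow_div hy0.le hδ0
  have hyδ : 1 ≤ (x / m) ^ δ := Real.one_le_rpow hy hδ0.le
  have h3 : Real.log (1 + x) ≤ b * Real.log (1 + m) * (x / m) ^ δ := by
    refine h1.trans ?_
    have h4 : (x / m) ^ δ / δ ≤ 1 / (δ * Real.log 2) * Real.log (1 + m) * (x / m) ^ δ := by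
      have : (x / m) ^ δ / δ = 1 / (δ * Real.log 2) * Real.log 2 * (x / m) ^ δ := by
        field_simp
      rw [this]
      gcongr
    have h5 : Real.log (1 + m) ≤ Real.log (1 + m) * (x / m) ^ δ :=
      le_mul_of_one_le_right hlm0.le hyδ
    calc _ ≤ Real.log (1 + m) * (x / m) ^ δ +
          1 / (δ * Real.log 2) * Real.log (1 + m) * (x / m) ^ δ := by linarith
      _ = _ := by rw [hb]; ring
  calc Real.log (1 + x) ^ γ ≤ (b * Real.log (1 + m) * (x / m) ^ δ) ^ γ := by
        have := (log_one_add_pos hx0).le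
        gcongr
    _ = b ^ γ * Real.log (1 + m) ^ γ * (x / m) ^ (δ * γ) := by
        rw [Real.mul_rpow (by positivity) (by positivity), Real.mul_rpow hb0.le hlm0.le,
          ← Real.rpow_mul hy0.le]
    _ ≤ _ := by
        gcongr
        rw [hδ, div_mul_eq_mul_div, div_le_iff₀ (by positivity)]
        nlinarith

theorem exists_sum_decay_sq_le {θ γ : ℝ} (hθ : 1 / 2 < θ) (hγ : 0 ≤ γ) :
    ∃ C : ℝ, 0 < C ∧ ∀ m n : ℕ, 1 ≤ m →
      ∑ j ∈ Finset.Ico m n, decay θ γ ((j : ℝ) + 1) ^ 2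
        ≤ (C * ((m : ℝ) ^ (1 / 2 - θ) * Real.log (1 + m) ^ γ)) ^ 2 := by
  obtain ⟨B, hB0, hB⟩ := exists_log_rpow_le (ε := (θ - 1 / 2) / 2) hγ (by linarith)
  have hp : 0 < θ - 1 / 2 := by linarith
  refine ⟨B * √(1 / (θ - 1 / 2)), by positivity, fun m n hm => ?_⟩
  have hm1 : (1 : ℝ) ≤ m := by exact_mod_cast hm
  have hm0 : (0 : ℝ) < m := by linarith
  have hl0 := log_one_add_pos hm0
  have hterm : ∀ j ∈ Finset.Ico m n, decay θ γ ((j : ℝ) + 1) ^ 2 ≤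
      (B * Real.log (1 + m) ^ γ) ^ 2 * (m : ℝ) ^ (-(θ - 1 / 2)) *
        ((j : ℝ) + 1) ^ (-(θ + 1 / 2)) := fun j hj => by
    have hj : (m : ℝ) ≤ (j : ℝ) + 1 := by
      have : (m : ℝ) ≤ j := by exact_mod_cast (Finset.mem_Ico.1 hj).1
      linarith
    set x : ℝ := (j : ℝ) + 1 with hx
    have hx0 : 0 < x := by linarith
    have h1 := hB m x hm1 hj
    have h2 : decay θ γ x ≤ x ^ (-θ) * (B * Real.log (1 + m) ^ γ *
        (x / m) ^ ((θ - 1 / 2) / 2)) := by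
      unfold decay; gcongr
    refine (pow_le_pow_left₀ (decay_pos hx0).le h2 2).trans (le_of_eq ?_)
    have e1 : (x ^ (-θ)) ^ 2 = x ^ (-(θ + 1 / 2)) * x ^ (-(θ - 1 / 2)) := by
      rw [← Real.rpow_natCast, ← Real.rpow_mul hx0.le, ← Real.rpow_add hx0]
      congr 1; push_cast; ring
    have e2 : ((x / m) ^ ((θ - 1 / 2) / 2)) ^ 2 = x ^ (θ - 1 / 2) * (m : ℝ) ^ (-(θ - 1 / 2)) := by
      rw [← Real.rpow_natCast, ← Real.rpow_mul (by positivity), Real.div_rpow hx0.le hm0.le,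
        Real.rpow_neg hm0.le, ← div_eq_mul_inv]
      push_cast
      congr 2 <;> ring
    have e3 : x ^ (-(θ - 1 / 2)) * x ^ (θ - 1 / 2) = 1 := by
      rw [← Real.rpow_add hx0]; simp
    rw [mul_pow, mul_pow _ ((x / m) ^ ((θ - 1 / 2) / 2)), e1, e2]
    linear_combination (x ^ (-(θ + 1 / 2)) * (B * Real.log (1 + m) ^ γ) ^ 2 *
      (m : ℝ) ^ (-(θ - 1 / 2))) * e3
  refine (Finset.sum_le_sum hterm).trans ?_
  rw [← Finset.mul_sum]
  have h1 := sum_rpow_neg_le (p := θ + 1 / 2) (by linarith) hm n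
  calc _ ≤ (B * Real.log (1 + m) ^ γ) ^ 2 * (m : ℝ) ^ (-(θ - 1 / 2)) *
        ((m : ℝ) ^ (1 - (θ + 1 / 2)) / (θ + 1 / 2 - 1)) := by gcongr
    _ = _ := by
        have e1 : ((m : ℝ) ^ (1 / 2 - θ)) ^ 2
            = (m : ℝ) ^ (-(θ - 1 / 2)) * (m : ℝ) ^ (1 - (θ + 1 / 2)) := by
          rw [← Real.rpow_natCast, ← Real.rpow_mul hm0.le, ← Real.rpow_add hm0]
          congr 1; push_cast; ring
        have e2 : √(1 / (θ - 1 / 2)) ^ 2 = 1 / (θ - 1 / 2) := Real.sq_sqrt (by positivity)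
        have e3 : θ + 1 / 2 - 1 = θ - 1 / 2 := by ring
        rw [mul_pow, mul_pow, mul_pow _ √(1 / (θ - 1 / 2)), mul_pow _ (Real.log (1 + m) ^ γ), e1,
          e2, e3]
        ring

/-- Moments of the remainder of the series in terms of the free parameters of the chaining: the
level `k₀` of the initial grid and the order `2p` of the moment. -/
theorem exists_eLpNorm_tail_le {T : ℝ} (hT : 0 < T) {d : ℕ} (hd : 1 ≤ d) {θ θ' γ a A s : ℝ}
    (hθ : 1 / 2 < θ) (hθ' : 1 / 2 < θ') (hγ : 0 ≤ γ) (ha : 0 < a) (hA : 0 < A) :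
    ∃ C : ℝ, 0 < C ∧ ∀ (Ω : Type u) [MeasurableSpace Ω] (P : Measure Ω) [IsProbabilityMeasure P]
      (ξ : ℕ → Ω → ℝ) (f : ℕ → PathSpace T d) (Y : Ω → PathSpace T d),
      IsStdNormalSeq P ξ → IsSeriesSum P ξ f Y →
      (∀ j : ℕ, ‖f j‖ ≤ A * decay θ γ ((j : ℝ) + 1)) →
      (∀ j : ℕ, ∀ x y, |f j x - f j y| ≤ A * decay θ' γ ((j : ℝ) + 1) * dist x y ^ a) →
      ∀ m : ℕ, 1 ≤ m → ∀ k₀ p : ℕ, 1 ≤ p → d ≤ 2 * p → (d : ℝ) / (2 * p) ≤ a / 2 →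
      s ≤ 2 * p →
      eLpNorm (fun ω => Y ω - ∑ j ∈ Finset.range m, ξ j ω • f j) (ENNReal.ofReal s) P ≤
        ENNReal.ofReal (C * √(2 * p) * (2 ^ (k₀ * ((d : ℝ) / (2 * p))) * (m : ℝ) ^ (1 / 2 - θ) +
          ((2 : ℝ) ^ (-(a / 2))) ^ k₀ * (m : ℝ) ^ (1 / 2 - θ')) * Real.log (1 + m) ^ γ) := by
  obtain ⟨C₁, hC₁, h₁⟩ := exists_sum_decay_sq_le hθ hγ
  obtain ⟨C₂, hC₂, h₂⟩ := exists_sum_decay_sq_le hθ' hγ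
  have hβ1 : (2 : ℝ) ^ (-(a / 2)) < 1 :=
    Real.rpow_lt_one_of_one_lt_of_neg (by norm_num) (by linarith)
  have hβ : 0 < 1 - (2 : ℝ) ^ (-(a / 2)) := by linarith
  have hd0 : (0 : ℝ) < d := by exact_mod_cast hd
  set c₁ : ℝ := 6 * (A * C₁) with hc₁
  set c₂ : ℝ := 12 * (d * T) ^ a * (A * C₂) / (1 - (2 : ℝ) ^ (-(a / 2))) with hc₂
  have hc₁0 : 0 < c₁ := by positivity
  have hc₂0 : 0 < c₂ := by positivity
  refine ⟨c₁ + c₂, by positivity, ?_⟩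
  intro Ω _ P _ ξ f Y hξ hY hf hf' m hm k₀ p hp hpd hpa hs
  have hm0 : (0 : ℝ) < m := by exact_mod_cast hm
  have hl0 := log_one_add_pos hm0
  have hlim : ∀ᵐ ω ∂P, Tendsto (fun n => ∑ j ∈ Finset.Ico m (n + m), ξ j ω • f j) atTop
      (𝓝 (Y ω - ∑ j ∈ Finset.range m, ξ j ω • f j)) := by
    filter_upwards [hY] with ω hω
    refine ((hω.comp (tendsto_add_atTop_nat m)).sub_const _).congr fun n => ?_
    simp only [Function.comp]
    rw [Finset.sum_Ico_eq_sub _ (Nat.le_add_left m n)]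
  have hmeas : ∀ n, AEStronglyMeasurable
      (fun ω => ∑ j ∈ Finset.Ico m (n + m), ξ j ω • f j) P := fun n =>
    (Finset.stronglyMeasurable_fun_sum _ fun j _ =>
      (hξ.measurable j).stronglyMeasurable.smul_const (f j)).aestronglyMeasurable
  refine (Lp.eLpNorm_lim_le_liminf_eLpNorm hmeas _ hlim).trans
    ((liminf_le_liminf (Eventually.of_forall fun n => ?_)).trans
      (liminf_const (f := atTop (α := ℕ)) _).le)
  refine (eLpNorm_le_eLpNorm_of_exponent_le (ENNReal.ofReal_le_ofReal hs) (hmeas n)).trans ?_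
  have hdec : ∀ θ (j : ℕ), 0 < decay θ γ ((j : ℝ) + 1) := fun θ j => decay_pos (by positivity)
  refine (hξ.eLpNorm_chaining hT hd f (Finset.Ico m (n + m))
    (S := A * (C₁ * ((m : ℝ) ^ (1 / 2 - θ) * Real.log (1 + m) ^ γ)))
    (H := A * (C₂ * ((m : ℝ) ^ (1 / 2 - θ') * Real.log (1 + m) ^ γ)))
    (by positivity) (by positivity) ha ?_ (fun j => A * decay θ' γ ((j : ℝ) + 1))
    (fun j _ => hf' j) (fun j _ => (mul_pos hA (hdec _ j)).le) ?_ k₀ hp hpd hpa).trans ?_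
  · rw [mul_pow]
    refine le_trans ?_ (mul_le_mul_of_nonneg_left (h₁ m (n + m) hm) (by positivity))
    rw [Finset.mul_sum]
    refine Finset.sum_le_sum fun j _ => ?_
    rw [← mul_pow]
    exact pow_le_pow_left₀ (norm_nonneg _) (hf j) 2
  · rw [mul_pow]
    refine le_trans (le_of_eq ?_) (mul_le_mul_of_nonneg_left (h₂ m (n + m) hm) (by positivity))
    rw [Finset.mul_sum]
    simp only [mul_pow]
  · apply ENNReal.ofReal_le_ofReal
    set u := (2 : ℝ) ^ (k₀ * ((d : ℝ) / (2 * p))) * (m : ℝ) ^ (1 / 2 - θ) with hu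
    set v := ((2 : ℝ) ^ (-(a / 2))) ^ k₀ * (m : ℝ) ^ (1 / 2 - θ') with hv
    have hu0 : 0 < u := by positivity
    have hv0 : 0 < v := by positivity
    calc _ = √(2 * p) * (c₁ * u + c₂ * v) * Real.log (1 + m) ^ γ := by
          rw [hc₁, hc₂, hu, hv]; ring
      _ ≤ √(2 * p) * ((c₁ + c₂) * (u + v)) * Real.log (1 + m) ^ γ := by
          gcongr
          nlinarith [mul_pos hc₁0 hv0, mul_pos hc₂0 hu0]
      _ = _ := by ring

/-- If the Hölder constants decay like the sup-norms, the remainder has the order of its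
pointwise standard deviation. -/
theorem exists_eLpNorm_tail_le_of_holder {T : ℝ} (hT : 0 < T) {d : ℕ} (hd : 1 ≤ d)
    {θ γ a A : ℝ} (s : ℝ) (hθ : 1 / 2 < θ) (hγ : 0 ≤ γ) (ha : 0 < a) (hA : 0 < A) :
    ∃ C : ℝ, 0 < C ∧ ∀ (Ω : Type u) [MeasurableSpace Ω] (P : Measure Ω) [IsProbabilityMeasure P]
      (ξ : ℕ → Ω → ℝ) (f : ℕ → PathSpace T d) (Y : Ω → PathSpace T d),
      IsStdNormalSeq P ξ → IsSeriesSum P ξ f Y →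
      (∀ j : ℕ, ‖f j‖ ≤ A * decay θ γ ((j : ℝ) + 1)) →
      (∀ j : ℕ, ∀ x y, |f j x - f j y| ≤ A * decay θ γ ((j : ℝ) + 1) * dist x y ^ a) →
      ∀ m : ℕ, 1 ≤ m →
      eLpNorm (fun ω => Y ω - ∑ j ∈ Finset.range m, ξ j ω • f j) (ENNReal.ofReal s) P ≤
        ENNReal.ofReal (C * ((m : ℝ) ^ (1 / 2 - θ) * Real.log (1 + m) ^ γ)) := by
  obtain ⟨C, hC, h⟩ := exists_eLpNorm_tail_le.{u} hT hd (s := s) hθ hθ hγ ha hA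
  obtain ⟨p, hp⟩ := exists_nat_ge (max (max (d : ℝ) 1) (max (d / a) s))
  simp only [max_le_iff] at hp
  obtain ⟨⟨hpd, hp1⟩, hpa, hps⟩ := hp
  have hp0 : (0 : ℝ) < p := by linarith
  refine ⟨C * √(2 * p) * 2, by positivity, ?_⟩
  intro Ω _ P _ ξ f Y hξ hY hf hf' m hm
  refine (h Ω P ξ f Y hξ hY hf hf' m hm 0 p (by exact_mod_cast hp1) ?_ ?_ ?_).trans ?_
  · have : d ≤ p := by exact_mod_cast hpd
    omega
  · rw [div_le_iff₀ (by positivity)]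
    rw [div_le_iff₀ ha] at hpa
    linarith
  · linarith
  · apply ENNReal.ofReal_le_ofReal
    simp
    linarith

/-- Whatever the decay of the Hölder constants, a union bound over a grid of polynomial size in
`m` costs a factor `√(log (1 + m))`. -/
theorem exists_eLpNorm_tail_le_log {T : ℝ} (hT : 0 < T) {d : ℕ} (hd : 1 ≤ d)
    {θ θ' γ a A : ℝ} (s : ℝ) (hθ : 1 / 2 < θ) (hθ' : 1 / 2 < θ') (hθθ' : θ' ≤ θ)
    (hγ : 0 ≤ γ) (ha : 0 < a) (hA : 0 < A) :
    ∃ C : ℝ, 0 < C ∧ ∀ (Ω : Type u) [MeasurableSpace Ω] (P : Measure Ω) [IsProbabilityMeasure P]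
      (ξ : ℕ → Ω → ℝ) (f : ℕ → PathSpace T d) (Y : Ω → PathSpace T d),
      IsStdNormalSeq P ξ → IsSeriesSum P ξ f Y →
      (∀ j : ℕ, ‖f j‖ ≤ A * decay θ γ ((j : ℝ) + 1)) →
      (∀ j : ℕ, ∀ x y, |f j x - f j y| ≤ A * decay θ' γ ((j : ℝ) + 1) * dist x y ^ a) →
      ∀ m : ℕ, 1 ≤ m →
      eLpNorm (fun ω => Y ω - ∑ j ∈ Finset.range m, ξ j ω • f j) (ENNReal.ofReal s) P ≤
        ENNReal.ofReal (C * ((m : ℝ) ^ (1 / 2 - θ) * Real.log (1 + m) ^ (γ + 1 / 2))) := by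
  obtain ⟨C, hC, h⟩ := exists_eLpNorm_tail_le.{u} hT hd (s := s) hθ hθ' hγ ha hA
  obtain ⟨p₀, hp⟩ := exists_nat_ge (max (max (d : ℝ) 1) (max (d / a) s))
  simp only [max_le_iff] at hp
  obtain ⟨⟨hpd, hp1⟩, hpa, hps⟩ := hp
  have hp0 : (0 : ℝ) < p₀ := by linarith
  have hlog2 : 0 < Real.log 2 := Real.log_pos (by norm_num)
  have hd0 : (0 : ℝ) < d := by exact_mod_cast hd
  set κ : ℝ := 2 * (θ - θ') / a / Real.log 2 with hκ
  have hκ0 : 0 ≤ κ := by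
    have : 0 ≤ θ - θ' := by linarith
    positivity
  set K : ℝ := 2 * (p₀ / Real.log 2 + d * (κ + 1 / Real.log 2)) with hK
  have hK0 : 0 < K := by positivity
  refine ⟨C * √K * 3, by positivity, ?_⟩
  intro Ω _ P _ ξ f Y hξ hY hf hf' m hm
  have hm1 : (1 : ℝ) ≤ m := by exact_mod_cast hm
  have hm0 : (0 : ℝ) < m := by linarith
  have hl0 := log_one_add_pos hm0
  have hl2 : Real.log 2 ≤ Real.log (1 + m) := Real.log_le_log (by norm_num) (by linarith)
  have hlm : Real.log m ≤ Real.log (1 + m) := Real.log_le_log hm0 (by linarith)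
  have hlm0 : 0 ≤ Real.log m := Real.log_nonneg hm1
  -- The grid of level `k₀` has mesh at most `m ^ (-2 (θ - θ') / a)`.
  set k₀ : ℕ := ⌈κ * Real.log m⌉₊ with hk₀
  have hk1 : κ * Real.log m ≤ k₀ := Nat.le_ceil _
  have hk2 : (k₀ : ℝ) ≤ κ * Real.log m + 1 := (Nat.ceil_lt_add_one (by positivity)).le
  have hpp : (p₀ : ℝ) ≤ ((p₀ + d * k₀ : ℕ) : ℝ) := by
    push_cast
    nlinarith [(Nat.cast_nonneg k₀ : (0 : ℝ) ≤ k₀)]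
  have hpk : (d : ℝ) * k₀ ≤ ((p₀ + d * k₀ : ℕ) : ℝ) := by push_cast; linarith
  have hpK : 2 * ((p₀ + d * k₀ : ℕ) : ℝ) ≤ K * Real.log (1 + m) := by
    have h1 : (1 : ℝ) ≤ 1 / Real.log 2 * Real.log (1 + m) := by
      rw [div_mul_eq_mul_div, one_mul, one_le_div hlog2]; exact hl2
    have h2 : (k₀ : ℝ) ≤ (κ + 1 / Real.log 2) * Real.log (1 + m) := by
      nlinarith [mul_le_mul_of_nonneg_left hlm hκ0]
    have h3 : (p₀ : ℝ) ≤ p₀ / Real.log 2 * Real.log (1 + m) := by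
      calc (p₀ : ℝ) = p₀ * 1 := by ring
        _ ≤ p₀ * (1 / Real.log 2 * Real.log (1 + m)) := by gcongr
        _ = _ := by ring
    push_cast
    have h4 := mul_le_mul_of_nonneg_left h2 hd0.le
    rw [hK]
    nlinarith
  set p : ℕ := p₀ + d * k₀ with hpdef
  have hp00 : (0 : ℝ) < p := by linarith
  refine (h Ω P ξ f Y hξ hY hf hf' m hm k₀ p ?_ ?_ ?_ ?_).trans ?_
  · have : (1 : ℝ) ≤ p := by linarith
    exact_mod_cast this
  · have : (d : ℝ) ≤ p := by linarith
    have : d ≤ p := by exact_mod_cast this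
    omega
  · rw [div_le_iff₀ (by positivity)]
    rw [div_le_iff₀ ha] at hpa
    nlinarith
  · linarith
  · apply ENNReal.ofReal_le_ofReal
    have e1 : (2 : ℝ) ^ (k₀ * ((d : ℝ) / (2 * p))) ≤ 2 := by
      calc (2 : ℝ) ^ (k₀ * ((d : ℝ) / (2 * p))) ≤ 2 ^ (1 : ℝ) := by
            apply Real.rpow_le_rpow_of_exponent_le (by norm_num)
            rw [← mul_div_assoc, div_le_one (by positivity)]
            linarith
        _ = 2 := by norm_num
    have e2 : ((2 : ℝ) ^ (-(a / 2))) ^ k₀ ≤ (m : ℝ) ^ (θ' - θ) := by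
      rw [← Real.rpow_natCast, ← Real.rpow_mul (by norm_num), Real.rpow_def_of_pos (by norm_num),
        Real.rpow_def_of_pos hm0]
      apply Real.exp_le_exp.2
      have h1 : Real.log 2 * (a / 2) * (κ * Real.log m) = Real.log m * (θ - θ') := by
        rw [hκ]; field_simp
      have h2 := mul_le_mul_of_nonneg_left hk1 (by positivity : 0 ≤ Real.log 2 * (a / 2))
      linarith
    have e3 : (m : ℝ) ^ (θ' - θ) * (m : ℝ) ^ (1 / 2 - θ') = (m : ℝ) ^ (1 / 2 - θ) := by
      rw [← Real.rpow_add hm0]; congr 1; ring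
    have e4 : √(2 * p) ≤ √K * Real.log (1 + m) ^ (1 / 2 : ℝ) := by
      rw [← Real.sqrt_eq_rpow, ← Real.sqrt_mul hK0.le]
      exact Real.sqrt_le_sqrt hpK
    calc _ ≤ C * (√K * Real.log (1 + m) ^ (1 / 2 : ℝ)) * (2 * (m : ℝ) ^ (1 / 2 - θ) +
          (m : ℝ) ^ (θ' - θ) * (m : ℝ) ^ (1 / 2 - θ')) * Real.log (1 + m) ^ γ := by
          gcongr
      _ = C * √K * 3 * ((m : ℝ) ^ (1 / 2 - θ) *
          (Real.log (1 + m) ^ γ * Real.log (1 + m) ^ (1 / 2 : ℝ))) := by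
          rw [e3]; ring
      _ = _ := by rw [← Real.rpow_add hl0]

theorem HolderCondition.abs_sub_le {T : ℝ} {d : ℕ} {a : ℝ≥0} {b C₂ : ℝ} {f : ℕ → PathSpace T d}
    (hf : HolderCondition a b C₂ f) (j : ℕ) (x y : cube T d) :
    |f j x - f j y| ≤ max C₂ 1 * ((j : ℝ) + 1) ^ b * dist x y ^ (a : ℝ) := by
  have h := hf j
  have hmem : MemHolder a (f j) := eHolderNorm_lt_top.1 (h.trans_lt ENNReal.ofReal_lt_top)
  have hx : (0 : ℝ) < (j : ℝ) + 1 := by positivity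
  have h1 : (nnHolderNorm a (f j) : ℝ) ≤ max C₂ 1 * ((j : ℝ) + 1) ^ b := by
    have h0 : 0 ≤ max C₂ 1 * ((j : ℝ) + 1) ^ b := by positivity
    rw [← hmem.coe_nnHolderNorm_eq_eHolderNorm] at h
    have h2 : (nnHolderNorm a (f j) : ℝ≥0∞) ≤
        ENNReal.ofReal (max C₂ 1 * ((j : ℝ) + 1) ^ b) := by
      refine h.trans (ENNReal.ofReal_le_ofReal ?_)
      gcongr
      exact le_max_left _ _
    have h3 := ENNReal.toReal_mono ENNReal.ofReal_ne_top h2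
    rwa [ENNReal.toReal_ofReal h0, ENNReal.coe_toReal] at h3
  have h4 := hmem.holderWith.dist_le x y
  rw [Real.dist_eq] at h4
  exact h4.trans (by gcongr)

/-- The remainder of a series satisfying the size and Hölder conditions. In the general case the
Hölder constants may grow; interpolation with the sup-norms gives a smaller Hölder exponent, but
constants whose decay is still of order better than `1 / 2`. -/
theorem exists_eLpNorm_tail_le_rate {T : ℝ} (hT : 0 < T) {d : ℕ} (hd : 1 ≤ d)
    {θ γ : ℝ} {a : ℝ≥0} (b C₁ C₂ s : ℝ) (hθ : 1 / 2 < θ) (hγ : 0 ≤ γ) (ha : 0 < a) :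
    ∃ C : ℝ, 0 < C ∧ ∀ (Ω : Type u) [MeasurableSpace Ω] (P : Measure Ω) [IsProbabilityMeasure P]
      (ξ : ℕ → Ω → ℝ) (f : ℕ → PathSpace T d) (Y : Ω → PathSpace T d),
      IsStdNormalSeq P ξ → IsSeriesSum P ξ f Y →
      SizeCondition θ γ C₁ f → HolderCondition a b C₂ f →
      ∀ m : ℕ, 1 ≤ m →
      eLpNorm (fun ω => Y ω - ∑ j ∈ Finset.range m, ξ j ω • f j) (ENNReal.ofReal s) P ≤
        ENNReal.ofReal (C * ((m : ℝ) ^ (1 / 2 - θ) * Real.log (1 + m) ^ (γ + 1 / 2))) ∧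
      (b + θ ≤ 0 →
        eLpNorm (fun ω => Y ω - ∑ j ∈ Finset.range m, ξ j ω • f j) (ENNReal.ofReal s) P ≤
          ENNReal.ofReal (C * ((m : ℝ) ^ (1 / 2 - θ) * Real.log (1 + m) ^ γ))) := by
  have ha' : (0 : ℝ) < a := ha
  have hlog2 : 0 < Real.log 2 := Real.log_pos (by norm_num)
  -- An interpolation weight `l` for which `θ (1 - l) - b l > 1 / 2`.
  obtain ⟨l, hl0, hl1, hl⟩ : ∃ l : ℝ, 0 < l ∧ l ≤ 1 ∧ l * (θ + |b|) ≤ (θ - 1 / 2) / 2 := by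
    refine ⟨(θ - 1 / 2) / 2 / (θ + |b|), ?_, ?_, ?_⟩
    · have := abs_nonneg b
      have : 0 < θ + |b| := by linarith
      have : 0 < θ - 1 / 2 := by linarith
      positivity
    · rw [div_le_one (by linarith [abs_nonneg b])]; linarith [abs_nonneg b]
    · rw [div_mul_cancel₀ _ (by have := abs_nonneg b; positivity)]
  set D₁ : ℝ := max C₁ 1 with hD₁
  set D₂ : ℝ := max C₂ 1 with hD₂
  have hD₁0 : 0 < D₁ := by positivity
  have hD₂0 : 0 < D₂ := by positivity
  set θ' : ℝ := θ - l * (θ + |b|) with hθ'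
  have hθ'1 : 1 / 2 < θ' := by linarith
  have hθ'2 : θ' ≤ θ := by
    have : 0 ≤ l * (θ + |b|) := by have := abs_nonneg b; positivity
    linarith
  set A : ℝ := max D₁ (D₂ * Real.log 2 ^ (-γ)) with hA
  set A' : ℝ := max D₁ ((2 * D₁) ^ (1 - l) * D₂ ^ l * Real.log 2 ^ (-(γ * l))) with hA'
  have hA0 : 0 < A := lt_max_of_lt_left hD₁0
  have hA'0 : 0 < A' := lt_max_of_lt_left hD₁0
  obtain ⟨K, hK0, hK⟩ := exists_eLpNorm_tail_le_of_holder.{u} hT hd s hθ hγ ha' hA0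
  obtain ⟨K', hK'0, hK'⟩ := exists_eLpNorm_tail_le_log.{u} hT hd s hθ hθ'1 hθ'2 hγ
    (mul_pos ha' hl0) hA'0
  refine ⟨max K K', lt_max_of_lt_left hK0, ?_⟩
  intro Ω _ P _ ξ f Y hξ hY hf hf' m hm
  have hm0 : (0 : ℝ) < m := by exact_mod_cast hm
  have hlm0 := log_one_add_pos hm0
  have hsize : ∀ j : ℕ, ‖f j‖ ≤ D₁ * decay θ γ ((j : ℝ) + 1) := fun j => by
    have hx : (0 : ℝ) < (j : ℝ) + 1 := by positivity
    have h0 := decay_pos (θ := θ) (γ := γ) hx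
    have h1 := hf j
    rw [mul_assoc] at h1
    refine h1.trans ?_
    change C₁ * decay θ γ ((j : ℝ) + 1) ≤ _
    gcongr
    exact le_max_left _ _
  have hlog : ∀ (j : ℕ) (e : ℝ), 0 ≤ e →
      1 ≤ Real.log 2 ^ (-e) * Real.log (1 + ((j : ℝ) + 1)) ^ e := fun j e he => by
    have h1 : Real.log 2 ≤ Real.log (1 + ((j : ℝ) + 1)) :=
      Real.log_le_log (by norm_num) (by linarith [(Nat.cast_nonneg j : (0 : ℝ) ≤ j)])
    have h2 : Real.log 2 ^ (-e) * Real.log 2 ^ e = 1 := by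
      rw [← Real.rpow_add hlog2]; simp
    refine h2.ge.trans ?_
    gcongr
  constructor
  · refine (hK' Ω P ξ f Y hξ hY (fun j => ?_) (fun j x y => ?_) m hm).trans ?_
    · refine (hsize j).trans ?_
      have h0 := decay_pos (θ := θ) (γ := γ) (by positivity : (0 : ℝ) < (j : ℝ) + 1)
      gcongr
      exact le_max_left _ _
    · have h1 : |f j x - f j y| ≤ 2 * (D₁ * decay θ γ ((j : ℝ) + 1)) := by
        have hx := ((f j).norm_coe_le_norm x).trans (hsize j)
        have hy := ((f j).norm_coe_le_norm y).trans (hsize j)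
        have := norm_sub_le (f j x) (f j y)
        rw [Real.norm_eq_abs] at this
        linarith
      have h2 := hf'.abs_sub_le j x y
      rw [← hD₂] at h2
      set t : ℝ := (j : ℝ) + 1 with ht
      have ht1 : 1 ≤ t := by rw [ht]; linarith [(Nat.cast_nonneg j : (0 : ℝ) ≤ j)]
      have ht0 : 0 < t := by linarith
      have hL := log_one_add_pos ht0
      have hρ : 0 ≤ dist x y := dist_nonneg
      have h3 : |f j x - f j y| ≤
          (2 * (D₁ * decay θ γ t)) ^ (1 - l) * (D₂ * t ^ b * dist x y ^ (a : ℝ)) ^ l := by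
        rcases (abs_nonneg (f j x - f j y)).eq_or_lt with h0 | h0
        · rw [← h0]
          have := decay_pos (θ := θ) (γ := γ) ht0
          positivity
        · calc |f j x - f j y| = |f j x - f j y| ^ (1 - l) * |f j x - f j y| ^ l := by
                rw [← Real.rpow_add h0]; simp
            _ ≤ _ := by
                have : 0 ≤ 1 - l := by linarith
                have := decay_pos (θ := θ) (γ := γ) ht0
                gcongr
      refine h3.trans ?_
      have e1 : (2 * (D₁ * decay θ γ t)) ^ (1 - l) = (2 * D₁) ^ (1 - l) *
          (t ^ (-θ * (1 - l)) * Real.log (1 + t) ^ (γ * (1 - l))) := by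
        unfold decay
        rw [← mul_assoc, Real.mul_rpow (x := 2 * D₁) (by positivity) (by positivity),
          Real.mul_rpow (x := t ^ (-θ)) (by positivity) (by positivity), ← Real.rpow_mul ht0.le,
          ← Real.rpow_mul hL.le]
      have e2 : (D₂ * t ^ b * dist x y ^ (a : ℝ)) ^ l =
          D₂ ^ l * t ^ (b * l) * dist x y ^ (a * l) := by
        rw [Real.mul_rpow (by positivity) (by positivity), Real.mul_rpow hD₂0.le (by positivity),
          ← Real.rpow_mul ht0.le, ← Real.rpow_mul hρ]
      have e3 : t ^ (-θ * (1 - l)) * t ^ (b * l) ≤ t ^ (-θ') := by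
        rw [← Real.rpow_add ht0]
        apply Real.rpow_le_rpow_of_exponent_le ht1
        rw [hθ']
        nlinarith [le_abs_self b]
      have e4 : Real.log (1 + t) ^ (γ * (1 - l)) ≤
          Real.log 2 ^ (-(γ * l)) * Real.log (1 + t) ^ γ := by
        have h5 := hlog j (γ * l) (by positivity)
        have h6 : Real.log (1 + t) ^ γ =
            Real.log (1 + t) ^ (γ * l) * Real.log (1 + t) ^ (γ * (1 - l)) := by
          rw [← Real.rpow_add hL]; congr 1; ring
        rw [h6, ← mul_assoc]
        exact le_mul_of_one_le_left (by positivity) h5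
      rw [e1, e2]
      calc _ = (2 * D₁) ^ (1 - l) * D₂ ^ l * (t ^ (-θ * (1 - l)) * t ^ (b * l)) *
            Real.log (1 + t) ^ (γ * (1 - l)) * dist x y ^ (a * l) := by ring
        _ ≤ (2 * D₁) ^ (1 - l) * D₂ ^ l * t ^ (-θ') *
            (Real.log 2 ^ (-(γ * l)) * Real.log (1 + t) ^ γ) * dist x y ^ (a * l) := by
            gcongr
        _ = (2 * D₁) ^ (1 - l) * D₂ ^ l * Real.log 2 ^ (-(γ * l)) * decay θ' γ t *
            dist x y ^ (a * l) := by unfold decay; ring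
        _ ≤ _ := by
            have := decay_pos (θ := θ') (γ := γ) ht0
            gcongr
            exact le_max_right _ _
    · apply ENNReal.ofReal_le_ofReal
      gcongr
      exact le_max_right _ _
  · intro hb
    refine (hK Ω P ξ f Y hξ hY (fun j => ?_) (fun j x y => ?_) m hm).trans ?_
    · refine (hsize j).trans ?_
      have h0 := decay_pos (θ := θ) (γ := γ) (by positivity : (0 : ℝ) < (j : ℝ) + 1)
      gcongr
      exact le_max_left _ _
    · refine (hf'.abs_sub_le j x y).trans ?_
      rw [← hD₂]
      have h5 := hlog j γ hγ
      have ht1 : (1 : ℝ) ≤ (j : ℝ) + 1 := by linarith [(Nat.cast_nonneg j : (0 : ℝ) ≤ j)]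
      set t : ℝ := (j : ℝ) + 1 with ht
      have ht0 : 0 < t := by linarith
      have hL := log_one_add_pos ht0
      have h6 : t ^ b ≤ t ^ (-θ) := Real.rpow_le_rpow_of_exponent_le ht1 (by linarith)
      have hρ : 0 ≤ dist x y := dist_nonneg
      calc D₂ * t ^ b * dist x y ^ (a : ℝ) ≤ D₂ * (t ^ (-θ) * (Real.log 2 ^ (-γ) *
            Real.log (1 + t) ^ γ)) * dist x y ^ (a : ℝ) := by
            gcongr
            exact h6.trans (le_mul_of_one_le_right (by positivity) h5)
        _ = D₂ * Real.log 2 ^ (-γ) * decay θ γ t * dist x y ^ (a : ℝ) := by unfold decay; ring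
        _ ≤ _ := by
            have := decay_pos (θ := θ) (γ := γ) ht0
            gcongr
            exact le_max_right _ _
    · apply ENNReal.ofReal_le_ofReal
      gcongr
      exact le_max_left _ _

end Tail

/-! ### Existence of optimal quantizers -/

section OptimalQuantizers

/-- The `L^r`-distortion `∫ dist(x, α) ^ r dμ(x)` of a finite codebook `α`; it is `∞` for the empty
codebook. -/
noncomputable def distortion (r : ℝ) (μ : Measure ℝ) (α : Finset ℝ) : ℝ≥0∞ :=
  ∫⁻ x, Metric.infEDist x (α : Set ℝ) ^ r ∂μ

/-- A codebook with at most `N` points whose distortion is minimal among all such codebooks. -/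
structure IsOptimalCodebook (r : ℝ) (μ : Measure ℝ) (N : ℕ) (α : Finset ℝ) : Prop where
  nonempty : α.Nonempty
  card_le : α.card ≤ N
  le : ∀ β : Finset ℝ, β.Nonempty → β.card ≤ N → distortion r μ α ≤ distortion r μ β

theorem infEDist_image_univ {N : ℕ} (e : Fin N → ℝ) (x : ℝ) :
    Metric.infEDist x ((Finset.univ.image e : Finset ℝ) : Set ℝ)
      = Finset.univ.inf fun i => edist x (e i) := by
  rw [Finset.coe_image, Finset.coe_univ, Set.image_univ, Metric.infEDist, iInf_range,
    Finset.inf_univ_eq_iInf]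

theorem exists_image_univ_eq {N : ℕ} {α : Finset ℝ} (hα : α.Nonempty) (hN : α.card ≤ N) :
    ∃ e : Fin N → ℝ, Finset.univ.image e = α := by
  have hne : Nonempty α := hα.to_subtype
  obtain ⟨g⟩ : Nonempty (α ↪ Fin N) := Function.Embedding.nonempty_of_card_le (by simpa using hN)
  refine ⟨fun i => (Function.invFun g i : α), ?_⟩
  ext x
  simp only [Finset.mem_image, Finset.mem_univ, true_and]
  constructor
  · rintro ⟨i, rfl⟩
    exact (Function.invFun g i).2
  · intro hx
    exact ⟨g ⟨x, hx⟩, by rw [Function.leftInverse_invFun g.injective]⟩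

theorem IsOptimalCodebook.of_image_univ {r : ℝ} {μ : Measure ℝ} {N : ℕ} (hN : 1 ≤ N)
    {e : Fin N → ℝ}
    (he : ∀ e' : Fin N → ℝ,
      distortion r μ (Finset.univ.image e) ≤ distortion r μ (Finset.univ.image e')) :
    IsOptimalCodebook r μ N (Finset.univ.image e) where
  nonempty := ⟨e ⟨0, hN⟩, Finset.mem_image_of_mem _ (Finset.mem_univ _)⟩
  card_le := Finset.card_image_le.trans (by simp)
  le β hβ hβN := by
    obtain ⟨e', rfl⟩ := exists_image_univ_eq hβ hβN
    exact he e'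

/-- The distance from a real number to an extended real number; it is `∞` at `±∞`. -/
noncomputable def extDist (x : ℝ) (y : EReal) : ℝ≥0∞ :=
  max (y - x).toENNReal (x - y).toENNReal

theorem continuous_extDist (x : ℝ) : Continuous (extDist x) := by
  have h1 : Continuous fun y : EReal => y - x := by
    rw [continuous_iff_continuousAt]
    intro y
    have := EReal.continuousAt_add (p := (y, -(x : EReal))) (Or.inr (by simp [← EReal.coe_neg]))
      (Or.inr (by simp [← EReal.coe_neg]))
    exact ContinuousAt.comp (f := fun y : EReal => (y, -(x : EReal))) this (by fun_prop)
  have h2 : Continuous fun y : EReal => x - y := by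
    rw [continuous_iff_continuousAt]
    intro y
    have := EReal.continuousAt_add (p := ((x : EReal), -y)) (Or.inl (by simp)) (Or.inl (by simp))
    exact ContinuousAt.comp (f := fun y : EReal => ((x : EReal), -y)) this (by fun_prop)
  exact (h1.ereal_toENNReal).max (h2.ereal_toENNReal)

theorem extDist_coe (x y : ℝ) : extDist x y = edist x y := by
  rw [extDist, ← EReal.coe_sub, ← EReal.coe_sub, EReal.toENNReal_of_ne_top (EReal.coe_ne_top _),
    EReal.toENNReal_of_ne_top (EReal.coe_ne_top _), EReal.toReal_coe, EReal.toReal_coe, edist_dist,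
    Real.dist_eq, ← ENNReal.ofReal_max, abs_eq_max_neg, neg_sub, max_comm]

theorem extDist_top (x : ℝ) : extDist x ⊤ = ⊤ := by
  simp [extDist]

theorem extDist_bot (x : ℝ) : extDist x ⊥ = ⊤ := by
  simp [extDist]

/-- Optimal codebooks exist. A minimizing sequence of `N`-tuples has a limit in the compact space
of extended-real tuples, points at `±∞` do not contribute to the distance to the codebook, and
Fatou's lemma shows that the finite points of the limit form a minimizer. -/
theorem exists_isOptimalCodebook {r : ℝ} (hr : 0 < r) (μ : Measure ℝ) [IsProbabilityMeasure μ]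
    {N : ℕ} (hN : 1 ≤ N) : ∃ α, IsOptimalCodebook r μ N α := by
  let Φ : (Fin N → ℝ) → ℝ≥0∞ := fun e => distortion r μ (Finset.univ.image e)
  suffices h : ∃ e, ∀ e', Φ e ≤ Φ e' by
    obtain ⟨e, he⟩ := h
    exact ⟨_, IsOptimalCodebook.of_image_univ hN he⟩
  set I : ℝ≥0∞ := sInf (Set.range Φ) with hI
  have hIle : ∀ e, I ≤ Φ e := fun e => sInf_le ⟨e, rfl⟩
  suffices h : ∃ e, Φ e ≤ I by
    obtain ⟨e, he⟩ := h
    exact ⟨e, fun e' => he.trans (hIle e')⟩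
  obtain ⟨u, -, hu, hur⟩ := exists_seq_tendsto_sInf (Set.range_nonempty Φ) (OrderBot.bddBelow _)
  choose e he using hur
  obtain ⟨L, φ, hφ, hL⟩ := CompactSpace.tendsto_subseq
    (fun n => (fun i => (e n i : EReal) : Fin N → EReal))
  have hcont : ∀ x : ℝ, Continuous fun y : Fin N → EReal =>
      Finset.univ.inf fun i => extDist x (y i) := fun x =>
    Continuous.finset_inf_apply fun i _ => (continuous_extDist x).comp (continuous_apply i)
  have hpt : ∀ x : ℝ, Tendsto (fun n => Metric.infEDist x
      ((Finset.univ.image (e (φ n)) : Finset ℝ) : Set ℝ) ^ r) atTop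
      (𝓝 ((Finset.univ.inf fun i => extDist x (L i)) ^ r)) := fun x => by
    have h1 := ((hcont x).tendsto L).comp hL
    refine ((ENNReal.continuous_rpow_const (y := r)).tendsto _).comp (h1.congr fun n => ?_)
    simp only [Function.comp, extDist_coe, infEDist_image_univ]
  have hfatou : ∫⁻ x, (Finset.univ.inf fun i => extDist x (L i)) ^ r ∂μ ≤ I := by
    have h1 := lintegral_liminf_le (μ := μ) (u := atTop)
      (f := fun (n : ℕ) x => Metric.infEDist x
        ((Finset.univ.image (e (φ n)) : Finset ℝ) : Set ℝ) ^ r)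
      (fun n => by fun_prop)
    rw [lintegral_congr fun x => (hpt x).liminf_eq] at h1
    refine h1.trans (le_of_eq ?_)
    have h2 : Tendsto (fun n => Φ (e (φ n))) atTop (𝓝 I) :=
      (hu.comp hφ.tendsto_atTop).congr fun n => (he (φ n)).symm
    exact h2.liminf_eq
  by_cases hfin : ∃ i y, L i = (y : ℝ)
  · obtain ⟨i₀, y₀, hi₀⟩ := hfin
    refine ⟨fun i => if L i = ⊤ ∨ L i = ⊥ then y₀ else (L i).toReal, ?_⟩
    refine le_trans (lintegral_mono fun x => ?_) hfatou
    simp only [infEDist_image_univ]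
    refine ENNReal.rpow_le_rpow ?_ hr.le
    refine Finset.le_inf fun i _ => ?_
    refine (Finset.inf_le (Finset.mem_univ i)).trans ?_
    by_cases h : L i = ⊤ ∨ L i = ⊥
    · rcases h with h | h <;> simp [h, extDist_top, extDist_bot]
    · rw [if_neg h, ← extDist_coe, EReal.coe_toReal]
      · exact fun h1 => h (Or.inl h1)
      · exact fun h1 => h (Or.inr h1)
  · refine ⟨fun _ => 0, ?_⟩
    have hinf : ∀ x, (Finset.univ.inf fun i => extDist x (L i)) = ⊤ := fun x => by
      rw [eq_top_iff]
      refine Finset.le_inf fun i _ => ?_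
      induction h : L i with
      | bot => rw [extDist_bot]
      | top => rw [extDist_top]
      | coe y => exact absurd ⟨i, y, h⟩ hfin
    simp only [hinf, ENNReal.top_rpow_of_pos hr, lintegral_const, measure_univ, mul_one,
      top_le_iff] at hfatou
    rw [hfatou]
    exact le_top

/-- A measurable projection on a finite codebook. -/
theorem exists_measurable_nearest {α : Finset ℝ} (hα : α.Nonempty) :
    ∃ p : ℝ → ℝ, Measurable p ∧ ∀ x, p x ∈ α ∧ edist x (p x) = Metric.infEDist x (α : Set ℝ) := by
  obtain ⟨e, he⟩ := exists_image_univ_eq hα le_rfl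
  have hN : 0 < α.card := hα.card_pos
  let e' : ℕ → ℝ := fun k => e ⟨min k (α.card - 1), by omega⟩
  refine ⟨SimpleFunc.nearestPt e' (α.card - 1), SimpleFunc.measurable _, fun x => ?_⟩
  have hmem : ∀ k, e' k ∈ α := fun k => by
    rw [← he]; exact Finset.mem_image_of_mem _ (Finset.mem_univ _)
  have h1 : SimpleFunc.nearestPt e' (α.card - 1) x ∈ α := by
    rw [SimpleFunc.nearestPt, SimpleFunc.map_apply]; exact hmem _
  refine ⟨h1, le_antisymm ?_ (Metric.infEDist_le_edist_of_mem h1)⟩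
  refine le_iInf₂ fun y hy => ?_
  rw [Finset.mem_coe, ← he, Finset.mem_image] at hy
  obtain ⟨i, -, rfl⟩ := hy
  have h2 := SimpleFunc.edist_nearestPt_le e' x (k := i) (N := α.card - 1) (by omega)
  rw [edist_comm, edist_comm x]
  have h3 : e' i = e i := congrArg e (Fin.ext (min_eq_left (by omega)))
  rwa [h3] at h2

variable {Ω : Type*} [MeasurableSpace Ω] {P : Measure Ω} {r : ℝ}
  {N : ℕ} {X : Ω → ℝ}

theorem lintegral_infEDist_comp (hX : Measurable X) (α : Finset ℝ) :
    ∫⁻ ω, Metric.infEDist (X ω) (α : Set ℝ) ^ r ∂P = distortion r (P.map X) α := by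
  rw [distortion, lintegral_map (by fun_prop) hX]

/-- The values of a quantization form a codebook. -/
theorem IsQuantization.exists_codebook [Nonempty Ω] {Xhat : Ω → ℝ} (h : IsQuantization N Xhat) :
    ∃ α : Finset ℝ, α.Nonempty ∧ α.card ≤ N ∧ ∀ ω, Xhat ω ∈ α := by
  have hfin : (Set.range Xhat).Finite := Set.finite_of_encard_le_coe h.2
  refine ⟨hfin.toFinset, ?_, ?_, fun ω => by simp⟩
  · simpa using Set.range_nonempty Xhat
  · have := h.2
    rw [hfin.encard_eq_coe_toFinset_card] at this
    exact_mod_cast this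

theorem distortion_le_lintegral (hr : 0 < r) (hX : Measurable X) {Xhat : Ω → ℝ} {α : Finset ℝ}
    (hα : ∀ ω, Xhat ω ∈ α) :
    distortion r (P.map X) α ≤ ∫⁻ ω, ‖X ω - Xhat ω‖ₑ ^ r ∂P := by
  rw [← lintegral_infEDist_comp hX]
  refine lintegral_mono fun ω => ?_
  rw [← edist_eq_enorm_sub]
  gcongr
  exact Metric.infEDist_le_edist_of_mem (hα ω)

theorem minError_le_distortion (hX : Measurable X) {α : Finset ℝ}
    (hα : α.Nonempty) (hN : α.card ≤ N) :
    ∃ Xhat, IsQuantization N Xhat ∧ lrError r P X Xhat = distortion r (P.map X) α ^ (1 / r) := by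
  obtain ⟨p, hpm, hp⟩ := exists_measurable_nearest hα
  refine ⟨fun ω => p (X ω), ⟨hpm.comp hX, ?_⟩, ?_⟩
  · have : Set.range (fun ω => p (X ω)) ⊆ (α : Set ℝ) := by
      rintro _ ⟨ω, rfl⟩; exact (hp _).1
    refine (Set.encard_le_encard this).trans ?_
    rw [Set.encard_coe_eq_coe_finsetCard]
    exact_mod_cast hN
  · rw [lrError, ← lintegral_infEDist_comp hX]
    congr 1
    refine lintegral_congr fun ω => ?_
    rw [← edist_eq_enorm_sub, (hp _).2]

theorem exists_isOptimalQuantization [IsProbabilityMeasure P] (hr : 0 < r) (hX : Measurable X)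
    (hN : 1 ≤ N) :
    ∃ Xhat, IsOptimalQuantization r P N X Xhat := by
  have := nonempty_of_isProbabilityMeasure P
  have := Measure.isProbabilityMeasure_map (μ := P) hX.aemeasurable
  obtain ⟨α, hα⟩ := exists_isOptimalCodebook hr (P.map X) hN
  obtain ⟨Xhat, hq, he⟩ := minError_le_distortion (P := P) (r := r) hX hα.nonempty hα.card_le
  refine ⟨Xhat, hq, le_antisymm ?_ (sInf_le ⟨Xhat, hq, rfl⟩)⟩
  refine le_sInf ?_
  rintro _ ⟨Y, hY, rfl⟩
  obtain ⟨β, hβ, hβN, hYβ⟩ := hY.exists_codebook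
  rw [he, lrError]
  gcongr
  exact (hα.le β hβ hβN).trans (distortion_le_lintegral hr hX hYβ)

/-- An optimal quantization is almost surely a nearest-neighbour projection on an optimal
codebook. -/
theorem IsOptimalQuantization.exists_optimalCodebook [IsProbabilityMeasure P] (hr : 0 < r)
    (hX : Measurable X) {Xhat : Ω → ℝ} (h : IsOptimalQuantization r P N X Xhat)
    (hfin : distortion r (P.map X) {0} ≠ ⊤) :
    ∃ α, IsOptimalCodebook r (P.map X) N α ∧
      ∀ᵐ ω ∂P, ‖X ω - Xhat ω‖ₑ = Metric.infEDist (X ω) (α : Set ℝ) := by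
  have := nonempty_of_isProbabilityMeasure P
  obtain ⟨α, hα, hαN, hmem⟩ := h.1.exists_codebook
  have h1 := distortion_le_lintegral (P := P) hr hX hmem
  have h2 : ∀ β : Finset ℝ, β.Nonempty → β.card ≤ N →
      ∫⁻ ω, ‖X ω - Xhat ω‖ₑ ^ r ∂P ≤ distortion r (P.map X) β := fun β hβ hβN => by
    obtain ⟨Y, hY, he⟩ := minError_le_distortion (P := P) (r := r) hX hβ hβN
    have h3 : lrError r P X Xhat ≤ lrError r P X Y := by
      rw [h.2]; exact sInf_le ⟨Y, hY, rfl⟩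
    rw [he, lrError] at h3
    exact (ENNReal.rpow_le_rpow_iff (by positivity)).1 h3
  refine ⟨α, ⟨hα, hαN, fun β hβ hβN => h1.trans (h2 β hβ hβN)⟩, ?_⟩
  have h4 : ∫⁻ ω, ‖X ω - Xhat ω‖ₑ ^ r ∂P ≤ ∫⁻ ω, Metric.infEDist (X ω) (α : Set ℝ) ^ r ∂P := by
    rw [lintegral_infEDist_comp hX]; exact h2 α hα hαN
  have h5 : ∫⁻ ω, Metric.infEDist (X ω) (α : Set ℝ) ^ r ∂P ≠ ⊤ := by
    rw [lintegral_infEDist_comp hX]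
    refine ne_top_of_le_ne_top hfin (h1.trans (h2 {0} (by simp) ?_))
    rw [Finset.card_singleton]
    exact hα.card_pos.trans_le hαN
  have h6 : ∀ᵐ ω ∂P, Metric.infEDist (X ω) (α : Set ℝ) ^ r = ‖X ω - Xhat ω‖ₑ ^ r := by
    refine ae_eq_of_ae_le_of_lintegral_le (Eventually.of_forall fun ω => ?_) h5
      ((hX.sub h.1.1).enorm.pow_const r).aemeasurable h4
    dsimp only
    rw [← edist_eq_enorm_sub]
    gcongr
    exact Metric.infEDist_le_edist_of_mem (hmem ω)
  filter_upwards [h6] with ω hω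
  exact (ENNReal.rpow_left_injective hr.ne' hω).symm

end OptimalQuantizers

/-! ### Estimates for the normal law and removal of a point of a codebook -/

section GaussianEstimates

theorem gaussianPDFReal_std (x : ℝ) :
    gaussianPDFReal 0 1 x = (√(2 * Real.pi))⁻¹ * Real.exp (-x ^ 2 / 2) := by
  simp [gaussianPDFReal]

theorem inv_sqrt_two_pi_le_one : (√(2 * Real.pi))⁻¹ ≤ 1 := by
  apply inv_le_one_of_one_le₀
  rw [Real.one_le_sqrt]
  linarith [Real.pi_gt_three]

theorem lintegral_gaussian_std (f : ℝ → ℝ≥0∞) (hf : Measurable f) :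
    ∫⁻ x, f x ∂gaussianReal 0 1 = ∫⁻ x, gaussianPDF 0 1 x * f x := by
  rw [gaussianReal_of_var_ne_zero _ one_ne_zero,
    lintegral_withDensity_eq_lintegral_mul _ (measurable_gaussianPDF 0 1) hf]
  rfl

theorem lintegral_gaussian_neg (f : ℝ → ℝ≥0∞) (hf : Measurable f) :
    ∫⁻ x, f (-x) ∂gaussianReal 0 1 = ∫⁻ x, f x ∂gaussianReal 0 1 := by
  have h := gaussianReal_map_neg (μ := 0) (v := 1)
  rw [neg_zero] at h
  conv_rhs => rw [← h]
  rw [lintegral_map hf measurable_neg]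

theorem lintegral_gaussian_exp_lt_top {A s τ : ℝ} (hA : 0 ≤ A) (hs : 0 ≤ s) (hτ : τ < 1) :
    ∫⁻ x, ENNReal.ofReal ((A + |x|) ^ s * Real.exp (τ * (x ^ 2 / 2))) ∂gaussianReal 0 1 < ⊤ := by
  rw [lintegral_gaussian_std _ (by fun_prop)]
  set ε : ℝ := (1 - τ) / 2 with hε
  have hε0 : 0 < ε := by rw [hε]; linarith
  set C : ℝ := Real.exp (s * A + s ^ 2 / (2 * ε)) with hC
  have hint : Integrable (fun x : ℝ => C * Real.exp (-(ε / 2) * x ^ 2)) :=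
    (integrable_exp_neg_mul_sq (by positivity)).const_mul C
  refine lt_of_le_of_lt (lintegral_mono fun x => ?_) hint.lintegral_lt_top
  rw [gaussianPDF, ← ENNReal.ofReal_mul (gaussianPDFReal_nonneg _ _ _), gaussianPDFReal_std]
  apply ENNReal.ofReal_le_ofReal
  have h1 : (A + |x|) ^ s ≤ Real.exp (s * (A + |x|)) := by
    rw [mul_comm, Real.exp_mul]
    have := Real.add_one_le_exp (A + |x|)
    gcongr
    linarith
  have h2 : s * |x| ≤ s ^ 2 / (2 * ε) + ε * (x ^ 2 / 2) := by
    have h3 : 0 ≤ (s - ε * |x|) ^ 2 / (2 * ε) := by positivity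
    have h4 : (s - ε * |x|) ^ 2 / (2 * ε) = s ^ 2 / (2 * ε) + ε * (|x| ^ 2 / 2) - s * |x| := by
      field_simp; ring
    rw [sq_abs] at h4
    linarith
  calc (√(2 * Real.pi))⁻¹ * Real.exp (-x ^ 2 / 2) *
        ((A + |x|) ^ s * Real.exp (τ * (x ^ 2 / 2)))
      ≤ 1 * Real.exp (-x ^ 2 / 2) *
        (Real.exp (s * (A + |x|)) * Real.exp (τ * (x ^ 2 / 2))) := by
        gcongr
        exact inv_sqrt_two_pi_le_one
    _ = Real.exp (-x ^ 2 / 2 + (s * (A + |x|) + τ * (x ^ 2 / 2))) := by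
        rw [Real.exp_add, Real.exp_add, one_mul]
    _ ≤ Real.exp (s * A + s ^ 2 / (2 * ε) + -(ε / 2) * x ^ 2) := by
        apply Real.exp_le_exp.2
        have : τ = 1 - 2 * ε := by rw [hε]; ring
        rw [this]
        linarith
    _ = _ := by rw [Real.exp_add]

theorem distortion_gaussian_ne_top {r : ℝ} (hr : 0 < r) {α : Finset ℝ} (hα : α.Nonempty) :
    distortion r (gaussianReal 0 1) α ≠ ⊤ := by
  obtain ⟨b, hb⟩ := hα
  refine ne_top_of_le_ne_top (lintegral_gaussian_exp_lt_top (A := |b|) (s := r) (τ := 0)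
    (abs_nonneg b) hr.le (by norm_num)).ne (lintegral_mono fun x => ?_)
  rw [zero_mul, Real.exp_zero, mul_one, ← ENNReal.ofReal_rpow_of_nonneg (by positivity) hr.le]
  gcongr
  refine (Metric.infEDist_le_edist_of_mem (Finset.mem_coe.2 hb)).trans ?_
  rw [edist_dist, Real.dist_eq]
  apply ENNReal.ofReal_le_ofReal
  have := abs_sub x b
  linarith

/-- The mass of an interval of length `δ / 4` next to `y`, on the side of `y` that faces the
origin. -/
theorem exists_gaussian_nbhd : ∃ c : ℝ, 0 < c ∧ ∀ y δ : ℝ, 0 ≤ δ → δ ≤ 1 →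
    ∃ J : Set ℝ, MeasurableSet J ∧ (∀ x ∈ J, |x - y| ≤ δ / 4) ∧
      ENNReal.ofReal (c * δ * Real.exp (-(y ^ 2 / 2))) ≤ gaussianReal 0 1 J := by
  refine ⟨(√(2 * Real.pi))⁻¹ * Real.exp (-(1 / 32)) / 4, by positivity, fun y δ h0 h1 => ?_⟩
  have key : ∀ u v : ℝ, v - u = δ / 4 → (∀ x ∈ Set.Icc u v, x ^ 2 ≤ y ^ 2 + 1 / 16) →
      ENNReal.ofReal ((√(2 * Real.pi))⁻¹ * Real.exp (-(1 / 32)) / 4 * δ *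
        Real.exp (-(y ^ 2 / 2))) ≤ gaussianReal 0 1 (Set.Icc u v) := fun u v huv hx => by
    rw [gaussianReal_apply _ one_ne_zero]
    calc _ = ∫⁻ _x in Set.Icc u v, ENNReal.ofReal ((√(2 * Real.pi))⁻¹ * Real.exp (-(1 / 32)) *
          Real.exp (-(y ^ 2 / 2))) := by
          rw [setLIntegral_const, Real.volume_Icc, huv, ← ENNReal.ofReal_mul (by positivity)]
          congr 1; ring
      _ ≤ _ := by
          refine setLIntegral_mono' measurableSet_Icc fun x hxJ => ?_
          rw [gaussianPDF, gaussianPDFReal_std]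
          apply ENNReal.ofReal_le_ofReal
          rw [mul_assoc, ← Real.exp_add]
          gcongr
          have := hx x hxJ
          linarith
  rcases le_total 0 y with hy | hy
  · refine ⟨Set.Icc (y - δ / 4) y, measurableSet_Icc, fun x hx => ?_, key _ _ (by ring) ?_⟩
    · rw [abs_le]; constructor <;> linarith [hx.1, hx.2]
    · intro x hx
      rcases le_total 0 x with hx0 | hx0
      · nlinarith [hx.2]
      · nlinarith [hx.1]
  · refine ⟨Set.Icc y (y + δ / 4), measurableSet_Icc, fun x hx => ?_, key _ _ (by ring) ?_⟩
    · rw [abs_le]; constructor <;> linarith [hx.1, hx.2]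
    · intro x hx
      rcases le_total 0 x with hx0 | hx0
      · nlinarith [hx.2]
      · nlinarith [hx.1]

/-- The cost of moving the mass of an interval `[p, q]` to its left end point, in terms of the
increment of `exp (-x)` over the interval. -/
theorem setLIntegral_rpow_sub_le {r : ℝ} (hr : 0 < r) {p q : ℝ} (hpq : p ≤ q) :
    ∫⁻ x in Set.Icc p q, ENNReal.ofReal ((x - p) ^ r) ∂gaussianReal 0 1 ≤
      ENNReal.ofReal (Real.exp ((r + 1) ^ 2 / 2) *
        (Real.exp (-p) - Real.exp (-q)) ^ (r + 1)) := by
  set Δ : ℝ := Real.exp (-p) - Real.exp (-q) with hΔ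
  have hΔ0 : 0 ≤ Δ := by
    have : Real.exp (-q) ≤ Real.exp (-p) := Real.exp_le_exp.2 (by linarith)
    linarith
  rw [← lintegral_indicator measurableSet_Icc, lintegral_gaussian_std _
    (Measurable.indicator (by fun_prop) measurableSet_Icc)]
  set C : ℝ := Real.exp ((r + 1) ^ 2 / 2) with hC
  have hpt : ∀ x, gaussianPDF 0 1 x *
      (Set.Icc p q).indicator (fun x => ENNReal.ofReal ((x - p) ^ r)) x ≤
      (Set.Icc p q).indicator (fun x => ENNReal.ofReal (C * Δ ^ r * Real.exp (-x))) x := by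
    intro x
    by_cases hx : x ∈ Set.Icc p q
    · rw [Set.indicator_of_mem hx, Set.indicator_of_mem hx, gaussianPDF,
        ← ENNReal.ofReal_mul (gaussianPDFReal_nonneg _ _ _), gaussianPDFReal_std]
      apply ENNReal.ofReal_le_ofReal
      have hxp : 0 ≤ x - p := by linarith [hx.1]
      have h1 : (x - p) * Real.exp (-x) ≤ Δ := by
        have h2 : Real.exp (-p) = Real.exp (x - p) * Real.exp (-x) := by
          rw [← Real.exp_add]; ring_nf
        have h3 := Real.add_one_le_exp (x - p)
        have h4 : Real.exp (-q) ≤ Real.exp (-x) := Real.exp_le_exp.2 (by linarith [hx.2])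
        rw [hΔ, h2]
        nlinarith [Real.exp_pos (-x)]
      have h5 : Real.exp (-x ^ 2 / 2) ≤ C * (Real.exp (-x) ^ r * Real.exp (-x)) := by
        rw [hC, ← Real.exp_mul, ← Real.exp_add, ← Real.exp_add]
        apply Real.exp_le_exp.2
        nlinarith [sq_nonneg (x - (r + 1))]
      calc (√(2 * Real.pi))⁻¹ * Real.exp (-x ^ 2 / 2) * (x - p) ^ r
          ≤ 1 * (C * (Real.exp (-x) ^ r * Real.exp (-x))) * (x - p) ^ r := by
            gcongr
            exact inv_sqrt_two_pi_le_one
        _ = C * ((x - p) * Real.exp (-x)) ^ r * Real.exp (-x) := by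
            rw [Real.mul_rpow hxp (Real.exp_pos _).le]; ring
        _ ≤ _ := by
            have := Real.exp_pos (-x)
            gcongr
    · simp [Set.indicator_of_notMem hx]
  refine (lintegral_mono hpt).trans ?_
  rw [lintegral_indicator measurableSet_Icc]
  have hcont : Continuous fun x : ℝ => C * Δ ^ r * Real.exp (-x) := by fun_prop
  rw [← ofReal_integral_eq_lintegral_ofReal (hcont.continuousOn.integrableOn_Icc)
    (Eventually.of_forall fun x => by positivity), integral_Icc_eq_integral_Ioc,
    ← intervalIntegral.integral_of_le hpq]
  apply ENNReal.ofReal_le_ofReal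
  rw [intervalIntegral.integral_const_mul, intervalIntegral.integral_comp_neg
    (f := fun x => Real.exp x), integral_exp, ← hΔ, Real.rpow_add_one' hΔ0 (by linarith)]
  linarith

end GaussianEstimates

section Exchange

/-- The distribution function of the symmetric exponential law, rescaled to `(-1, 1)`. -/
noncomputable def laplaceScale (x : ℝ) : ℝ := if 0 ≤ x then 1 - Real.exp (-x) else Real.exp x - 1

theorem laplaceScale_lt_one (x : ℝ) : laplaceScale x < 1 := by
  unfold laplaceScale
  split_ifs with h
  · linarith [Real.exp_pos (-x)]
  · have : Real.exp x < 1 := Real.exp_lt_one_iff.2 (not_le.1 h)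
    linarith

theorem neg_one_lt_laplaceScale (x : ℝ) : -1 < laplaceScale x := by
  unfold laplaceScale
  split_ifs with h
  · have : Real.exp (-x) ≤ 1 := Real.exp_le_one_iff.2 (by linarith)
    linarith
  · linarith [Real.exp_pos x]

theorem laplaceScale_nonneg_iff (x : ℝ) : 0 ≤ laplaceScale x ↔ 0 ≤ x := by
  unfold laplaceScale
  split_ifs with h
  · have : Real.exp (-x) ≤ 1 := Real.exp_le_one_iff.2 (by linarith)
    simp only [h, iff_true]
    linarith
  · have : Real.exp x < 1 := Real.exp_lt_one_iff.2 (not_le.1 h)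
    simp only [h, iff_false]
    linarith

/-- Among more than `4 K` points, three lie in a common cell of the partition of the line into
`2 K` cells of equal Laplace mass; no cell contains points of different signs. -/
theorem exists_three_close {K : ℕ} (hK : 1 ≤ K) {α : Finset ℝ} (hα : 4 * K < α.card) :
    ∃ p ∈ α, ∃ q ∈ α, ∃ t ∈ α, p < q ∧ q < t ∧ (0 ≤ p ↔ 0 ≤ t) ∧
      |laplaceScale t - laplaceScale p| ≤ 1 / K := by
  have hK0 : (0 : ℝ) < K := by exact_mod_cast hK
  let key : ℝ → ℤ := fun x => ⌊K * laplaceScale x⌋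
  have hmaps : ∀ x ∈ α, key x ∈ Finset.Ico (-(K : ℤ)) K := fun x _ => by
    rw [Finset.mem_Ico]
    constructor
    · apply Int.le_floor.2
      push_cast
      nlinarith [neg_one_lt_laplaceScale x]
    · apply Int.floor_lt.2
      push_cast
      nlinarith [laplaceScale_lt_one x]
  have hcard : (Finset.Ico (-(K : ℤ)) K).card * 2 < α.card := by
    rw [Int.card_Ico]; omega
  obtain ⟨i, -, hi⟩ := Finset.exists_lt_card_fiber_of_mul_lt_card_of_maps_to hmaps hcard
  set F : Finset ℝ := α.filter fun x => key x = i with hF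
  have hFne : F.Nonempty := Finset.card_pos.1 (by omega)
  have hp := F.min'_mem hFne
  have ht := F.max'_mem hFne
  have hq' : ((F.erase (F.min' hFne)).erase (F.max' hFne)).Nonempty := by
    apply Finset.card_pos.1
    have h1 := Finset.pred_card_le_card_erase (s := F) (a := F.min' hFne)
    have h2 := Finset.pred_card_le_card_erase (s := F.erase (F.min' hFne)) (a := F.max' hFne)
    omega
  obtain ⟨q, hq⟩ := hq'
  simp only [Finset.mem_erase] at hq
  obtain ⟨hqt, hqp, hqF⟩ := hq
  have hpq : F.min' hFne < q := lt_of_le_of_ne (F.min'_le q hqF) (Ne.symm hqp)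
  have hqt' : q < F.max' hFne := lt_of_le_of_ne (F.le_max' q hqF) hqt
  generalize F.min' hFne = p at *
  generalize F.max' hFne = t at *
  rw [hF, Finset.mem_filter] at hp ht hqF
  have hkey : key t = key p := ht.2.trans hp.2.symm
  refine ⟨p, hp.1, q, hqF.1, t, ht.1, hpq, hqt', ?_, ?_⟩
  · rw [← laplaceScale_nonneg_iff, ← laplaceScale_nonneg_iff t]
    have h1 : ∀ x, 0 ≤ laplaceScale x ↔ 0 ≤ key x := fun x => by
      rw [Int.floor_nonneg, mul_nonneg_iff_of_pos_left hK0]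
    rw [h1, h1, hkey]
  · have h1 := Int.abs_sub_lt_one_of_floor_eq_floor hkey
    rw [← mul_sub, abs_mul, abs_of_pos hK0] at h1
    rw [le_div_iff₀ hK0, mul_comm]
    exact h1.le

/-- Some point of a codebook with more than `4 K` points can be removed at a cost of order
`K ^ (-(r + 1))`: the middle one of three close points, whose cell lies between its two
neighbours. -/
theorem exists_erase_cost {r : ℝ} (hr : 0 < r) {K : ℕ} (hK : 1 ≤ K) {α : Finset ℝ}
    (hα : 4 * K < α.card) :
    ∃ q ∈ α, ∃ h : ℝ → ℝ≥0∞, Measurable h ∧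
      (∀ x, Metric.infEDist x ((α.erase q : Finset ℝ) : Set ℝ) ^ r ≤
        Metric.infEDist x (α : Set ℝ) ^ r + h x) ∧
      ∫⁻ x, h x ∂gaussianReal 0 1 ≤
        ENNReal.ofReal (Real.exp ((r + 1) ^ 2 / 2) * (1 / K) ^ (r + 1)) := by
  obtain ⟨p, hp, q, hq, t, ht, hpq, hqt, hsign, hclose⟩ := exists_three_close hK hα
  have hpe : p ∈ α.erase q := Finset.mem_erase.2 ⟨hpq.ne, hp⟩
  have hte : t ∈ α.erase q := Finset.mem_erase.2 ⟨hqt.ne', ht⟩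
  have hout : ∀ x, x ∉ Set.Icc p t → Metric.infEDist x ((α.erase q : Finset ℝ) : Set ℝ) ≤
      Metric.infEDist x (α : Set ℝ) := fun x hx => by
    refine le_iInf₂ fun y hy => ?_
    by_cases hyq : y = q
    · subst hyq
      rcases lt_or_ge x p with hxp | hxp
      · refine (Metric.infEDist_le_edist_of_mem (Finset.mem_coe.2 hpe)).trans ?_
        rw [edist_dist, edist_dist, Real.dist_eq, Real.dist_eq, abs_of_neg (by linarith),
          abs_of_neg (by linarith)]
        exact ENNReal.ofReal_le_ofReal (by linarith)
      · have hxt : t < x := by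
          by_contra h
          exact hx ⟨hxp, not_lt.1 h⟩
        refine (Metric.infEDist_le_edist_of_mem (Finset.mem_coe.2 hte)).trans ?_
        rw [edist_dist, edist_dist, Real.dist_eq, Real.dist_eq, abs_of_pos (by linarith),
          abs_of_pos (by linarith)]
        exact ENNReal.ofReal_le_ofReal (by linarith)
    · exact Metric.infEDist_le_edist_of_mem
        (Finset.mem_coe.2 (Finset.mem_erase.2 ⟨hyq, Finset.mem_coe.1 hy⟩))
  have hcost : ∀ z ∈ α.erase q, ∀ x, Metric.infEDist x ((α.erase q : Finset ℝ) : Set ℝ) ^ r ≤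
      Metric.infEDist x (α : Set ℝ) ^ r +
        (Set.Icc p t).indicator (fun x => ENNReal.ofReal (|x - z| ^ r)) x := fun z hz x => by
    by_cases hx : x ∈ Set.Icc p t
    · rw [Set.indicator_of_mem hx]
      refine le_add_left ?_
      rw [← ENNReal.ofReal_rpow_of_nonneg (abs_nonneg _) hr.le]
      gcongr
      refine (Metric.infEDist_le_edist_of_mem (Finset.mem_coe.2 hz)).trans ?_
      rw [edist_dist, Real.dist_eq]
    · rw [Set.indicator_of_notMem hx, add_zero]
      have := hout x hx
      gcongr
  have hmeas : ∀ z, Measurable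
      ((Set.Icc p t).indicator (fun x => ENNReal.ofReal (|x - z| ^ r))) := fun z =>
    Measurable.indicator (by fun_prop) measurableSet_Icc
  rcases le_or_gt 0 p with hp0 | hp0
  · have ht0 := hsign.1 hp0
    refine ⟨q, hq, _, hmeas p, hcost p hpe, ?_⟩
    rw [lintegral_indicator measurableSet_Icc]
    have h1 : ∫⁻ x in Set.Icc p t, ENNReal.ofReal (|x - p| ^ r) ∂gaussianReal 0 1 =
        ∫⁻ x in Set.Icc p t, ENNReal.ofReal ((x - p) ^ r) ∂gaussianReal 0 1 :=
      setLIntegral_congr_fun measurableSet_Icc fun x hx => by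
        rw [abs_of_nonneg (by linarith [hx.1])]
    rw [h1]
    refine (setLIntegral_rpow_sub_le hr (hpq.trans hqt).le).trans
      (ENNReal.ofReal_le_ofReal ?_)
    have hle : Real.exp (-t) ≤ Real.exp (-p) := Real.exp_le_exp.2 (by linarith)
    have h2 : Real.exp (-p) - Real.exp (-t) ≤ 1 / K := by
      have := le_abs_self (laplaceScale t - laplaceScale p)
      simp only [laplaceScale, if_pos hp0, if_pos ht0] at this hclose
      linarith
    have h3 : 0 ≤ Real.exp (-p) - Real.exp (-t) := by linarith
    gcongr
  · have ht0 : ¬ 0 ≤ t := fun h => absurd (hsign.2 h) (not_le.2 hp0)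
    refine ⟨q, hq, _, hmeas t, hcost t hte, ?_⟩
    -- The negative half-line is treated by reflection.
    rw [← lintegral_gaussian_neg _ (hmeas t)]
    have h0 : ∀ x, (Set.Icc p t).indicator (fun x => ENNReal.ofReal (|x - t| ^ r)) (-x) =
        (Set.Icc (-t) (-p)).indicator (fun x => ENNReal.ofReal ((x - -t) ^ r)) x := fun x => by
      by_cases hx : x ∈ Set.Icc (-t) (-p)
      · have hx' : -x ∈ Set.Icc p t := ⟨by linarith [hx.2], by linarith [hx.1]⟩
        rw [Set.indicator_of_mem hx, Set.indicator_of_mem hx', ← abs_neg,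
          abs_of_nonneg (by linarith [hx.1])]
        congr 2
        ring
      · have hx' : -x ∉ Set.Icc p t := fun h => hx ⟨by linarith [h.2], by linarith [h.1]⟩
        rw [Set.indicator_of_notMem hx, Set.indicator_of_notMem hx']
    rw [lintegral_congr h0, lintegral_indicator measurableSet_Icc]
    rw [not_le] at ht0
    refine (setLIntegral_rpow_sub_le hr (by linarith)).trans
      (ENNReal.ofReal_le_ofReal ?_)
    rw [neg_neg, neg_neg]
    have hle : Real.exp p ≤ Real.exp t := Real.exp_le_exp.2 (by linarith)
    have h2 : Real.exp t - Real.exp p ≤ 1 / K := by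
      have := le_abs_self (laplaceScale t - laplaceScale p)
      simp only [laplaceScale, if_neg (not_le.2 hp0), if_neg (not_le.2 ht0)] at this hclose
      linarith
    have h3 : 0 ≤ Real.exp t - Real.exp p := by linarith
    gcongr

end Exchange

/-! ### Distortion mismatch for optimal quantizers of the normal law -/

section Mismatch

/-- Local bound on the mesh of an optimal codebook for the normal law. Exchanging a point that is
cheap to remove for a new point at `y` cannot decrease the distortion; the gain at `y` is of order
`δ ^ (r + 1) * exp (-y ^ 2 / 2)` with `δ = min (dist y α) 1`. -/
theorem exists_infDist_le {r : ℝ} (hr : 0 < r) : ∃ C : ℝ, 0 < C ∧ ∀ (N : ℕ) (α : Finset ℝ),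
    1 ≤ N → IsOptimalCodebook r (gaussianReal 0 1) N α → ∀ y : ℝ,
      min (Metric.infDist y (α : Set ℝ)) 1 ≤ C / N * Real.exp (y ^ 2 / 2 / (r + 1)) := by
  obtain ⟨c, hc, hnbhd⟩ := exists_gaussian_nbhd
  set g : ℝ := (3 / 4) ^ r - (1 / 4) ^ r with hg
  have hg0 : 0 < g := by
    have : (1 / 4 : ℝ) ^ r < (3 / 4) ^ r := Real.rpow_lt_rpow (by norm_num) (by norm_num) hr
    linarith
  set E : ℝ := Real.exp ((r + 1) ^ 2 / 2) with hE
  set B : ℝ := E * 8 ^ (r + 1) / (g * c) with hB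
  have hB0 : 0 < B := by positivity
  refine ⟨max 5 (B ^ (1 / (r + 1))), by positivity, fun N α hN hα y => ?_⟩
  have hN0 : (0 : ℝ) < N := by exact_mod_cast hN
  rcases lt_or_ge N 5 with hN5 | hN5
  · refine (min_le_right _ _).trans ?_
    have h1 : (1 : ℝ) ≤ max 5 (B ^ (1 / (r + 1))) / N := by
      rw [one_le_div hN0]
      have : (N : ℝ) ≤ 5 := by exact_mod_cast hN5.le
      exact this.trans (le_max_left _ _)
    have h2 : 1 ≤ Real.exp (y ^ 2 / 2 / (r + 1)) := Real.one_le_exp (by positivity)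
    nlinarith
  -- A codebook with fewer than `N` points that is almost as good as `α`.
  obtain ⟨α', hα'N, h, hhm, hh, hhint⟩ : ∃ α' : Finset ℝ, α'.card < N ∧ ∃ h : ℝ → ℝ≥0∞,
      Measurable h ∧ (∀ x, Metric.infEDist x (α' : Set ℝ) ^ r ≤
        Metric.infEDist x (α : Set ℝ) ^ r + h x) ∧
      ∫⁻ x, h x ∂gaussianReal 0 1 ≤ ENNReal.ofReal (E * (8 / N) ^ (r + 1)) := by
    rcases lt_or_ge (4 * ((N - 1) / 4)) α.card with hcard | hcard
    · obtain ⟨q, hq, h, hhm, hh, hhint⟩ := exists_erase_cost hr (K := (N - 1) / 4) (by omega) hcard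
      refine ⟨α.erase q, ?_, h, hhm, hh, hhint.trans (ENNReal.ofReal_le_ofReal ?_)⟩
      · rw [Finset.card_erase_of_mem hq]
        have := hα.card_le
        omega
      · have hK : 1 ≤ (N - 1) / 4 := by omega
        have hK0 : (0 : ℝ) < ((N - 1) / 4 : ℕ) := by exact_mod_cast hK
        have hle : (1 : ℝ) / ((N - 1) / 4 : ℕ) ≤ 8 / N := by
          rw [div_le_div_iff₀ hK0 hN0, one_mul]
          have : N ≤ 8 * ((N - 1) / 4) := by omega
          exact_mod_cast this
        exact mul_le_mul_of_nonneg_left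
          (Real.rpow_le_rpow (by positivity) hle (by positivity)) (Real.exp_pos _).le
    · exact ⟨α, by omega, 0, measurable_zero, by simp, by simp⟩
  set D : ℝ := Metric.infDist y (α : Set ℝ) with hD
  set δ : ℝ := min D 1 with hδ
  have hδ0 : 0 ≤ δ := le_min Metric.infDist_nonneg zero_le_one
  have hδ1 : δ ≤ 1 := min_le_right _ _
  have hδD : ENNReal.ofReal δ ≤ Metric.infEDist y (α : Set ℝ) := by
    rw [← ENNReal.ofReal_toReal (Metric.infEDist_ne_top (Finset.coe_nonempty.2 hα.nonempty))]
    exact ENNReal.ofReal_le_ofReal (min_le_left _ _)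
  obtain ⟨J, hJm, hJ, hJμ⟩ := hnbhd y δ hδ0 hδ1
  have hβne : (insert y α').Nonempty := Finset.insert_nonempty _ _
  have hopt := hα.le (insert y α') hβne
    ((Finset.card_insert_le _ _).trans (by omega))
  have hpt : ∀ x, Metric.infEDist x ((insert y α' : Finset ℝ) : Set ℝ) ^ r +
      J.indicator (fun _ => ENNReal.ofReal (g * δ ^ r)) x ≤
      Metric.infEDist x (α : Set ℝ) ^ r + h x := fun x => by
    by_cases hx : x ∈ J
    · rw [Set.indicator_of_mem hx]
      refine le_add_right ?_
      have hxy : edist x y ≤ ENNReal.ofReal (δ / 4) := by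
        rw [edist_dist, Real.dist_eq]
        exact ENNReal.ofReal_le_ofReal (hJ x hx)
      have h1 : Metric.infEDist x ((insert y α' : Finset ℝ) : Set ℝ) ≤
          ENNReal.ofReal (δ / 4) :=
        (Metric.infEDist_le_edist_of_mem (by simp)).trans hxy
      have h2 : ENNReal.ofReal (3 / 4 * δ) ≤ Metric.infEDist x (α : Set ℝ) := by
        have h3 : ENNReal.ofReal δ ≤ ENNReal.ofReal (δ / 4) + Metric.infEDist x (α : Set ℝ) := by
          refine hδD.trans ((Metric.infEDist_le_edist_add_infEDist (y := x)).trans ?_)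
          rw [edist_comm]
          gcongr
        have h4 : 3 / 4 * δ = δ - δ / 4 := by ring
        rw [h4, ENNReal.ofReal_sub _ (by positivity)]
        exact tsub_le_iff_left.2 h3
      calc _ ≤ ENNReal.ofReal (δ / 4) ^ r + ENNReal.ofReal (g * δ ^ r) := by gcongr
        _ = ENNReal.ofReal (3 / 4 * δ) ^ r := by
            rw [ENNReal.ofReal_rpow_of_nonneg (by positivity) hr.le,
              ENNReal.ofReal_rpow_of_nonneg (by positivity) hr.le,
              ← ENNReal.ofReal_add (by positivity) (by positivity)]
            congr 1
            rw [div_eq_inv_mul, Real.mul_rpow (by norm_num) hδ0,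
              Real.mul_rpow (by norm_num) hδ0, hg, ← one_div]
            ring
        _ ≤ _ := by gcongr
    · rw [Set.indicator_of_notMem hx, add_zero]
      refine le_trans (ENNReal.rpow_le_rpow (Metric.infEDist_anti ?_) hr.le) (hh x)
      rw [Finset.coe_insert]
      exact Set.subset_insert _ _
  have hint : distortion r (gaussianReal 0 1) (insert y α') +
      ENNReal.ofReal (g * δ ^ r) * gaussianReal 0 1 J ≤
      distortion r (gaussianReal 0 1) (insert y α') +
        ENNReal.ofReal (E * (8 / N) ^ (r + 1)) := by
    calc _ = ∫⁻ x, Metric.infEDist x ((insert y α' : Finset ℝ) : Set ℝ) ^ r +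
          J.indicator (fun _ => ENNReal.ofReal (g * δ ^ r)) x ∂gaussianReal 0 1 := by
          rw [lintegral_add_left (by fun_prop), lintegral_indicator_const hJm]
          rfl
      _ ≤ ∫⁻ x, Metric.infEDist x (α : Set ℝ) ^ r + h x ∂gaussianReal 0 1 := lintegral_mono hpt
      _ = distortion r (gaussianReal 0 1) α + ∫⁻ x, h x ∂gaussianReal 0 1 := by
          rw [lintegral_add_right _ hhm]
          rfl
      _ ≤ _ := by gcongr
  have hgain : g * δ ^ r * (c * δ * Real.exp (-(y ^ 2 / 2))) ≤ E * (8 / N) ^ (r + 1) := by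
    have h1 := (ENNReal.add_le_add_iff_left (distortion_gaussian_ne_top hr hβne)).1 hint
    have h2 : ENNReal.ofReal (g * δ ^ r * (c * δ * Real.exp (-(y ^ 2 / 2)))) ≤
        ENNReal.ofReal (E * (8 / N) ^ (r + 1)) := by
      rw [ENNReal.ofReal_mul (by positivity)]
      refine le_trans ?_ h1
      gcongr
    exact (ENNReal.ofReal_le_ofReal_iff (by positivity)).1 h2
  have hpow : δ ^ (r + 1) ≤ (B ^ (1 / (r + 1)) / N * Real.exp (y ^ 2 / 2 / (r + 1))) ^ (r + 1) := by
    have hr1 : 0 < r + 1 := by linarith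
    rw [Real.mul_rpow (by positivity) (by positivity), Real.div_rpow (by positivity) hN0.le,
      ← Real.rpow_mul hB0.le, one_div, inv_mul_cancel₀ hr1.ne', Real.rpow_one, ← Real.exp_mul,
      div_mul_cancel₀ _ hr1.ne']
    rw [Real.div_rpow (by norm_num) hN0.le, Real.exp_neg] at hgain
    rw [Real.rpow_add_one' hδ0 hr1.ne', hB]
    have hexp := Real.exp_pos (y ^ 2 / 2)
    have hNr : 0 < (N : ℝ) ^ (r + 1) := by positivity
    have h3 : g * δ ^ r * (c * δ * (Real.exp (y ^ 2 / 2))⁻¹) =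
        (δ ^ r * δ) * (g * c / Real.exp (y ^ 2 / 2)) := by
      field_simp
    rw [h3, ← le_div_iff₀ (by positivity)] at hgain
    refine hgain.trans (le_of_eq ?_)
    field_simp
  have hle := (Real.rpow_le_rpow_iff hδ0 (by positivity) (by linarith)).1 hpow
  refine hle.trans ?_
  gcongr
  exact le_max_right _ _

/-- Optimal codebooks for the normal law, of whatever size, have a point near the origin. -/
theorem exists_infDist_zero_le {r : ℝ} (hr : 0 < r) : ∃ R : ℝ, 0 ≤ R ∧ ∀ (N : ℕ) (α : Finset ℝ),
    1 ≤ N → IsOptimalCodebook r (gaussianReal 0 1) N α →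
      Metric.infDist 0 (α : Set ℝ) ≤ R := by
  set M : ℝ := (distortion r (gaussianReal 0 1) {0}).toReal with hM
  have hMtop := distortion_gaussian_ne_top hr (Finset.singleton_nonempty (0 : ℝ))
  obtain ⟨c, hc, hnbhd⟩ := exists_gaussian_nbhd
  refine ⟨1 + (M / c) ^ (1 / r), by positivity, fun N α hN hα => ?_⟩
  set D : ℝ := Metric.infDist 0 (α : Set ℝ) with hD
  by_contra hlt
  rw [not_le] at hlt
  have hMc : 0 ≤ M / c := by positivity
  have hD1 : 0 ≤ D - 1 := by
    have : 0 ≤ (M / c) ^ (1 / r) := by positivity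
    linarith
  obtain ⟨J, hJm, hJ, hJμ⟩ := hnbhd 0 1 zero_le_one le_rfl
  have hDe : ENNReal.ofReal D = Metric.infEDist 0 (α : Set ℝ) :=
    ENNReal.ofReal_toReal (Metric.infEDist_ne_top (Finset.coe_nonempty.2 hα.nonempty))
  have h1 : ENNReal.ofReal ((D - 1) ^ r) * gaussianReal 0 1 J ≤
      distortion r (gaussianReal 0 1) {0} := by
    refine le_trans ?_ (hα.le {0} (by simp) (by simpa using hN))
    rw [distortion, ← lintegral_indicator_const hJm]
    refine lintegral_mono fun x => ?_
    by_cases hx : x ∈ J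
    · rw [Set.indicator_of_mem hx, ← ENNReal.ofReal_rpow_of_nonneg hD1 hr.le]
      gcongr
      rw [ENNReal.ofReal_sub _ zero_le_one, hDe]
      refine tsub_le_iff_left.2 ((Metric.infEDist_le_edist_add_infEDist (y := x)).trans ?_)
      gcongr
      rw [edist_comm, edist_dist, Real.dist_eq]
      apply ENNReal.ofReal_le_ofReal
      linarith [hJ x hx]
    · simp [Set.indicator_of_notMem hx]
  have h2 : (D - 1) ^ r * c ≤ M := by
    have h3 : ENNReal.ofReal ((D - 1) ^ r * c) ≤ distortion r (gaussianReal 0 1) {0} := by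
      rw [ENNReal.ofReal_mul (by positivity)]
      refine le_trans ?_ h1
      gcongr
      simpa using hJμ
    rwa [ENNReal.ofReal_le_iff_le_toReal hMtop] at h3
  rw [← le_div_iff₀ hc] at h2
  have h4 : ((M / c) ^ (1 / r)) ^ r < (D - 1) ^ r :=
    Real.rpow_lt_rpow (by positivity) (by linarith) hr
  rw [← Real.rpow_mul hMc, one_div, inv_mul_cancel₀ hr.ne', Real.rpow_one] at h4
  linarith

/-- Distortion mismatch: for an `L^r`-optimal `N`-quantization of a standard normal variable, the
quantization error is of order `1 / N` in `L^s` for every `s < r + 1`. -/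
theorem exists_eLpNorm_quantization_le {r s : ℝ} (hr : 0 < r) (hs : 0 < s) (hsr : s < r + 1) :
    ∃ C : ℝ, 0 < C ∧ ∀ (Ω : Type u) [MeasurableSpace Ω] (P : Measure Ω) [IsProbabilityMeasure P]
      (X Xhat : Ω → ℝ) (N : ℕ), Measurable X → P.map X = gaussianReal 0 1 → 1 ≤ N →
      IsOptimalQuantization r P N X Xhat →
      eLpNorm (fun ω => X ω - Xhat ω) (ENNReal.ofReal s) P ≤ ENNReal.ofReal (C / N) := by
  obtain ⟨C, hC, hmesh⟩ := exists_infDist_le hr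
  obtain ⟨R, hR, hzero⟩ := exists_infDist_zero_le hr
  have hr1 : 0 < r + 1 := by linarith
  set W : ℝ := (∫⁻ x, ENNReal.ofReal ((1 + R + |x|) ^ s *
    Real.exp (s / (r + 1) * (x ^ 2 / 2))) ∂gaussianReal 0 1).toReal with hW
  have hWtop := lintegral_gaussian_exp_lt_top (A := 1 + R) (s := s) (τ := s / (r + 1))
    (by positivity) hs.le (by rwa [div_lt_one hr1])
  refine ⟨C * (W + 1) ^ (1 / s), by positivity, ?_⟩
  intro Ω _ P _ X Xhat N hX hlaw hN hopt
  have hN0 : (0 : ℝ) < N := by exact_mod_cast hN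
  obtain ⟨α, hα, hae⟩ := hopt.exists_optimalCodebook hr hX
    (by rw [hlaw]; exact distortion_gaussian_ne_top hr (Finset.singleton_nonempty 0))
  rw [hlaw] at hα
  apply eLpNorm_ofReal_le hs
  have hpt : ∀ x, Metric.infEDist x (α : Set ℝ) ^ s ≤ ENNReal.ofReal ((C / N) ^ s) *
      ENNReal.ofReal ((1 + R + |x|) ^ s * Real.exp (s / (r + 1) * (x ^ 2 / 2))) := fun x => by
    have h1 := hmesh N α hN hα x
    set D : ℝ := Metric.infDist x (α : Set ℝ) with hD
    have hD0 : 0 ≤ D := Metric.infDist_nonneg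
    have h2 : D ≤ R + |x| := by
      have h3 := Metric.infDist_le_infDist_add_dist (s := (α : Set ℝ)) (x := x) (y := 0)
      have h4 := hzero N α hN hα
      rw [Real.dist_eq, sub_zero] at h3
      linarith
    have h5 : D ≤ min D 1 * (1 + R + |x|) := by
      have := abs_nonneg x
      rcases le_total D 1 with h | h
      · rw [min_eq_left h]
        nlinarith
      · rw [min_eq_right h]
        linarith
    have h6 : D ≤ C / N * Real.exp (x ^ 2 / 2 / (r + 1)) * (1 + R + |x|) :=
      h5.trans (by gcongr)
    have hDe : ENNReal.ofReal D = Metric.infEDist x (α : Set ℝ) :=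
      ENNReal.ofReal_toReal (Metric.infEDist_ne_top (Finset.coe_nonempty.2 hα.nonempty))
    rw [← hDe, ENNReal.ofReal_rpow_of_nonneg hD0 hs.le, ← ENNReal.ofReal_mul (by positivity)]
    apply ENNReal.ofReal_le_ofReal
    refine (Real.rpow_le_rpow hD0 h6 hs.le).trans (le_of_eq ?_)
    rw [Real.mul_rpow (by positivity) (by positivity), Real.mul_rpow (by positivity)
      (by positivity), ← Real.exp_mul]
    have : x ^ 2 / 2 / (r + 1) * s = s / (r + 1) * (x ^ 2 / 2) := by ring
    rw [this]
    ring
  calc ∫⁻ ω, ‖X ω - Xhat ω‖ₑ ^ s ∂P = ∫⁻ ω, Metric.infEDist (X ω) (α : Set ℝ) ^ s ∂P :=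
        lintegral_congr_ae (by filter_upwards [hae] with ω hω; rw [hω])
    _ = ∫⁻ x, Metric.infEDist x (α : Set ℝ) ^ s ∂gaussianReal 0 1 := by
        rw [lintegral_infEDist_comp hX, hlaw]; rfl
    _ ≤ _ := lintegral_mono hpt
    _ = ENNReal.ofReal ((C / N) ^ s * W) := by
        rw [lintegral_const_mul _ (by fun_prop), ENNReal.ofReal_mul (by positivity), hW,
          ENNReal.ofReal_toReal hWtop.ne]
    _ ≤ ENNReal.ofReal (C * (W + 1) ^ (1 / s) / N) ^ s := by
        rw [ENNReal.ofReal_rpow_of_nonneg (by positivity) hs.le]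
        apply ENNReal.ofReal_le_ofReal
        have hW0 : 0 ≤ W := ENNReal.toReal_nonneg
        rw [mul_div_right_comm, Real.mul_rpow (by positivity) (by positivity),
          ← Real.rpow_mul (by positivity), one_div, inv_mul_cancel₀ hs.ne', Real.rpow_one]
        gcongr
        linarith

end Mismatch

/-! ### Allocation of the levels -/

section Allocation

variable {θ γ : ℝ}

theorem one_le_j₀ (hθ : 0 < θ) (hγ : 0 ≤ γ) : 1 ≤ j₀ θ γ := by
  apply Nat.le_floor
  rw [Nat.cast_one]
  exact Real.one_le_exp (by positivity)

theorem nu_eq_decay (j : ℕ) : nu θ γ j = decay θ γ ((max j (j₀ θ γ) : ℕ) : ℝ) := rfl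

theorem nu_pos (hθ : 0 < θ) (hγ : 0 ≤ γ) (j : ℕ) : 0 < nu θ γ j := by
  rw [nu_eq_decay]
  apply decay_pos
  exact_mod_cast lt_of_lt_of_le (one_le_j₀ hθ hγ) (le_max_right _ _)

/-- The profile decreases from `j₀` on, since `log (1 + x) ≥ γ / θ` there. -/
theorem decay_le_decay (hθ : 0 < θ) (hγ : 0 ≤ γ) {x y : ℝ} (hx : (j₀ θ γ : ℝ) ≤ x)
    (hxy : x ≤ y) : decay θ γ y ≤ decay θ γ x := by
  have hj : (1 : ℝ) ≤ j₀ θ γ := by exact_mod_cast one_le_j₀ hθ hγ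
  have hx0 : 0 < x := by linarith
  have hy0 : 0 < y := by linarith
  have hlx := log_one_add_pos hx0
  have hly := log_one_add_pos hy0
  have hlog : γ / θ ≤ Real.log (1 + x) := by
    rw [Real.le_log_iff_exp_le (by linarith)]
    have := Nat.lt_floor_add_one (Real.exp (γ / θ))
    change Real.exp (γ / θ) < (j₀ θ γ : ℝ) + 1 at this
    linarith
  have h1 : Real.log (Real.log (1 + y)) - Real.log (Real.log (1 + x)) ≤
      (Real.log y - Real.log x) / Real.log (1 + x) := by
    rw [← Real.log_div hly.ne' hlx.ne']
    refine (Real.log_le_sub_one_of_pos (by positivity)).trans ?_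
    rw [div_sub_one hlx.ne']
    refine div_le_div_of_nonneg_right ?_ hlx.le
    rw [← Real.log_div (by linarith) (by linarith), ← Real.log_div hy0.ne' hx0.ne']
    apply Real.log_le_log (div_pos (by linarith) (by linarith))
    rw [div_le_div_iff₀ (by linarith) hx0]
    linarith
  have h2 : 0 ≤ Real.log y - Real.log x := by
    have := Real.log_le_log hx0 hxy
    linarith
  have h3 : γ * (Real.log (Real.log (1 + y)) - Real.log (Real.log (1 + x))) ≤
      θ * (Real.log y - Real.log x) := by
    calc _ ≤ γ * ((Real.log y - Real.log x) / Real.log (1 + x)) := by gcongr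
      _ = γ / Real.log (1 + x) * (Real.log y - Real.log x) := by ring
      _ ≤ _ := by
          gcongr
          rw [div_le_iff₀ hlx]
          rw [div_le_iff₀ hθ] at hlog
          linarith
  unfold decay
  rw [Real.rpow_def_of_pos hy0, Real.rpow_def_of_pos hx0, Real.rpow_def_of_pos hly,
    Real.rpow_def_of_pos hlx, ← Real.exp_add, ← Real.exp_add]
  apply Real.exp_le_exp.2
  linarith

theorem nu_antitone (hθ : 0 < θ) (hγ : 0 ≤ γ) : Antitone (nu θ γ) := fun i j hij => by
  rw [nu_eq_decay, nu_eq_decay]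
  apply decay_le_decay hθ hγ
  · exact_mod_cast le_max_right _ _
  · exact_mod_cast max_le_max_right _ hij

theorem decay_le_nu (hθ : 0 < θ) (hγ : 0 ≤ γ) {j : ℕ} (hj : 1 ≤ j) :
    decay θ γ j ≤ (j₀ θ γ : ℝ) ^ θ * nu θ γ j := by
  have hj₀ : (1 : ℝ) ≤ j₀ θ γ := by exact_mod_cast one_le_j₀ hθ hγ
  have hj' : (1 : ℝ) ≤ j := by exact_mod_cast hj
  rcases le_total (j₀ θ γ) j with h | h
  · have h1 : nu θ γ j = decay θ γ j := by rw [nu_eq_decay, max_eq_left h]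
    rw [h1]
    exact le_mul_of_one_le_left (decay_pos (by linarith)).le (Real.one_le_rpow hj₀ hθ.le)
  · rw [nu_eq_decay, max_eq_right h]
    unfold decay
    rw [← mul_assoc, ← Real.rpow_add (by linarith), add_neg_cancel, Real.rpow_zero]
    have h1 : (j : ℝ) ^ (-θ) ≤ 1 := Real.rpow_le_one_of_one_le_of_nonpos hj' (by linarith)
    have h2 := log_one_add_pos (by linarith : (0 : ℝ) < j)
    have h3 : (j : ℝ) ≤ j₀ θ γ := by exact_mod_cast h
    gcongr

/-- The geometric mean of `ν_1, …, ν_m`. -/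
noncomputable def nuMean (θ γ : ℝ) (m : ℕ) : ℝ :=
  (∏ k ∈ Finset.Icc 1 m, nu θ γ k) ^ (1 / (m : ℝ))

theorem prod_nu_pos (hθ : 0 < θ) (hγ : 0 ≤ γ) (m : ℕ) : 0 < ∏ k ∈ Finset.Icc 1 m, nu θ γ k :=
  Finset.prod_pos fun k _ => nu_pos hθ hγ k

theorem nuMean_pos (hθ : 0 < θ) (hγ : 0 ≤ γ) (m : ℕ) : 0 < nuMean θ γ m :=
  Real.rpow_pos_of_pos (prod_nu_pos hθ hγ m) _

theorem zAlloc_eq (hθ : 0 < θ) (hγ : 0 ≤ γ) (N m j : ℕ) :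
    zAlloc θ γ N m j = (N : ℝ) ^ (1 / (m : ℝ)) * nu θ γ j / nuMean θ γ m := by
  rw [zAlloc, Real.rpow_neg (prod_nu_pos hθ hγ m).le, ← div_eq_mul_inv]
  rfl

theorem zAlloc_antitone (hθ : 0 < θ) (hγ : 0 ≤ γ) (N m : ℕ) : Antitone (zAlloc θ γ N m) :=
  fun i j hij => by
    rw [zAlloc_eq hθ hγ, zAlloc_eq hθ hγ]
    have h1 := nu_antitone hθ hγ hij
    have h2 := nuMean_pos hθ hγ m
    gcongr

theorem prod_zAlloc (hθ : 0 < θ) (hγ : 0 ≤ γ) (N : ℕ) {m : ℕ} (hm : 1 ≤ m) :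
    ∏ j ∈ Finset.range m, zAlloc θ γ N m (j + 1) = N := by
  have hm0 : (m : ℝ) ≠ 0 := by positivity
  have h1 : ∏ j ∈ Finset.range m, nu θ γ (j + 1) = ∏ k ∈ Finset.Icc 1 m, nu θ γ k := by
    rw [Finset.range_eq_Ico, Finset.prod_Ico_add' (nu θ γ) 0 m 1]
    rfl
  have h2 : nuMean θ γ m ^ m = ∏ k ∈ Finset.Icc 1 m, nu θ γ k := by
    rw [nuMean, ← Real.rpow_natCast, ← Real.rpow_mul (prod_nu_pos hθ hγ m).le,
      one_div_mul_cancel hm0, Real.rpow_one]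
  have h3 : ((N : ℝ) ^ (1 / (m : ℝ))) ^ m = N := by
    rw [← Real.rpow_natCast, ← Real.rpow_mul (by positivity), one_div_mul_cancel hm0,
      Real.rpow_one]
  simp only [zAlloc_eq hθ hγ]
  rw [Finset.prod_div_distrib, Finset.prod_mul_distrib, Finset.prod_const, Finset.prod_const,
    Finset.card_range, h1, h2, h3, mul_div_assoc, div_self (prod_nu_pos hθ hγ m).ne', mul_one]

theorem one_le_zAlloc (hθ : 0 < θ) (hγ : 0 ≤ γ) {N m : ℕ} (h : 1 ≤ zAlloc θ γ N m m) {j : ℕ}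
    (hj : j < m) : 1 ≤ zAlloc θ γ N m (j + 1) :=
  h.trans (zAlloc_antitone hθ hγ N m hj)

theorem one_le_levels (hθ : 0 < θ) (hγ : 0 ≤ γ) {N m : ℕ} (h : 1 ≤ zAlloc θ γ N m m) {j : ℕ}
    (hj : j < m) : 1 ≤ levels θ γ N m j := by
  apply Nat.le_floor
  rw [Nat.cast_one]
  exact one_le_zAlloc hθ hγ h hj

theorem prod_levels_le (hθ : 0 < θ) (hγ : 0 ≤ γ) {N m : ℕ} (hm : 1 ≤ m)
    (h : 1 ≤ zAlloc θ γ N m m) : ∏ j ∈ Finset.range m, levels θ γ N m j ≤ N := by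
  have h1 : ((∏ j ∈ Finset.range m, levels θ γ N m j : ℕ) : ℝ) ≤ N := by
    rw [← prod_zAlloc hθ hγ N hm]
    push_cast
    refine Finset.prod_le_prod (fun _ _ => Nat.cast_nonneg _) fun j hj => ?_
    exact Nat.floor_le (zero_le_one.trans (one_le_zAlloc hθ hγ h (Finset.mem_range.1 hj)))
  exact_mod_cast h1

/-- The allocation balances the contributions `ν_j / N_j` of the coordinates. -/
theorem nu_div_levels_le (hθ : 0 < θ) (hγ : 0 ≤ γ) {N m : ℕ} (hN : 1 ≤ N)
    (h : 1 ≤ zAlloc θ γ N m m) {j : ℕ} (hj : j < m) :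
    nu θ γ (j + 1) / levels θ γ N m j ≤ 2 * ((N : ℝ) ^ (-(1 / (m : ℝ))) * nuMean θ γ m) := by
  have hz := one_le_zAlloc hθ hγ h hj
  have hl : (1 : ℝ) ≤ levels θ γ N m j := by exact_mod_cast one_le_levels hθ hγ h hj
  have hN0 : (0 : ℝ) < N := by exact_mod_cast hN
  have h1 : zAlloc θ γ N m (j + 1) ≤ 2 * levels θ γ N m j := by
    have := Nat.lt_floor_add_one (zAlloc θ γ N m (j + 1))
    change _ < (levels θ γ N m j : ℝ) + 1 at this
    linarith
  rw [zAlloc_eq hθ hγ, div_le_iff₀ (nuMean_pos hθ hγ m)] at h1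
  rw [div_le_iff₀ (by linarith), Real.rpow_neg hN0.le]
  have hpow : 0 < (N : ℝ) ^ (1 / (m : ℝ)) := by positivity
  calc nu θ γ (j + 1) = ((N : ℝ) ^ (1 / (m : ℝ)))⁻¹ *
        ((N : ℝ) ^ (1 / (m : ℝ)) * nu θ γ (j + 1)) := by
        rw [← mul_assoc, inv_mul_cancel₀ hpow.ne', one_mul]
    _ ≤ ((N : ℝ) ^ (1 / (m : ℝ)))⁻¹ * (2 * levels θ γ N m j * nuMean θ γ m) := by gcongr
    _ = _ := by ring

/-- The geometric mean of the `ν_k` is of the order of the last one, by `m ! ≥ (m / e) ^ m`. -/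
theorem exists_nuMean_le (hθ : 0 < θ) (hγ : 0 ≤ γ) :
    ∃ C : ℝ, 0 < C ∧ ∀ m : ℕ, 1 ≤ m → nuMean θ γ m ≤ C * decay θ γ m := by
  have hlog2 : 0 < Real.log 2 := Real.log_pos (by norm_num)
  have hj₀ : (1 : ℝ) ≤ j₀ θ γ := by exact_mod_cast one_le_j₀ hθ hγ
  set B : ℝ := Real.log (1 + j₀ θ γ) / Real.log 2 with hB
  have hB1 : 1 ≤ B := by
    rw [hB, one_le_div hlog2]
    exact Real.log_le_log (by norm_num) (by linarith)
  refine ⟨Real.exp 1 ^ θ * B ^ γ, by positivity, fun m hm => ?_⟩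
  have hm0 : (0 : ℝ) < m := by exact_mod_cast hm
  have hm1 : (1 : ℝ) ≤ m := by exact_mod_cast hm
  have hlm := log_one_add_pos hm0
  have hterm : ∀ k ∈ Finset.Icc 1 m,
      nu θ γ k ≤ (k : ℝ) ^ (-θ) * (B * Real.log (1 + m)) ^ γ := fun k hk => by
    rw [Finset.mem_Icc] at hk
    have hk0 : (0 : ℝ) < k := by exact_mod_cast hk.1
    have hkm : (k : ℝ) ≤ m := by exact_mod_cast hk.2
    have h1 : (k : ℝ) ≤ ((max k (j₀ θ γ) : ℕ) : ℝ) := by exact_mod_cast le_max_left _ _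
    have h2 : Real.log (1 + ((max k (j₀ θ γ) : ℕ) : ℝ)) ≤ B * Real.log (1 + m) := by
      rcases le_total k (j₀ θ γ) with h | h
      · rw [max_eq_right h]
        have h3 : Real.log 2 ≤ Real.log (1 + m) := Real.log_le_log (by norm_num) (by linarith)
        calc Real.log (1 + j₀ θ γ) = B * Real.log 2 := by rw [hB]; field_simp
          _ ≤ _ := by gcongr
      · rw [max_eq_left h]
        refine (Real.log_le_log (by linarith) (by linarith)).trans
          (le_mul_of_one_le_left hlm.le hB1)
    unfold nu
    have h4 : 0 ≤ Real.log (1 + ((max k (j₀ θ γ) : ℕ) : ℝ)) :=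
      Real.log_nonneg (by linarith)
    have h5 : ((max k (j₀ θ γ) : ℕ) : ℝ) ^ (-θ) ≤ (k : ℝ) ^ (-θ) :=
      Real.rpow_le_rpow_of_nonpos hk0 h1 (by linarith)
    gcongr
  have hfac : ∏ k ∈ Finset.Icc 1 m, k = m.factorial := by
    rw [← Finset.prod_range_add_one_eq_factorial, Finset.range_eq_Ico,
      Finset.prod_Ico_add' (fun k => k) 0 m 1]
    rfl
  have hprod : ∏ k ∈ Finset.Icc 1 m, nu θ γ k ≤
      ((m.factorial : ℝ) ^ (-θ)) * ((B * Real.log (1 + m)) ^ γ) ^ m := by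
    refine (Finset.prod_le_prod (fun k _ => (nu_pos hθ hγ k).le) hterm).trans (le_of_eq ?_)
    rw [Finset.prod_mul_distrib, Finset.prod_const, Nat.card_Icc, Nat.add_sub_cancel,
      Real.finsetProd_rpow _ _ (fun k _ => Nat.cast_nonneg k), ← Nat.cast_prod, hfac]
  have hfact : ((m : ℝ) / Real.exp 1) ^ m ≤ m.factorial := by
    have h1 := Real.pow_div_factorial_le_exp (m : ℝ) hm0.le m
    rw [div_le_iff₀ (by positivity)] at h1
    rw [div_pow, div_le_iff₀ (by positivity), ← Real.exp_nat_mul, mul_one]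
    linarith
  have hfact' : (m.factorial : ℝ) ^ (-θ) ≤ (((m : ℝ) / Real.exp 1) ^ (-θ)) ^ m := by
    rw [← Real.rpow_natCast, ← Real.rpow_mul (by positivity), mul_comm, Real.rpow_mul
      (by positivity), Real.rpow_natCast]
    exact Real.rpow_le_rpow_of_nonpos (by positivity) hfact (by linarith)
  calc nuMean θ γ m ≤ ((((m : ℝ) / Real.exp 1) ^ (-θ) * (B * Real.log (1 + m)) ^ γ) ^ m)
        ^ (1 / (m : ℝ)) := by
        unfold nuMean
        have := (prod_nu_pos hθ hγ m).le
        rw [mul_pow]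
        refine Real.rpow_le_rpow this (hprod.trans ?_) (by positivity)
        gcongr
    _ = ((m : ℝ) / Real.exp 1) ^ (-θ) * (B * Real.log (1 + m)) ^ γ := by
        rw [one_div, Real.pow_rpow_inv_natCast (by positivity) (by omega)]
    _ = _ := by
        rw [Real.div_rpow hm0.le (Real.exp_pos _).le, Real.mul_rpow (by positivity) hlm.le,
          Real.rpow_neg (Real.exp_pos 1).le, div_inv_eq_mul]
        unfold decay
        ring

end Allocation

/-! ### Lengths, and the error of the tuned product quantizations -/

section Lengths

variable {θ γ : ℝ}

theorem one_lt_log {N : ℕ} (hN : 3 ≤ N) : 1 < Real.log N := by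
  have h3 : (3 : ℝ) ≤ N := by exact_mod_cast hN
  rw [Real.lt_log_iff_exp_lt (by linarith)]
  linarith [Real.exp_one_lt_d9]

theorem log_log_pos {N : ℕ} (hN : 3 ≤ N) : 0 < Real.log (Real.log N) :=
  Real.log_pos (one_lt_log hN)

theorem tendsto_log_nat : Tendsto (fun N : ℕ => Real.log N) atTop atTop :=
  Real.tendsto_log_atTop.comp tendsto_natCast_atTop_atTop

theorem tendsto_log_log_nat : Tendsto (fun N : ℕ => Real.log (Real.log N)) atTop atTop :=
  Real.tendsto_log_atTop.comp tendsto_log_nat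

theorem tendsto_length_scale :
    Tendsto (fun N : ℕ => 2 * Real.log N / Real.log (Real.log N)) atTop atTop := by
  refine tendsto_atTop_mono' _ ?_
    ((tendsto_rpow_atTop (by norm_num : (0 : ℝ) < 1 / 2)).comp tendsto_log_nat)
  filter_upwards [eventually_ge_atTop 3] with N hN
  have h1 := one_lt_log hN
  have h2 := log_log_pos hN
  have h3 := Real.log_le_rpow_div (x := Real.log N) (by linarith) (by norm_num : (0 : ℝ) < 1 / 2)
  rw [Function.comp, le_div_iff₀ h2]
  have h4 : Real.log N ^ (1 / 2 : ℝ) * Real.log N ^ (1 / 2 : ℝ) = Real.log N := by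
    rw [← Real.rpow_add (by linarith)]; norm_num
  have h5 : 0 < Real.log N ^ (1 / 2 : ℝ) := by positivity
  nlinarith

theorem two_le_length_scale {N : ℕ} (hN : 3 ≤ N) :
    2 ≤ 2 * Real.log N / Real.log (Real.log N) := by
  rw [le_div_iff₀ (log_log_pos hN)]
  have := Real.log_le_sub_one_of_pos (zero_lt_one.trans (one_lt_log hN))
  linarith

/-- With at most `2 log N / log log N` factors, the geometric mean `N ^ (1 / m)` of the levels is
at least `√(log N)`. -/
theorem log_rpow_half_le {N m : ℕ} (hN : 3 ≤ N) (hm : 1 ≤ m)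
    (hle : (m : ℝ) ≤ 2 * Real.log N / Real.log (Real.log N)) :
    Real.log N ^ (1 / 2 : ℝ) ≤ (N : ℝ) ^ (1 / (m : ℝ)) := by
  have hN0 : (0 : ℝ) < N := by positivity
  have hm0 : (0 : ℝ) < m := by exact_mod_cast hm
  have h1 := one_lt_log hN
  have h2 := log_log_pos hN
  rw [Real.rpow_def_of_pos hN0, Real.rpow_def_of_pos (by linarith)]
  apply Real.exp_le_exp.2
  rw [le_div_iff₀ h2] at hle
  rw [mul_one_div, mul_one_div, div_le_div_iff₀ (by norm_num) hm0]
  linarith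

/-- The integer parts of `2 log N / log log N` are admissible lengths for all large `N`. -/
theorem exists_isLengthChoice (hθ : 0 < θ) (hγ : 0 ≤ γ) :
    ∃ m : ℕ → ℕ, IsLengthChoice θ γ m := by
  classical
  let M : ℕ → ℕ := fun N => ⌊2 * Real.log N / Real.log (Real.log N)⌋₊
  have hM1 : ∀ N, 3 ≤ N → 1 ≤ M N := fun N hN =>
    Nat.le_floor (by rw [Nat.cast_one]; linarith [two_le_length_scale hN])
  have hMle : ∀ N, 3 ≤ N → (M N : ℝ) ≤ 2 * Real.log N / Real.log (Real.log N) := fun N hN =>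
    Nat.floor_le (by linarith [two_le_length_scale hN])
  have hMtop : Tendsto M atTop atTop := tendsto_nat_floor_atTop.comp tendsto_length_scale
  have hM : ∀ᶠ N in atTop, 1 ≤ zAlloc θ γ N (M N) (M N) := by
    obtain ⟨C, hC, hmean⟩ := exists_nuMean_le hθ hγ
    have hgrow := ((tendsto_rpow_atTop (by norm_num : (0 : ℝ) < 1 / 2)).comp
      tendsto_log_nat).eventually_ge_atTop C
    filter_upwards [eventually_ge_atTop 3, hgrow, hMtop.eventually_ge_atTop (j₀ θ γ)]
      with N hN hCN hj
    have h1 := hmean (M N) (hM1 N hN)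
    have h2 : nu θ γ (M N) = decay θ γ (M N) := by rw [nu_eq_decay, max_eq_left hj]
    rw [zAlloc_eq hθ hγ, one_le_div (nuMean_pos hθ hγ _), h2]
    refine h1.trans ?_
    have h3 : 0 < decay θ γ (M N) := decay_pos (by exact_mod_cast hM1 N hN)
    have h4 := hCN.trans (log_rpow_half_le hN (hM1 N hN) (hMle N hN))
    gcongr
  refine ⟨fun N => if 1 ≤ zAlloc θ γ N (M N) (M N) then M N else 1, ⟨?_, ?_, ?_, ?_⟩⟩
  · intro N hN
    split_ifs
    · exact hM1 N hN
    · exact le_rfl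
  · intro N hN
    split_ifs with h
    · exact h
    · have hν := nu_pos hθ hγ 1
      have : (1 : ℝ) ≤ N := by exact_mod_cast (by omega : 1 ≤ N)
      rw [zAlloc_eq hθ hγ, nuMean, Finset.Icc_self, Finset.prod_singleton]
      simpa [hν.ne'] using (by omega : 1 ≤ N)
  · intro N hN
    split_ifs
    · exact hMle N hN
    · rw [Nat.cast_one]
      linarith [two_le_length_scale hN]
  · have h1 : Tendsto (fun N : ℕ => (M N : ℝ) / (2 * Real.log N / Real.log (Real.log N)))
        atTop (𝓝 1) := (tendsto_nat_floor_div_atTop (R := ℝ)).comp tendsto_length_scale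
    refine h1.congr' ?_
    filter_upwards [hM] with N hN
    rw [if_pos hN]

/-- A bound that holds for large `N` holds for all `N ≥ 3` after changing the constant. -/
theorem exists_const_of_eventually {f g : ℕ → ℝ} (hg : ∀ N, 3 ≤ N → 0 < g N) {K : ℝ}
    (h : ∀ᶠ N in atTop, f N ≤ K * g N) : ∃ C : ℝ, 0 < C ∧ ∀ N, 3 ≤ N → f N ≤ C * g N := by
  obtain ⟨N₀, hN₀⟩ := eventually_atTop.1 h
  have hS : 0 ≤ ∑ n ∈ Finset.range N₀, |f n / g n| := Finset.sum_nonneg fun _ _ => abs_nonneg _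
  refine ⟨|K| + 1 + ∑ n ∈ Finset.range N₀, |f n / g n|, by positivity, fun N hN => ?_⟩
  have hgN := hg N hN
  rcases lt_or_ge N N₀ with hlt | hge
  · have h1 : |f N / g N| ≤ ∑ n ∈ Finset.range N₀, |f n / g n| :=
      Finset.single_le_sum (f := fun n => |f n / g n|) (fun _ _ => abs_nonneg _)
        (Finset.mem_range.2 hlt)
    rw [← div_le_iff₀ hgN]
    linarith [le_abs_self (f N / g N), abs_nonneg K]
  · refine (hN₀ N hge).trans ?_
    have := le_abs_self K
    gcongr
    linarith

/-- The contribution of the quantized coordinates and that of the remainder, for lengths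
`m ~ 2 log N / log log N`. Here `κ ≥ 0` is the exponent of the logarithm that the chaining bound
for the remainder costs. -/
theorem exists_error_le_rate (hθ : 1 / 2 < θ) (hγ : 0 ≤ γ) {κ : ℝ} (hκ : 0 ≤ κ) {m : ℕ → ℕ}
    (hm : IsLengthChoice θ γ m) :
    ∃ C : ℝ, 0 < C ∧ ∀ N : ℕ, 3 ≤ N →
      (m N : ℝ) * ((N : ℝ) ^ (-(1 / (m N : ℝ))) * nuMean θ γ (m N)) +
        (m N : ℝ) ^ (1 / 2 - θ) * Real.log (1 + m N) ^ (γ + κ) ≤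
      C * (Real.log (Real.log N) ^ (θ - 1 / 2 + γ + κ) / Real.log N ^ (θ - 1 / 2)) := by
  obtain ⟨A, hA, hmean⟩ := exists_nuMean_le (by linarith : 0 < θ) hγ
  refine exists_const_of_eventually (K := A * 2 + 1) (fun N hN => ?_) ?_
  · have h1 := one_lt_log hN
    have h2 := log_log_pos hN
    positivity
  have hhalf : ∀ᶠ N : ℕ in atTop,
      1 / 2 < (m N : ℝ) / (2 * Real.log N / Real.log (Real.log N)) :=
    hm.equiv.eventually (lt_mem_nhds (by norm_num))
  filter_upwards [eventually_ge_atTop 3, hhalf, tendsto_log_nat.eventually_ge_atTop 2,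
    tendsto_log_log_nat.eventually_ge_atTop 4] with N hN hmN hL2 hl4
  have hm1 := hm.pos N hN
  have hmle := hm.le N hN
  have hroot := log_rpow_half_le hN hm1 hmle
  have hmean' := hmean (m N) hm1
  have hN0 : (0 : ℝ) < N := by positivity
  set n : ℝ := (m N : ℝ) with hn
  set L : ℝ := Real.log N with hL
  set l : ℝ := Real.log L with hl
  have hn0 : 0 < n := by rw [hn]; exact_mod_cast hm1
  have hL0 : 0 < L := by linarith
  have hl0 : 0 < l := by linarith
  have hlower : L / l ≤ n := by
    rw [lt_div_iff₀ (by positivity)] at hmN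
    have : 1 / 2 * (2 * L / l) = L / l := by ring
    linarith
  have hupper : 1 + n ≤ L := by
    have : 2 * L / l ≤ L / 2 := by
      rw [div_le_div_iff₀ hl0 (by norm_num)]
      nlinarith
    linarith
  have hlog : Real.log (1 + n) ≤ l := Real.log_le_log (by linarith) hupper
  have hlog0 := log_one_add_pos hn0
  have hpow : n ^ (1 / 2 - θ) ≤ l ^ (θ - 1 / 2) / L ^ (θ - 1 / 2) := by
    refine (Real.rpow_le_rpow_of_nonpos (by positivity) hlower (by linarith)).trans (le_of_eq ?_)
    have : 1 / 2 - θ = -(θ - 1 / 2) := by ring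
    rw [this, Real.rpow_neg (by positivity), Real.div_rpow hL0.le hl0.le, inv_div]
  have hR : l ^ (θ - 1 / 2) / L ^ (θ - 1 / 2) * l ^ (γ + κ) =
      l ^ (θ - 1 / 2 + γ + κ) / L ^ (θ - 1 / 2) := by
    rw [add_assoc (θ - 1 / 2), Real.rpow_add hl0 (θ - 1 / 2) (γ + κ), div_mul_eq_mul_div]
  have htail : n ^ (1 / 2 - θ) * Real.log (1 + n) ^ (γ + κ) ≤
      l ^ (θ - 1 / 2 + γ + κ) / L ^ (θ - 1 / 2) := by
    rw [← hR]
    gcongr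
  have hlogγ : Real.log (1 + n) ^ γ ≤ l ^ (γ + κ) :=
    (Real.rpow_le_rpow hlog0.le hlog hγ).trans
      (Real.rpow_le_rpow_of_exponent_le (by linarith) (by linarith))
  -- The factor `m` from the triangle inequality is compensated by `N ^ (-1 / m) ≤ L ^ (-1 / 2)`.
  have hhalfpow : n ^ (1 / 2 : ℝ) * (N : ℝ) ^ (-(1 / n)) ≤ 2 := by
    rw [Real.rpow_neg hN0.le, ← div_eq_mul_inv, div_le_iff₀ (by positivity)]
    have h1 : n ^ (1 / 2 : ℝ) ≤ L ^ (1 / 2 : ℝ) :=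
      Real.rpow_le_rpow hn0.le (by linarith) (by norm_num)
    have h2 : 0 < L ^ (1 / 2 : ℝ) := by positivity
    linarith
  have hmain : n * ((N : ℝ) ^ (-(1 / n)) * nuMean θ γ (m N)) ≤
      A * 2 * (l ^ (θ - 1 / 2 + γ + κ) / L ^ (θ - 1 / 2)) := by
    have e1 : n * n ^ (-θ) = n ^ (1 / 2 : ℝ) * n ^ (1 / 2 - θ) := by
      have h1 := Real.rpow_add hn0 1 (-θ)
      rw [Real.rpow_one] at h1
      rw [← h1, ← Real.rpow_add hn0]
      congr 1; ring
    calc n * ((N : ℝ) ^ (-(1 / n)) * nuMean θ γ (m N))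
        ≤ n * ((N : ℝ) ^ (-(1 / n)) * (A * decay θ γ n)) := by gcongr
      _ = A * (n ^ (1 / 2 : ℝ) * (N : ℝ) ^ (-(1 / n))) *
          (n ^ (1 / 2 - θ) * Real.log (1 + n) ^ γ) := by
          unfold decay
          linear_combination (A * (N : ℝ) ^ (-(1 / n)) * Real.log (1 + n) ^ γ) * e1
      _ ≤ A * 2 * (l ^ (θ - 1 / 2) / L ^ (θ - 1 / 2) * l ^ (γ + κ)) := by gcongr
      _ = _ := by rw [hR]
  calc _ ≤ A * 2 * (l ^ (θ - 1 / 2 + γ + κ) / L ^ (θ - 1 / 2)) +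
        l ^ (θ - 1 / 2 + γ + κ) / L ^ (θ - 1 / 2) := add_le_add hmain htail
    _ = _ := by ring

end Lengths

section ErrorBound

theorem exists_isProductQuantization {Ω E : Type*} [MeasurableSpace Ω] [NormedAddCommGroup E]
    [NormedSpace ℝ E] {P : Measure Ω} [IsProbabilityMeasure P] {ξ : ℕ → Ω → ℝ} {θ γ r : ℝ}
    (hθ : 0 < θ) (hγ : 0 ≤ γ) (hr : 0 < r) (hξ : IsStdNormalSeq P ξ) (f : ℕ → E) {N m : ℕ}
    (hm : 1 ≤ m) (hz : 1 ≤ zAlloc θ γ N m m) :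
    ∃ Xhat : Ω → E, IsProductQuantization r P ξ f N m (levels θ γ N m) Xhat := by
  have hex : ∀ j, ∃ Y, j < m → IsOptimalQuantization r P (levels θ γ N m j) (ξ j) Y := fun j => by
    by_cases hj : j < m
    · obtain ⟨Y, hY⟩ := exists_isOptimalQuantization (P := P) hr (hξ.measurable j)
        (one_le_levels hθ hγ hz hj)
      exact ⟨Y, fun _ => hY⟩
    · exact ⟨0, fun h => absurd h hj⟩
  choose ξhat hξhat using hex
  exact ⟨fun ω => ∑ j ∈ Finset.range m, ξhat j ω • f j, hm, fun j hj =>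
    one_le_levels hθ hγ hz hj, prod_levels_le hθ hγ hm hz, ξhat, hξhat, fun _ => rfl⟩

/-- The quantized coordinates contribute at most the sum of their errors, which the allocation
balances. For `r < 1` the triangle inequality is used in `L^1`, which requires the distortion
mismatch. -/
theorem exists_eLpNorm_quantized_le {T : ℝ} {d : ℕ} {θ γ r : ℝ} (C₁ : ℝ) (hθ : 0 < θ)
    (hγ : 0 ≤ γ) (hr : 0 < r) :
    ∃ C : ℝ, 0 < C ∧ ∀ (Ω : Type u) [MeasurableSpace Ω] (P : Measure Ω) [IsProbabilityMeasure P]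
      (ξ ξhat : ℕ → Ω → ℝ) (f : ℕ → PathSpace T d) (N m : ℕ), IsStdNormalSeq P ξ →
      SizeCondition θ γ C₁ f → 1 ≤ N → 1 ≤ zAlloc θ γ N m m →
      (∀ j < m, IsOptimalQuantization r P (levels θ γ N m j) (ξ j) (ξhat j)) →
      eLpNorm (fun ω => ∑ j ∈ Finset.range m, (ξ j ω - ξhat j ω) • f j)
        (ENNReal.ofReal (max 1 r)) P ≤
        ENNReal.ofReal (C * (m * ((N : ℝ) ^ (-(1 / (m : ℝ))) * nuMean θ γ m))) := by
  obtain ⟨Q, hQ, hquant⟩ := exists_eLpNorm_quantization_le.{u} (s := max 1 r) hr (by positivity)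
    (max_lt (by linarith) (by linarith))
  have hj₀ : (0 : ℝ) < (j₀ θ γ : ℝ) := by exact_mod_cast one_le_j₀ hθ hγ
  set D : ℝ := max C₁ 1 * (j₀ θ γ : ℝ) ^ θ with hD
  have hD0 : 0 < D := by positivity
  refine ⟨D * Q * 2, by positivity, ?_⟩
  intro Ω _ P _ ξ ξhat f N m hξ hf hN hz hopt
  have hmean := nuMean_pos hθ hγ m
  set W : ℝ := (N : ℝ) ^ (-(1 / (m : ℝ))) * nuMean θ γ m with hW
  have hW0 : 0 ≤ W := by positivity
  have hmeas : ∀ j < m, AEStronglyMeasurable (fun ω => (ξ j ω - ξhat j ω) • f j) P :=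
    fun j hj => (((hξ.measurable j).sub
      (hopt j hj).1.1).stronglyMeasurable.smul_const (f j)).aestronglyMeasurable
  have hterm : ∀ j < m, eLpNorm (fun ω => (ξ j ω - ξhat j ω) • f j)
      (ENNReal.ofReal (max 1 r)) P ≤ ENNReal.ofReal (D * Q * 2 * W) := fun j hj => by
    have h1 := hquant Ω P (ξ j) (ξhat j) _ (hξ.measurable j) (hξ.law j)
      (one_le_levels hθ hγ hz hj) (hopt j hj)
    have hf' : ‖f j‖ ≤ D * nu θ γ (j + 1) := by
      have h2 := hf j
      rw [mul_assoc] at h2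
      change ‖f j‖ ≤ C₁ * decay θ γ ((j : ℝ) + 1) at h2
      have h3 : decay θ γ ((j : ℝ) + 1) ≤ (j₀ θ γ : ℝ) ^ θ * nu θ γ (j + 1) := by
        have := decay_le_nu hθ hγ (j := j + 1) (by omega)
        push_cast at this
        exact this
      have h4 : 0 < decay θ γ ((j : ℝ) + 1) := decay_pos (by positivity)
      calc ‖f j‖ ≤ max C₁ 1 * decay θ γ ((j : ℝ) + 1) :=
            h2.trans (by gcongr; exact le_max_left _ _)
        _ ≤ max C₁ 1 * ((j₀ θ γ : ℝ) ^ θ * nu θ γ (j + 1)) := by gcongr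
        _ = _ := by rw [hD]; ring
    have hl : (0 : ℝ) < levels θ γ N m j := by exact_mod_cast one_le_levels hθ hγ hz hj
    calc eLpNorm (fun ω => (ξ j ω - ξhat j ω) • f j) (ENNReal.ofReal (max 1 r)) P
        ≤ ENNReal.ofReal ‖f j‖ *
          eLpNorm (fun ω => ξ j ω - ξhat j ω) (ENNReal.ofReal (max 1 r)) P := by
          refine eLpNorm_le_mul_eLpNorm_of_ae_le_mul (Eventually.of_forall fun ω => ?_) _
          rw [norm_smul, mul_comm]
      _ ≤ ENNReal.ofReal (D * nu θ γ (j + 1)) * ENNReal.ofReal (Q / levels θ γ N m j) := by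
          gcongr
      _ = ENNReal.ofReal (D * Q * (nu θ γ (j + 1) / levels θ γ N m j)) := by
          have := nu_pos hθ hγ (j + 1)
          rw [← ENNReal.ofReal_mul (by positivity)]
          congr 1
          ring
      _ ≤ ENNReal.ofReal (D * Q * (2 * W)) := by
          apply ENNReal.ofReal_le_ofReal
          have := nu_div_levels_le hθ hγ hN hz hj
          gcongr
      _ = _ := by congr 1; ring
  have hp1 : 1 ≤ ENNReal.ofReal (max 1 r) := by
    rw [← ENNReal.ofReal_one]; exact ENNReal.ofReal_le_ofReal (le_max_left _ _)
  have hfun : (fun ω => ∑ j ∈ Finset.range m, (ξ j ω - ξhat j ω) • f j) =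
      ∑ j ∈ Finset.range m, fun ω => (ξ j ω - ξhat j ω) • f j := by
    funext ω; rw [Finset.sum_apply]
  rw [hfun]
  refine (eLpNorm_sum_le (fun j hj => hmeas j (Finset.mem_range.1 hj)) hp1).trans ?_
  refine (Finset.sum_le_sum fun j hj => hterm j (Finset.mem_range.1 hj)).trans (le_of_eq ?_)
  rw [Finset.sum_const, Finset.card_range, nsmul_eq_mul, ← ENNReal.ofReal_natCast,
    ← ENNReal.ofReal_mul (by positivity)]
  congr 1
  ring

/-- The error bounds for the tuned product quantizations, with a constant that depends on the
sequence of lengths but not on the process. -/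
theorem exists_lrError_le_rate {T : ℝ} (hT : 0 < T) {d : ℕ} (hd : 1 ≤ d) {θ γ r : ℝ} {a : ℝ≥0}
    (b C₁ C₂ : ℝ) (hθ : 1 / 2 < θ) (hγ : 0 ≤ γ) (ha : 0 < a) (hr : 0 < r) {m : ℕ → ℕ}
    (hm : IsLengthChoice θ γ m) :
    ∃ C : ℝ, ∀ (Ω : Type u) [MeasurableSpace Ω] (P : Measure Ω) [IsProbabilityMeasure P]
      (ξ : ℕ → Ω → ℝ) (f : ℕ → PathSpace T d) (Y : Ω → PathSpace T d),
      IsStdNormalSeq P ξ → IsSeriesSum P ξ f Y →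
      SizeCondition θ γ C₁ f → HolderCondition a b C₂ f → ∀ N : ℕ, 3 ≤ N →
      ∀ Xhat : Ω → PathSpace T d,
        IsProductQuantization r P ξ f N (m N) (levels θ γ N (m N)) Xhat →
        lrError r P Y Xhat ≤ rate C (θ + γ) θ N ∧
        (b + θ ≤ 0 → lrError r P Y Xhat ≤ rate C (θ + γ - 1 / 2) θ N) := by
  obtain ⟨K, hK, htail⟩ := exists_eLpNorm_tail_le_rate.{u} hT hd b C₁ C₂ (max 1 r) hθ hγ ha
  obtain ⟨Q, hQ, hquant⟩ := exists_eLpNorm_quantized_le.{u} (T := T) (d := d) C₁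
    (by linarith : 0 < θ) hγ hr
  obtain ⟨A₁, hA₁, hrate₁⟩ := exists_error_le_rate hθ hγ (κ := 1 / 2) (by norm_num) hm
  obtain ⟨A₂, hA₂, hrate₂⟩ := exists_error_le_rate hθ hγ (κ := 0) le_rfl hm
  refine ⟨(K + Q) * (A₁ + A₂), ?_⟩
  intro Ω _ P _ ξ f Y hξ hY hf hf' N hN Xhat hX
  obtain ⟨-, -, -, ξhat, hopt, hXhat⟩ := hX
  have hL := one_lt_log hN
  have hl := log_log_pos hN
  have hm0 : (0 : ℝ) < m N := by exact_mod_cast hm.pos N hN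
  have hlm := log_one_add_pos hm0
  have htail' := htail Ω P ξ f Y hξ hY hf hf' (m N) (hm.pos N hN)
  have hquant' := hquant Ω P ξ ξhat f N (m N) hξ hf (by omega) (hm.mem N hN) hopt
  set S : ℝ := (m N : ℝ) * ((N : ℝ) ^ (-(1 / (m N : ℝ))) * nuMean θ γ (m N)) with hS
  have hS0 : 0 ≤ S := by
    have := nuMean_pos (by linarith : 0 < θ) hγ (m N)
    positivity
  have hYm : AEStronglyMeasurable Y P := by
    refine aestronglyMeasurable_of_tendsto_ae atTop (fun n => ?_) hY
    exact (Finset.stronglyMeasurable_fun_sum _ fun j _ =>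
      (hξ.measurable j).stronglyMeasurable.smul_const (f j)).aestronglyMeasurable
  have hpm : ∀ n, AEStronglyMeasurable (fun ω => ∑ j ∈ Finset.range n, ξ j ω • f j) P :=
    fun n => (Finset.stronglyMeasurable_fun_sum _ fun j _ =>
      (hξ.measurable j).stronglyMeasurable.smul_const (f j)).aestronglyMeasurable
  have hqm : AEStronglyMeasurable
      (fun ω => ∑ j ∈ Finset.range (m N), (ξ j ω - ξhat j ω) • f j) P :=
    (Finset.stronglyMeasurable_fun_sum _ fun j hj => ((hξ.measurable j).sub
      (hopt j (Finset.mem_range.1 hj)).1.1).stronglyMeasurable.smul_const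
        (f j)).aestronglyMeasurable
  have hp1 : 1 ≤ ENNReal.ofReal (max 1 r) := by
    rw [← ENNReal.ofReal_one]; exact ENNReal.ofReal_le_ofReal (le_max_left _ _)
  have hsplit : (fun ω => Y ω - Xhat ω) =
      (fun ω => Y ω - ∑ j ∈ Finset.range (m N), ξ j ω • f j) +
        fun ω => ∑ j ∈ Finset.range (m N), (ξ j ω - ξhat j ω) • f j := by
    funext ω
    simp only [Pi.add_apply, hXhat, sub_smul, Finset.sum_sub_distrib]
    abel
  have herr : lrError r P Y Xhat ≤
      eLpNorm (fun ω => Y ω - ∑ j ∈ Finset.range (m N), ξ j ω • f j)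
        (ENNReal.ofReal (max 1 r)) P + ENNReal.ofReal (Q * S) := by
    rw [lrError_eq_eLpNorm hr]
    have hm' : AEStronglyMeasurable (fun ω => Y ω - Xhat ω) P := by
      rw [hsplit]; exact (hYm.sub (hpm _)).add hqm
    refine (eLpNorm_le_eLpNorm_of_exponent_le
      (ENNReal.ofReal_le_ofReal (le_max_right 1 r)) hm').trans ?_
    rw [hsplit]
    exact (eLpNorm_add_le (hYm.sub (hpm _)) hqm hp1).trans (add_le_add le_rfl hquant')
  have hfinish : ∀ {V R A : ℝ}, 0 ≤ V → 0 ≤ R → A ≤ A₁ + A₂ → S + V ≤ A * R →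
      ENNReal.ofReal (K * V) + ENNReal.ofReal (Q * S) ≤
        ENNReal.ofReal ((K + Q) * (A₁ + A₂) * R) := by
    intro V R A hV hR hA h
    rw [← ENNReal.ofReal_add (by positivity) (by positivity)]
    apply ENNReal.ofReal_le_ofReal
    have h1 := mul_nonneg hK.le hS0
    have h2 := mul_nonneg hQ.le hV
    calc K * V + Q * S ≤ (K + Q) * (S + V) := by linarith
      _ ≤ (K + Q) * ((A₁ + A₂) * R) := by
          have : A * R ≤ (A₁ + A₂) * R := by gcongr
          gcongr
          linarith
      _ = _ := by ring
  constructor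
  · have h1 := hrate₁ N hN
    have e1 : θ - 1 / 2 + γ + 1 / 2 = θ + γ := by ring
    rw [e1] at h1
    rw [rate, mul_div_assoc]
    refine herr.trans ((add_le_add_left htail'.1 _).trans (hfinish ?_ ?_ ?_ h1))
    · positivity
    · positivity
    · linarith
  · intro hb
    have h1 := hrate₂ N hN
    have e1 : θ - 1 / 2 + γ + 0 = θ + γ - 1 / 2 := by ring
    rw [e1, add_zero] at h1
    rw [rate, mul_div_assoc]
    refine herr.trans ((add_le_add_left (htail'.2 hb) _).trans (hfinish ?_ ?_ ?_ h1))
    · positivity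
    · positivity
    · linarith

end ErrorBound

end ProdQuant

theorem theorem2 (d : ℕ) (hd : 1 ≤ d) (T : ℝ) (hT : 0 < T)
    (θ γ : ℝ) (hθ : 1 / 2 < θ) (hγ : 0 ≤ γ)
    (a : ℝ≥0) (ha₀ : 0 < a) (ha₁ : a ≤ 1) (b C₁ C₂ : ℝ) (r : ℝ) (hr : 0 < r) :
    -- bounds for the minimal product quantization error, uniform over all `X`, `f`
    (∃ C : ℝ, ∀ (Ω Ω' : Type*) [MeasurableSpace Ω] [MeasurableSpace Ω']
      (P : Measure Ω) [IsProbabilityMeasure P] (P' : Measure Ω') [IsProbabilityMeasure P']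
      (ξ : ℕ → Ω → ℝ) (X : Ω' → ProdQuant.PathSpace T d) (f : ℕ → ProdQuant.PathSpace T d),
      ProdQuant.IsStdNormalSeq P ξ → ProdQuant.IsAdmissible P ξ P' X f →
      ProdQuant.SizeCondition θ γ C₁ f → ProdQuant.HolderCondition a b C₂ f →
      ∀ N : ℕ, 3 ≤ N →
        ProdQuant.prodError r P ξ P' X N ≤ ProdQuant.rate C (θ + γ) θ N ∧
        (b + θ ≤ 0 →
          ProdQuant.prodError r P ξ P' X N ≤ ProdQuant.rate C (θ + γ - 1 / 2) θ N)) ∧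
    -- the lengths `m(N)` can be chosen as required
    (∃ m : ℕ → ℕ, ProdQuant.IsLengthChoice θ γ m) ∧
    -- for every such choice, the tuned product quantization with respect to `f` exists
    -- and achieves the rates
    (∀ m : ℕ → ℕ, ProdQuant.IsLengthChoice θ γ m →
      ∃ C : ℝ, ∀ (Ω Ω' : Type*) [MeasurableSpace Ω] [MeasurableSpace Ω']
        (P : Measure Ω) [IsProbabilityMeasure P] (P' : Measure Ω') [IsProbabilityMeasure P']
        (ξ : ℕ → Ω → ℝ) (X : Ω' → ProdQuant.PathSpace T d) (f : ℕ → ProdQuant.PathSpace T d)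
        (Y : Ω → ProdQuant.PathSpace T d),
        ProdQuant.IsStdNormalSeq P ξ → ProdQuant.IsRealization P ξ P' X f Y →
        ProdQuant.SizeCondition θ γ C₁ f → ProdQuant.HolderCondition a b C₂ f →
        ∀ N : ℕ, 3 ≤ N →
          (∃ Xhat : Ω → ProdQuant.PathSpace T d,
            ProdQuant.IsProductQuantization r P ξ f N (m N)
              (ProdQuant.levels θ γ N (m N)) Xhat) ∧
          ∀ Xhat : Ω → ProdQuant.PathSpace T d,
            ProdQuant.IsProductQuantization r P ξ f N (m N)
              (ProdQuant.levels θ γ N (m N)) Xhat →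
            ProdQuant.lrError r P Y Xhat ≤ ProdQuant.rate C (θ + γ) θ N ∧
            (b + θ ≤ 0 →
              ProdQuant.lrError r P Y Xhat ≤ ProdQuant.rate C (θ + γ - 1 / 2) θ N)) := by
  have hθ' : 0 < θ := by linarith
  have hex := ProdQuant.exists_isLengthChoice hθ' hγ
  refine ⟨?_, hex, fun m hm => ?_⟩
  · obtain ⟨m, hm⟩ := hex
    obtain ⟨C, hC⟩ := ProdQuant.exists_lrError_le_rate hT hd b C₁ C₂ hθ hγ ha₀ hr hm
    refine ⟨C, fun Ω Ω' _ _ P _ P' _ ξ X f hξ hX hf hf' N hN => ?_⟩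
    obtain ⟨Y, hY⟩ := hX
    obtain ⟨Xhat, hXhat⟩ := ProdQuant.exists_isProductQuantization hθ' hγ hr hξ f
      (hm.pos N hN) (hm.mem N hN)
    have hle : ProdQuant.prodError r P ξ P' X N ≤ ProdQuant.lrError r P Y Xhat :=
      sInf_le ⟨f, Y, m N, _, Xhat, hY, hXhat, rfl⟩
    have hrate := hC Ω P ξ f Y hξ hY.1 hf hf' N hN Xhat hXhat
    exact ⟨hle.trans hrate.1, fun hb => hle.trans (hrate.2 hb)⟩
  · obtain ⟨C, hC⟩ := ProdQuant.exists_lrError_le_rate hT hd b C₁ C₂ hθ hγ ha₀ hr hm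
    refine ⟨C, fun Ω Ω' _ _ P _ P' _ ξ X f Y hξ hY hf hf' N hN => ⟨?_, ?_⟩⟩
    · exact ProdQuant.exists_isProductQuantization hθ' hγ hr hξ f (hm.pos N hN) (hm.mem N hN)
    · exact hC Ω P ξ f Y hξ hY.1 hf hf' N hN
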